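/- Let $\alpha,\beta,\lambda>0$. There is a constant $\eta_0>0$, depending only on $\alpha,\beta,\lambda$, with the following property. Let $C_A,C_B\ge 0$ satisfy $C_A+C_B<\eta_0$. Then there are constants $C,C'>0$, depending only on $\alpha,\beta,\lambda,C_A,C_B$, such that for every $d$ and all maps $A,B:\mathbf R^d\to\mathbf R^d$ with $B$ odd and $$|A(q_1)-A(q_2)|\le C_A|q_1-q_2|,\qquad |B(q_1)-B(q_2)|\le C_B|q_1-q_2|\qquad (q_1,q_2\in\mathbf R^d),$$ the following holds for the generalised Vlasov equation on $\mathbf R^{3d}\ni(q,p,z)$, $$\partial_t\rho_t=-p\cdot\nabla_q\rho_t+\left[\beta q+A(q)+B*\rho_t(q)-\lambda z\right]\cdot\nabla_p\rho_t+\operatorname{div}_z[(\lambda p+\alpha z)\rho_t]+\Delta_z\rho_t,\qquad B*\rho_t(q)=\int_{\mathbf R^{3d}}B(q-q')\,d\rho_t(q',p',z').$$ Let $\mathcal P_2(\mathbf R^{3d})$ be the set of probability measures on $\mathbf R^{3d}$ with finite second moment, and $W_2$ the quadratic Wasserstein distance on it for the Euclidean norm, i.e. $W_2(\mu,\nu)^2=\inf\int|x-y|^2\,d\pi(x,y)$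 over all couplings $\pi$ of $\mu$ and $\nu$. A solution is a narrowly continuous curve $(\rho_t)_{t\ge0}$ in $\mathcal P_2(\mathbf R^{3d})$, with $\int_0^T\int|x|\,d\rho_t(x)\,dt<\infty$ for every $T>0$, which satisfies the equation in the sense of distributions, i.e. tested against functions in $C_c^\infty(\mathbf R^{3d})$, with initial value $\rho_0$. 1. Any two solutions $(\rho_t)_{t\ge0}$ and $(\overline\rho_t)_{t\ge0}$, with initial data $\rho_0,\overline\rho_0\in\mathcal P_2(\mathbf R^{3d})$, satisfy $$W_2(\rho_t,\overline\rho_t)\le C'e^{-Ct}\,W_2(\rho_0,\overline\rho_0)\qquad\text{for all }t\ge0.$$ 2. The equation has a unique stationary solution $\rho_\infty\in\mathcal P_2(\mathbf R^{3d})$, and every solution $(\rho_t)_{t\ge0}$ satisfies $$W_2(\rho_t,\rho_\infty)\le C'e^{-Ct}\,W_2(\rho_0,\rho_\infty)\qquad\text{for all }t\ge0.$$ -/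

import Mathlib

open MeasureTheory Set
open scoped ENNReal

namespace GenVlasov

/-- The space `ℝ^d` with its Euclidean norm. -/
abbrev Vec (d : ℕ) : Type := EuclideanSpace ℝ (Fin d)

/-- The phase space `ℝ^{3d}`, with coordinates `(q, p, z)`. Its topology, Borel structure and
smooth structure are the usual ones; Euclidean lengths are written out by `sqNorm`. -/
abbrev Phase (d : ℕ) : Type := Vec d × Vec d × Vec d

/-- The squared Euclidean norm `|q|² + |p|² + |z|²` on `ℝ^{3d}`. -/
noncomputable def sqNorm {d : ℕ} (x : Phase d) : ℝ := ‖x.1‖ ^ 2 + ‖x.2.1‖ ^ 2 + ‖x.2.2‖ ^ 2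

/-- Membership in `𝒫₂(ℝ^{3d})`: the second moment is finite. -/
def FiniteSecondMoment {d : ℕ} (μ : ProbabilityMeasure (Phase d)) : Prop :=
  ∫⁻ x, ENNReal.ofReal (sqNorm x) ∂(μ : Measure (Phase d)) < ⊤

/-- A coupling of `μ` and `ν`: the joint law of two random variables with laws `μ` and `ν`. -/
def IsCoupling {d : ℕ} (π : Measure (Phase d × Phase d)) (μ ν : ProbabilityMeasure (Phase d)) :
    Prop :=
  π.map Prod.fst = (μ : Measure (Phase d)) ∧ π.map Prod.snd = (ν : Measure (Phase d))

/-- The Wasserstein distance `W₂`, as an extended nonnegative real (it is finite on `𝒫₂`):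
the square root of the infimum of `𝔼 (|Q - Q'|² + |P - P'|² + |Z - Z'|²)` over all couplings. -/
noncomputable def W2 {d : ℕ} (μ ν : ProbabilityMeasure (Phase d)) : ℝ≥0∞ :=
  (⨅ (π : Measure (Phase d × Phase d)) (_ : IsCoupling π μ ν),
    ∫⁻ w, ENNReal.ofReal (sqNorm (w.1 - w.2)) ∂π) ^ (1 / 2 : ℝ)

/-- The mean-field force `(B ∗ μ)(q) = ∫ B(q - q') dμ(q', p', z')`. -/
noncomputable def meanField {d : ℕ} (B : Vec d → Vec d) (μ : ProbabilityMeasure (Phase d))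
    (q : Vec d) : Vec d :=
  ∫ y, B (q - y.1) ∂(μ : Measure (Phase d))

/-- The drift `(p, -(β q + A(q) + B ∗ μ(q) - λ z), -(λ p + α z))` of the dynamics at the
measure `μ`. -/
noncomputable def drift {d : ℕ} (α β lam : ℝ) (A B : Vec d → Vec d)
    (μ : ProbabilityMeasure (Phase d)) (x : Phase d) : Phase d :=
  (x.2.1,
    -(β • x.1 + A x.1 + meanField B μ x.1 - lam • x.2.2),
    -(lam • x.2.1 + α • x.2.2))

/-- The formal adjoint of the right-hand side of the generalised Vlasov equation, with the
mean-field term frozen at `μ`, applied to a test function `φ`: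
`p·∇_q φ - (β q + A(q) + B ∗ μ(q) - λ z)·∇_p φ - (λ p + α z)·∇_z φ + Δ_z φ`. -/
noncomputable def generator {d : ℕ} (α β lam : ℝ) (A B : Vec d → Vec d)
    (μ : ProbabilityMeasure (Phase d)) (φ : Phase d → ℝ) (x : Phase d) : ℝ :=
  fderiv ℝ φ x (drift α β lam A B μ x)
    + Laplacian.laplacian (fun z : Vec d => φ (x.1, x.2.1, z)) x.2.2

/-- `(ρ_t)_{t ≥ 0}` (the values at negative times are irrelevant) is a measure-valued solution
in `𝒫₂(ℝ^{3d})`, in the sense of distributions, of the generalised Vlasov equation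
`∂_t ρ = -p·∇_q ρ + (β q + A(q) + B ∗ ρ(q) - λ z)·∇_p ρ + div_z((λ p + α z) ρ) + Δ_z ρ`.
-/
structure IsSolution {d : ℕ} (α β lam : ℝ) (A B : Vec d → Vec d)
    (ρ : ℝ → ProbabilityMeasure (Phase d)) : Prop where
  /-- every `ρ_t` lies in `𝒫₂` -/
  secondMoment : ∀ t, 0 ≤ t → FiniteSecondMoment (ρ t)
  /-- `t ↦ ρ_t` is narrowly continuous on `[0, ∞)` -/
  narrowlyContinuous : ContinuousOn ρ (Ici 0)
  /-- the coefficients, which grow linearly, are integrable over bounded time intervals -/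
  integrable_coeff : ∀ T, 0 ≤ T →
    ∫⁻ t in Icc 0 T, ∫⁻ x, ‖x‖ₑ ∂(ρ t : Measure (Phase d)) < ⊤
  /-- the equation, tested against smooth compactly supported functions -/
  weak_integrable : ∀ φ : Phase d → ℝ, ContDiff ℝ (⊤ : ℕ∞) φ → HasCompactSupport φ → ∀ t, 0 ≤ t →
    IntervalIntegrable
      (fun s => ∫ x, generator α β lam A B (ρ s) φ x ∂(ρ s : Measure (Phase d))) volume 0 t
  weak_eq : ∀ φ : Phase d → ℝ, ContDiff ℝ (⊤ : ℕ∞) φ → HasCompactSupport φ → ∀ t, 0 ≤ t →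
    ∫ x, φ x ∂(ρ t : Measure (Phase d)) - ∫ x, φ x ∂(ρ 0 : Measure (Phase d)) =
      ∫ s in (0 : ℝ)..t, ∫ x, generator α β lam A B (ρ s) φ x ∂(ρ s : Measure (Phase d))

/-- `μ` is a stationary solution: the curve that is constantly `μ` is a solution. -/
def IsStationary {d : ℕ} (α β lam : ℝ) (A B : Vec d → Vec d)
    (μ : ProbabilityMeasure (Phase d)) : Prop :=
  IsSolution α β lam A B (fun _ => μ)

end GenVlasov

/-! The contraction comes from a synchronous coupling. If two solutions are driven by the same
noise, the noise cancels in their difference. What remains is a damped linear system, perturbed in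
the momentum by a force with Lipschitz constant `C_A + C_B` and by the difference of the two mean
fields. The friction acts on `z` only, but it reaches `p` and then `q` through the linear couplings.
This is hypocoercivity: the twisted quadratic form `lyap`, with small cross terms `q·p` and `p·z`,
decays along the linear flow (`exists_form`), and its decay survives small perturbations
(`exists_isLyapunov`).

Solutions are only distributional, so no process is given that could be coupled. Time discretisation
replaces it. With the drift frozen along a solution, the equation is a linear Fokker-Planck equation
with Lipschitz drift, and `IsFPSolution.tendsto_schemeLaw` shows that the Euler scheme with this
drift and a finitely valued noise converges narrowly to the solution. The proof is by duality. For
Lipschitz `u`, the integral of `u` under the scheme is compared with the integral of a mollification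
of `u` under the solution. One step of the scheme replaces `u` by `eulerOp` of `u`, whose Lipschitz
constant is larger by a factor `1 + τ L` at most. The error of a step
(`IsFPSolution.exists_local_error`) is `τ` times the sum of a part proportional to the mollification
radius, the time modulus of the drift, and `√τ` times a constant that depends on the kernel; the
radius is therefore fixed before `τ` tends to zero.

Running two such schemes with common noise yields explicit couplings. Their marginals converge,
hence they are tight, and a limit couples the two solutions without increasing the cost
(`exists_coupling_of_tendsto`). The outcome is `IsLyapunov.exists_coupling_le`: if the squared
difference of the mean fields is at most `V` times `exp (-γ s / 2)`, then the cost decays at the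
same rate, with prefactor `r + 2 K V / γ`. That squared difference is in turn at most `C_B ^ 2 / c₁`
times the cost. For small `C_B` the feedback factor is at most `1/2`, so that iteration from a crude
a priori bound improves the prefactor to `2 r` (`IsLyapunov.exists_coupling_iterate`). Taking the
infimum over initial couplings, and comparing `lyap` with the Euclidean form, gives the contraction
in `W2`.

The stationary solution is a limit of almost fixed points of the nonlinear Euler step, whose drift
is evaluated at the current law. This step preserves a bound on the Lyapunov moment and contracts
the transport cost, so consecutive iterates become as close as desired
(`IsLyapunov.exists_almost_fixed`). Consistency of the scheme then makes the integral of the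
generator of order `√τ` (`IsLyapunov.exists_abs_integral_generator_le`). A narrow limit point as `τ`
tends to zero is stationary: the integral of the generator, quadratic in the measure, is the
integral of the continuous function `pairGen` against the product measure. Uniqueness is the
contraction applied to two constant curves. -/

namespace GenVlasov

/-! ### Directional derivatives, Taylor estimates and mollification. -/

section Mollification

variable {E : Type*} [NormedAddCommGroup E] [NormedSpace ℝ E]

/-- The derivative of `φ` in the direction `v`, as a function of the base point. -/
noncomputable def dirDeriv (v : E) (φ : E → ℝ) (x : E) : ℝ := fderiv ℝ φ x v

lemma contDiff_dirDeriv {φ : E → ℝ} (hφ : ContDiff ℝ (⊤ : ℕ∞) φ) (v : E) :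
    ContDiff ℝ (⊤ : ℕ∞) (dirDeriv v φ) := by
  have h : ContDiff ℝ (⊤ : ℕ∞) (fderiv ℝ φ) := hφ.fderiv_right (by simp)
  exact h.clm_apply contDiff_const

lemma hasCompactSupport_dirDeriv {φ : E → ℝ} (hφ : HasCompactSupport φ) (v : E) :
    HasCompactSupport (dirDeriv v φ) :=
  hφ.fderiv_apply (𝕜 := ℝ) v

lemma hasDerivAt_line {φ : E → ℝ} (hφ : Differentiable ℝ φ) (x v : E) (r : ℝ) :
    HasDerivAt (fun r : ℝ => φ (x + r • v)) (dirDeriv v φ (x + r • v)) r := by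
  have h1 : HasDerivAt (fun r : ℝ => x + r • v) v r := by
    simpa using ((hasDerivAt_id r).smul_const v).const_add x
  exact (hφ (x + r • v)).hasFDerivAt.comp_hasDerivAt r h1

/-- The mean value inequality along the segment, after subtraction of the linear part. Only the
oscillation of the first derivative enters. -/
lemma abs_taylor_one_le {φ : E → ℝ} (hφ : Differentiable ℝ φ) {x v : E} {c : ℝ}
    (h : ∀ r ∈ Icc (0 : ℝ) 1, |dirDeriv v φ (x + r • v) - dirDeriv v φ x| ≤ c) :
    |φ (x + v) - φ x - dirDeriv v φ x| ≤ c := by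
  have h1 : ∀ r ∈ Icc (0 : ℝ) 1, HasDerivWithinAt
      (fun r : ℝ => φ (x + r • v) - r * dirDeriv v φ x)
      (dirDeriv v φ (x + r • v) - dirDeriv v φ x) (Icc 0 1) r := by
    intro r _
    exact (((hasDerivAt_line hφ x v r).sub
      ((hasDerivAt_id r).mul_const (dirDeriv v φ x))).congr_deriv (by simp)).hasDerivWithinAt
  have := norm_image_sub_le_of_norm_deriv_le_segment_01' h1
    (fun r hr => h r ⟨hr.1, hr.2.le⟩)
  simpa [Real.norm_eq_abs, sub_right_comm] using this

/-- Two applications of the mean value inequality along the line; the symmetric sum removes the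
first-order term. Only the oscillation of the pure second derivative along `v` is needed, which is
all that the noise of the scheme sees. -/
lemma abs_second_difference_le {φ : E → ℝ} (hφ : ContDiff ℝ (⊤ : ℕ∞) φ) {x v : E} {c : ℝ}
    (h : ∀ r : ℝ, |r| ≤ 1 →
      |dirDeriv v (dirDeriv v φ) (x + r • v) - dirDeriv v (dirDeriv v φ) x| ≤ c) :
    |φ (x + v) + φ (x - v) - 2 * φ x - dirDeriv v (dirDeriv v φ) x| ≤ 2 * c := by
  set D := dirDeriv v φ with hD
  set G := dirDeriv v D with hG
  have hφ1 : Differentiable ℝ φ := hφ.differentiable (by simp)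
  have hD1 : Differentiable ℝ D := (contDiff_dirDeriv hφ v).differentiable (by simp)
  have neg : ∀ (ψ : E → ℝ) (_ : Differentiable ℝ ψ) (r : ℝ),
      HasDerivAt (fun r : ℝ => ψ (x - r • v)) (- dirDeriv v ψ (x - r • v)) r := by
    intro ψ hψ r
    have := hasDerivAt_line hψ x (-v) r
    simpa [dirDeriv, sub_eq_add_neg] using this
  have h2 : ∀ r ∈ Icc (0 : ℝ) 1, HasDerivWithinAt
      (fun r : ℝ => D (x + r • v) - D (x - r • v) - 2 * r * G x)
      (G (x + r • v) + G (x - r • v) - 2 * G x) (Icc 0 1) r := by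
    intro r _
    exact ((((hasDerivAt_line hD1 x v r).sub (neg D hD1 r)).sub
      (((hasDerivAt_id r).const_mul 2).mul_const (G x))).congr_deriv
        (by simp [hG])).hasDerivWithinAt
  have b2 : ∀ r ∈ Icc (0 : ℝ) 1, |D (x + r • v) - D (x - r • v) - 2 * r * G x| ≤ 2 * c := by
    intro r hr
    have h0 : 0 ≤ c := (abs_nonneg _).trans (h 0 (by simp))
    have := norm_image_sub_le_of_norm_deriv_le_segment' (C := 2 * c) h2 (fun r hr => by
      have a1 := h r (abs_le.2 ⟨by linarith [hr.1], hr.2.le⟩)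
      have a2 := h (-r) (by rw [abs_neg]; exact abs_le.2 ⟨by linarith [hr.1], hr.2.le⟩)
      rw [neg_smul, ← sub_eq_add_neg] at a2
      rw [Real.norm_eq_abs, abs_le]
      rw [abs_le] at a1 a2
      constructor <;> linarith [a1.1, a1.2, a2.1, a2.2]) r hr
    have e : D (x + r • v) - D (x - r • v) - 2 * r * G x - (D (x + (0:ℝ) • v) - D (x - (0:ℝ) • v)
      - 2 * 0 * G x) = D (x + r • v) - D (x - r • v) - 2 * r * G x := by simp
    rw [e, Real.norm_eq_abs] at this
    refine this.trans ?_
    nlinarith [hr.1, hr.2]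
  have h1 : ∀ r ∈ Icc (0 : ℝ) 1, HasDerivWithinAt
      (fun r : ℝ => φ (x + r • v) + φ (x - r • v) - r ^ 2 * G x)
      (D (x + r • v) - D (x - r • v) - 2 * r * G x) (Icc 0 1) r := by
    intro r _
    exact ((((hasDerivAt_line hφ1 x v r).add (neg φ hφ1 r)).sub
      (((hasDerivAt_id r).pow 2).mul_const (G x))).congr_deriv
        (by simp [hD, sub_eq_add_neg])).hasDerivWithinAt
  have := norm_image_sub_le_of_norm_deriv_le_segment_01' h1
    (fun r hr => b2 r ⟨hr.1, hr.2.le⟩)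
  rw [Real.norm_eq_abs] at this
  refine le_of_eq_of_le (congrArg abs ?_) this
  simp
  ring

/-- A smooth probability density supported in the ball of radius `δ`. -/
structure IsMollifier [MeasureSpace E] (k : E → ℝ) (δ : ℝ) : Prop where
  contDiff : ContDiff ℝ (⊤ : ℕ∞) k
  hasCompactSupport : HasCompactSupport k
  nonneg : ∀ y, 0 ≤ k y
  integral_eq_one : ∫ y, k y = 1
  norm_lt : ∀ y, k y ≠ 0 → ‖y‖ < δ

variable [MeasureSpace E]

/-- The convolution `g ⋆ u` of two real functions. -/
noncomputable def moll (g u : E → ℝ) (x : E) : ℝ := ∫ y, g y * u (x - y)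

variable [BorelSpace E] [FiniteDimensional ℝ E] [(volume : Measure E).IsAddHaarMeasure]

lemma exists_isMollifier {δ : ℝ} (hδ : 0 < δ) : ∃ k : E → ℝ, IsMollifier k δ := by
  let B : ContDiffBump (0 : E) := ⟨δ / 2, δ, by positivity, by linarith⟩
  refine ⟨B.normed volume, B.contDiff_normed, B.hasCompactSupport_normed, B.nonneg_normed,
    B.integral_normed, fun y hy => ?_⟩
  have : y ∈ Function.support (B.normed volume) := hy
  rw [B.support_normed_eq] at this
  simpa using this

omit [NormedSpace ℝ E] [FiniteDimensional ℝ E] in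
lemma integrable_mul_comp_sub {g u : E → ℝ} (hg : Continuous g) (hgc : HasCompactSupport g)
    (hu : Continuous u) (x : E) : Integrable (fun y => g y * u (x - y)) := by
  refine Continuous.integrable_of_hasCompactSupport (by fun_prop) ?_
  exact hgc.mul_right

lemma contDiff_moll {g u : E → ℝ} (hg : ContDiff ℝ (⊤ : ℕ∞) g) (hgc : HasCompactSupport g)
    (hu : Continuous u) : ContDiff ℝ (⊤ : ℕ∞) (moll g u) :=
  hgc.contDiff_convolution_left (ContinuousLinearMap.mul ℝ ℝ) hg hu.locallyIntegrable

lemma dirDeriv_moll {g u : E → ℝ} (hg : ContDiff ℝ (⊤ : ℕ∞) g) (hgc : HasCompactSupport g)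
    (hu : Continuous u) (v : E) : dirDeriv v (moll g u) = moll (dirDeriv v g) u := by
  ext x
  have h := hgc.hasFDerivAt_convolution_left (ContinuousLinearMap.mul ℝ ℝ) (μ := volume)
    (hg.of_le (by simp)) hu.locallyIntegrable x
  have h' : fderiv ℝ (moll g u) x = _ := h.fderiv
  rw [dirDeriv, h', convolution, ContinuousLinearMap.integral_apply]
  · rfl
  · exact (hgc.fderiv ℝ).convolutionExists_left
      ((ContinuousLinearMap.mul ℝ ℝ).precompL E) (hg.continuous_fderiv (by simp))
      hu.locallyIntegrable x

omit [NormedSpace ℝ E] [FiniteDimensional ℝ E] in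
-- The common source of the bounds on mollified functions. The kernel `g` may be a mollifier or one
-- of its derivatives, and both the function and the base point may change.
lemma abs_moll_sub_moll_le {g u w : E → ℝ} (hg : Continuous g) (hgc : HasCompactSupport g)
    (hu : Continuous u) (hw : Continuous w) {x x' : E} {c : ℝ}
    (h : ∀ y, g y ≠ 0 → |u (x - y) - w (x' - y)| ≤ c) :
    |moll g u x - moll g w x'| ≤ c * ∫ y, |g y| := by
  rw [moll, moll, ← integral_sub (integrable_mul_comp_sub hg hgc hu x)
    (integrable_mul_comp_sub hg hgc hw x'), ← integral_const_mul, ← Real.norm_eq_abs]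
  have hi : Integrable g := hg.integrable_of_hasCompactSupport hgc
  refine norm_integral_le_of_norm_le (hi.abs.const_mul c) (Filter.Eventually.of_forall ?_)
  intro y
  rw [← mul_sub, norm_mul, mul_comm, Real.norm_eq_abs, Real.norm_eq_abs]
  by_cases hy : g y = 0
  · simp [hy]
  · exact mul_le_mul_of_nonneg_right (h y hy) (abs_nonneg _)

omit [FiniteDimensional ℝ E] [BorelSpace E] [(volume : Measure E).IsAddHaarMeasure] in
lemma IsMollifier.integral_abs {k : E → ℝ} {δ : ℝ} (hk : IsMollifier k δ) :
    ∫ y, |k y| = 1 := by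
  rw [← hk.integral_eq_one]
  exact integral_congr_ae (Filter.Eventually.of_forall fun y => abs_of_nonneg (hk.nonneg y))

omit [FiniteDimensional ℝ E] in
lemma IsMollifier.abs_moll_sub_le {k : E → ℝ} {δ : ℝ} (hk : IsMollifier k δ) {u : E → ℝ}
    (hu : Continuous u) {x : E} {c : ℝ} (h : ∀ y, ‖y‖ < δ → |u (x - y) - u x| ≤ c) :
    |moll k u x - u x| ≤ c := by
  have e : moll k (fun _ => u x) x = u x := by
    simp [moll, integral_mul_const, hk.integral_eq_one]
  have := abs_moll_sub_moll_le hk.contDiff.continuous hk.hasCompactSupport hu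
    (continuous_const (y := u x)) (x := x) (x' := x) (fun y hy => h y (hk.norm_lt y hy))
  rwa [e, hk.integral_abs, mul_one] at this

/-- The `L¹` norm of the gradient of `k`. -/
noncomputable def gradMass (k : E → ℝ) : ℝ := ∫ y, ‖fderiv ℝ k y‖

omit [FiniteDimensional ℝ E] [BorelSpace E] [(volume : Measure E).IsAddHaarMeasure] in
lemma gradMass_nonneg (k : E → ℝ) : 0 ≤ gradMass k := integral_nonneg fun _ => norm_nonneg _

omit [FiniteDimensional ℝ E] in
lemma integral_abs_dirDeriv_le {k : E → ℝ} (hk : ContDiff ℝ (⊤ : ℕ∞) k)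
    (hkc : HasCompactSupport k) (v : E) : ∫ y, |dirDeriv v k y| ≤ gradMass k * ‖v‖ := by
  rw [gradMass, ← integral_mul_const]
  refine integral_mono ?_ ?_ fun y => ?_
  · exact ((contDiff_dirDeriv hk v).continuous.integrable_of_hasCompactSupport
      (hasCompactSupport_dirDeriv hkc v)).abs
  · exact ((hk.continuous_fderiv (by simp)).integrable_of_hasCompactSupport
      (hkc.fderiv ℝ)).norm.mul_const _
  · exact (fderiv ℝ k y).le_opNorm v

lemma abs_dirDeriv_moll_sub_le {k u : E → ℝ} (hk : ContDiff ℝ (⊤ : ℕ∞) k)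
    (hkc : HasCompactSupport k) (hu : Continuous u) {x x' v : E} {c : ℝ} (hc : 0 ≤ c)
    (h : ∀ y, |u (x - y) - u (x' - y)| ≤ c) :
    |dirDeriv v (moll k u) x - dirDeriv v (moll k u) x'| ≤ c * (gradMass k * ‖v‖) := by
  rw [dirDeriv_moll hk hkc hu]
  refine (abs_moll_sub_moll_le (contDiff_dirDeriv hk v).continuous
    (hasCompactSupport_dirDeriv hkc v) hu hu (fun y _ => h y)).trans ?_
  exact mul_le_mul_of_nonneg_left (integral_abs_dirDeriv_le hk hkc v) hc

lemma dirDeriv_dirDeriv_moll {k u : E → ℝ} (hk : ContDiff ℝ (⊤ : ℕ∞) k)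
    (hkc : HasCompactSupport k) (hu : Continuous u) (v w : E) :
    dirDeriv w (dirDeriv v (moll k u)) = moll (dirDeriv w (dirDeriv v k)) u := by
  rw [dirDeriv_moll hk hkc hu, dirDeriv_moll (contDiff_dirDeriv hk v)
    (hasCompactSupport_dirDeriv hkc v) hu]

end Mollification

/-! ### Approximation of functions with bounded derivatives by compactly supported ones. -/

section Cutoff

variable {E : Type*} [NormedAddCommGroup E] [NormedSpace ℝ E] {ι : Type*} [Fintype ι]

/-- The second-order operator `∑ i, ∂_{e i}²`. -/
noncomputable def dirLaplacian (e : ι → E) (φ : E → ℝ) (x : E) : ℝ :=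
  ∑ i, dirDeriv (e i) (dirDeriv (e i) φ) x

lemma contDiff_dirLaplacian {φ : E → ℝ} (hφ : ContDiff ℝ (⊤ : ℕ∞) φ) (e : ι → E) :
    ContDiff ℝ (⊤ : ℕ∞) (dirLaplacian e φ) :=
  ContDiff.sum fun i _ => contDiff_dirDeriv (contDiff_dirDeriv hφ (e i)) (e i)

lemma dirDeriv_const (a : ℝ) (v : E) : dirDeriv v (fun _ : E => a) = fun _ => 0 := by
  ext x
  simp [dirDeriv]

lemma dirLaplacian_const (a : ℝ) (e : ι → E) : dirLaplacian e (fun _ : E => a) = fun _ => 0 := by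
  ext x
  simp [dirLaplacian, dirDeriv_const]

lemma dirDeriv_add {f g : E → ℝ} (hf : Differentiable ℝ f) (hg : Differentiable ℝ g) (v : E) :
    dirDeriv v (fun x => f x + g x) = fun x => dirDeriv v f x + dirDeriv v g x := by
  ext x
  simp [dirDeriv, fderiv_fun_add (hf x) (hg x)]

lemma dirDeriv_sub {f g : E → ℝ} (hf : Differentiable ℝ f) (hg : Differentiable ℝ g) (v : E) :
    dirDeriv v (fun x => f x - g x) = fun x => dirDeriv v f x - dirDeriv v g x := by
  ext x
  simp [dirDeriv, fderiv_fun_sub (hf x) (hg x)]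

lemma dirDeriv_mul {f g : E → ℝ} (hf : Differentiable ℝ f) (hg : Differentiable ℝ g) (v : E) :
    dirDeriv v (fun x => f x * g x) = fun x => f x * dirDeriv v g x + g x * dirDeriv v f x := by
  ext x
  simp [dirDeriv, fderiv_fun_mul (hf x) (hg x)]

lemma dirDeriv_comp_smul {f : E → ℝ} (hf : Differentiable ℝ f) (c : ℝ) (v : E) :
    dirDeriv v (fun x => f (c • x)) = fun x => c * dirDeriv v f (c • x) := by
  ext x
  have h1 : HasFDerivAt (fun x : E => c • x) (c • ContinuousLinearMap.id ℝ E) x :=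
    (hasFDerivAt_id x).const_smul c
  have h := (hf (c • x)).hasFDerivAt.comp x h1
  have h' : fderiv ℝ (fun x => f (c • x)) x = _ := h.fderiv
  simp [dirDeriv, h']

lemma dirDeriv_const_mul {f : E → ℝ} (hf : Differentiable ℝ f) (c : ℝ) (v : E) :
    dirDeriv v (fun x => c * f x) = fun x => c * dirDeriv v f x := by
  ext x
  simp [dirDeriv, fderiv_const_mul (hf x)]

lemma dirLaplacian_sub {f g : E → ℝ} (hf : ContDiff ℝ (⊤ : ℕ∞) f) (hg : ContDiff ℝ (⊤ : ℕ∞) g)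
    (e : ι → E) :
    dirLaplacian e (fun x => f x - g x) = fun x => dirLaplacian e f x - dirLaplacian e g x := by
  ext x
  simp only [dirLaplacian]
  rw [← Finset.sum_sub_distrib]
  refine Finset.sum_congr rfl fun i _ => ?_
  rw [dirDeriv_sub (hf.differentiable (by simp)) (hg.differentiable (by simp)),
    dirDeriv_sub ((contDiff_dirDeriv hf _).differentiable (by simp))
      ((contDiff_dirDeriv hg _).differentiable (by simp))]

lemma dirLaplacian_mul {f g : E → ℝ} (hf : ContDiff ℝ (⊤ : ℕ∞) f) (hg : ContDiff ℝ (⊤ : ℕ∞) g)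
    (e : ι → E) (x : E) :
    dirLaplacian e (fun x => f x * g x) x = f x * dirLaplacian e g x + g x * dirLaplacian e f x
      + 2 * ∑ i, dirDeriv (e i) f x * dirDeriv (e i) g x := by
  simp only [dirLaplacian]
  rw [Finset.mul_sum, Finset.mul_sum, Finset.mul_sum, ← Finset.sum_add_distrib,
    ← Finset.sum_add_distrib]
  refine Finset.sum_congr rfl fun i _ => ?_
  have hf0 : Differentiable ℝ f := hf.differentiable (by simp)
  have hg0 : Differentiable ℝ g := hg.differentiable (by simp)
  have hf1 : Differentiable ℝ (dirDeriv (e i) f) :=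
    (contDiff_dirDeriv hf _).differentiable (by simp)
  have hg1 : Differentiable ℝ (dirDeriv (e i) g) :=
    (contDiff_dirDeriv hg _).differentiable (by simp)
  rw [dirDeriv_mul hf0 hg0, dirDeriv_add (f := fun x => f x * dirDeriv (e i) g x)
    (g := fun x => g x * dirDeriv (e i) f x) (hf0.mul hg1) (hg0.mul hf1), dirDeriv_mul hf0 hg1,
    dirDeriv_mul hg0 hf1]
  ring

lemma dirLaplacian_comp_smul {f : E → ℝ} (hf : ContDiff ℝ (⊤ : ℕ∞) f) (c : ℝ) (e : ι → E) (x : E) :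
    dirLaplacian e (fun x => f (c • x)) x = c ^ 2 * dirLaplacian e f (c • x) := by
  simp only [dirLaplacian]
  rw [Finset.mul_sum]
  refine Finset.sum_congr rfl fun i _ => ?_
  have hf0 : Differentiable ℝ f := hf.differentiable (by simp)
  have hf1 : Differentiable ℝ (dirDeriv (e i) f) :=
    (contDiff_dirDeriv hf _).differentiable (by simp)
  rw [dirDeriv_comp_smul hf0, dirDeriv_const_mul
    (f := fun x => dirDeriv (e i) f (c • x)) (hf1.comp (differentiable_id.const_smul c)),
    dirDeriv_comp_smul hf1]
  ring

lemma dirDeriv_congr {f g : E → ℝ} {x : E} (h : f =ᶠ[nhds x] g) (v : E) :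
    dirDeriv v f =ᶠ[nhds x] dirDeriv v g := by
  filter_upwards [h.fderiv (𝕜 := ℝ)] with y hy
  simp [dirDeriv, hy]

lemma dirLaplacian_congr {f g : E → ℝ} {x : E} (h : f =ᶠ[nhds x] g) (e : ι → E) :
    dirLaplacian e f x = dirLaplacian e g x :=
  Finset.sum_congr rfl fun i _ => (dirDeriv_congr (dirDeriv_congr h (e i)) (e i)).eq_of_nhds

lemma abs_dirDeriv_le_of_lipschitz {f : E → ℝ} {K : ℝ} (hK : 0 ≤ K)
    (hf : ∀ x y, |f x - f y| ≤ K * ‖x - y‖) (v x : E) : |dirDeriv v f x| ≤ K * ‖v‖ := by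
  have h : LipschitzWith K.toNNReal f := LipschitzWith.of_dist_le_mul fun x y => by
    rw [Real.dist_eq, dist_eq_norm, Real.coe_toNNReal K hK]
    exact hf x y
  have := norm_fderiv_le_of_lipschitz ℝ h (x₀ := x)
  rw [Real.coe_toNNReal K hK] at this
  exact ((fderiv ℝ f x).le_opNorm v).trans (mul_le_mul_of_nonneg_right this (norm_nonneg v))

lemma lipschitz_of_abs_dirDeriv_le {f : E → ℝ} {K : ℝ} (hf : Differentiable ℝ f)
    (h : ∀ v x, |dirDeriv v f x| ≤ K * ‖v‖) (x y : E) : |f x - f y| ≤ K * ‖x - y‖ := by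
  have hb : ∀ z ∈ (univ : Set E), ‖fderiv ℝ f z‖ ≤ max K 0 := fun z _ =>
    ContinuousLinearMap.opNorm_le_bound _ (le_max_right _ _) fun v => by
      exact (h v z).trans (mul_le_mul_of_nonneg_right (le_max_left _ _) (norm_nonneg v))
  by_cases hK : 0 ≤ K
  · rw [max_eq_left hK] at hb
    exact convex_univ.norm_image_sub_le_of_norm_fderiv_le (𝕜 := ℝ) (fun z _ => hf z) hb
      (mem_univ y) (mem_univ x)
  -- A negative `K` is possible only on the trivial space.
  · have : ∀ v : E, ‖v‖ = 0 := fun v => by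
      have h1 := (abs_nonneg _).trans (h v x)
      have h2 := norm_nonneg v
      nlinarith
    have hxy : x = y := by
      have := this (x - y)
      rwa [norm_eq_zero, sub_eq_zero] at this
    simp [hxy]

variable [FiniteDimensional ℝ E]

/-- A smooth function with bounded derivatives is a limit of compactly supported smooth functions
whose derivatives are bounded uniformly. -/
lemma exists_cutoff_seq (e : ι → E) {φ : E → ℝ} {K : ℝ} (hφ : ContDiff ℝ (⊤ : ℕ∞) φ)
    (h1 : ∀ v x, |dirDeriv v φ x| ≤ K * ‖v‖) (h2 : ∀ x, |dirLaplacian e φ x| ≤ K) :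
    ∃ M : ℝ, 0 ≤ M ∧ ∃ φn : ℕ → E → ℝ, (∀ n, ContDiff ℝ (⊤ : ℕ∞) (φn n)) ∧
      (∀ n, HasCompactSupport (φn n)) ∧ (∀ n x, |φn n x| ≤ |φ x|) ∧
      (∀ x, ∀ᶠ n in Filter.atTop, φn n =ᶠ[nhds x] φ) ∧
      (∀ n v x, |dirDeriv v (φn n) x| ≤ M * ‖v‖) ∧ ∀ n x, |dirLaplacian e (φn n) x| ≤ M := by
  have hK : 0 ≤ K := (abs_nonneg _).trans (h2 0)
  let B : ContDiffBump (0 : E) := ⟨1, 2, by norm_num, by norm_num⟩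
  have hB : ContDiff ℝ (⊤ : ℕ∞) (B : E → ℝ) := B.contDiff
  have hBd : Differentiable ℝ (B : E → ℝ) := hB.differentiable (by simp)
  have hBc : HasCompactSupport (B : E → ℝ) := B.hasCompactSupport
  obtain ⟨G₁, hG₁⟩ := (hB.continuous_fderiv (by simp)).bounded_above_of_compact_support
    (hBc.fderiv ℝ)
  have hlapc : HasCompactSupport (dirLaplacian e (B : E → ℝ)) := by
    refine HasCompactSupport.of_support_subset_isCompact hBc fun x hx => ?_
    by_contra hx'
    refine hx ?_
    have : (B : E → ℝ) =ᶠ[nhds x] fun _ => 0 := notMem_tsupport_iff_eventuallyEq.1 hx'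
    rw [dirLaplacian_congr this, dirLaplacian_const]
  obtain ⟨G₂, hG₂⟩ := (contDiff_dirLaplacian hB e).continuous.bounded_above_of_compact_support hlapc
  have hG₁0 : 0 ≤ G₁ := (norm_nonneg _).trans (hG₁ 0)
  have hG₂0 : 0 ≤ G₂ := (norm_nonneg _).trans (hG₂ 0)
  have zero_of : ∀ y : E, 2 < ‖y‖ → (B : E → ℝ) =ᶠ[nhds y] fun _ => 0 := by
    intro y hy
    refine notMem_tsupport_iff_eventuallyEq.1 ?_
    rw [B.tsupport_eq]
    simpa [B] using hy
  have dB : ∀ v y, |dirDeriv v (B : E → ℝ) y| ≤ G₁ * ‖v‖ := fun v y =>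
    ((fderiv ℝ (B : E → ℝ) y).le_opNorm v).trans
      (mul_le_mul_of_nonneg_right (hG₁ y) (norm_nonneg v))
  let c : ℕ → ℝ := fun n => 1 / ((n : ℝ) + 1)
  have hc0 : ∀ n, 0 < c n := fun n => by positivity
  have hc1 : ∀ n, c n ≤ 1 := fun n => by
    rw [div_le_one (by positivity)]
    linarith [(Nat.cast_nonneg n : (0 : ℝ) ≤ n)]
  let χ : ℕ → E → ℝ := fun n x => B (c n • x)
  have hχ : ∀ n, ContDiff ℝ (⊤ : ℕ∞) (χ n) := fun n => hB.comp (contDiff_const_smul (c n))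
  have hφd : Differentiable ℝ φ := hφ.differentiable (by simp)
  have dχ : ∀ n v x, dirDeriv v (χ n) x = c n * dirDeriv v (B : E → ℝ) (c n • x) := fun n v x =>
    congrFun (dirDeriv_comp_smul hBd (c n) v) x
  have lχ : ∀ n x, dirLaplacian e (χ n) x = c n ^ 2 * dirLaplacian e (B : E → ℝ) (c n • x) :=
    fun n x => dirLaplacian_comp_smul hB (c n) e x
  set P : ℝ := |φ 0| + 2 * K with hP
  have hP0 : 0 ≤ P := by positivity
  -- The linear growth of `φ` is compensated by the factor `c n` that a derivative of the cutoff
  -- produces, since the cutoff lives on `‖x‖ ≤ 2 / c n`.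
  have hφb : ∀ n x, ‖c n • x‖ ≤ 2 → c n * |φ x| ≤ P := by
    intro n x hx
    rw [norm_smul, Real.norm_of_nonneg (hc0 n).le] at hx
    have := lipschitz_of_abs_dirDeriv_le hφd h1 x 0
    rw [sub_zero] at this
    have h3 : |φ x| ≤ |φ 0| + K * ‖x‖ := by
      have := abs_sub_abs_le_abs_sub (φ x) (φ 0)
      linarith
    calc c n * |φ x| ≤ c n * (|φ 0| + K * ‖x‖) := mul_le_mul_of_nonneg_left h3 (hc0 n).le
      _ = c n * |φ 0| + K * (c n * ‖x‖) := by ring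
      _ ≤ 1 * |φ 0| + K * 2 := by
          gcongr
          exact hc1 n
      _ = P := by rw [hP]; ring
  have first : ∀ n v x, |φ x * dirDeriv v (χ n) x| ≤ P * G₁ * ‖v‖ := by
    intro n v x
    rw [dχ]
    by_cases hx : ‖c n • x‖ ≤ 2
    · calc |φ x * (c n * dirDeriv v (B : E → ℝ) (c n • x))|
          = (c n * |φ x|) * |dirDeriv v (B : E → ℝ) (c n • x)| := by
            rw [abs_mul, abs_mul, abs_of_pos (hc0 n)]; ring
        _ ≤ P * (G₁ * ‖v‖) := mul_le_mul (hφb n x hx) (dB _ _) (abs_nonneg _) hP0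
        _ = P * G₁ * ‖v‖ := by ring
    · have : dirDeriv v (B : E → ℝ) (c n • x) = 0 := by
        rw [(dirDeriv_congr (zero_of _ (not_le.1 hx)) v).eq_of_nhds, dirDeriv_const]
      rw [this]
      simp only [mul_zero, abs_zero]
      positivity
  -- Of the two factors `c n` one absorbs the growth of `φ`; the other is simply bounded by one.
  have second : ∀ n x, |φ x * dirLaplacian e (χ n) x| ≤ P * G₂ := by
    intro n x
    rw [lχ]
    by_cases hx : ‖c n • x‖ ≤ 2
    · calc |φ x * (c n ^ 2 * dirLaplacian e (B : E → ℝ) (c n • x))|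
          = (c n * |φ x|) * (c n * |dirLaplacian e (B : E → ℝ) (c n • x)|) := by
            rw [abs_mul, abs_mul, abs_pow, abs_of_pos (hc0 n)]; ring
        _ ≤ P * (1 * G₂) := by
            refine mul_le_mul (hφb n x hx) ?_ (mul_nonneg (hc0 n).le (abs_nonneg _)) hP0
            exact mul_le_mul (hc1 n) (hG₂ _) (abs_nonneg _) zero_le_one
        _ = P * G₂ := by ring
    · have : dirLaplacian e (B : E → ℝ) (c n • x) = 0 := by
        rw [dirLaplacian_congr (zero_of _ (not_le.1 hx)), dirLaplacian_const]
      rw [this]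
      simp only [mul_zero, abs_zero]
      positivity
  have χ01 : ∀ n x, |χ n x| ≤ 1 := fun n x => by
    rw [abs_of_nonneg B.nonneg]
    exact B.le_one
  have dχ' : ∀ n v x, |dirDeriv v (χ n) x| ≤ G₁ * ‖v‖ := fun n v x => by
    rw [dχ, abs_mul, abs_of_pos (hc0 n)]
    calc c n * |dirDeriv v (B : E → ℝ) (c n • x)| ≤ 1 * (G₁ * ‖v‖) :=
          mul_le_mul (hc1 n) (dB _ _) (abs_nonneg _) zero_le_one
      _ = G₁ * ‖v‖ := one_mul _
  set S : ℝ := ∑ i, (K * ‖e i‖) * (G₁ * ‖e i‖) with hS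
  have hS0 : 0 ≤ S := Finset.sum_nonneg fun i _ => by positivity
  refine ⟨P * G₁ + P * G₂ + K + 2 * S, by positivity, fun n x => φ x * χ n x,
    fun n => hφ.mul (hχ n), fun n => ?_, fun n x => ?_, fun x => ?_, fun n v x => ?_,
    fun n x => ?_⟩
  · refine HasCompactSupport.mul_left ?_
    exact hBc.comp_homeomorph (Homeomorph.smulOfNeZero (c n) (hc0 n).ne')
  · rw [abs_mul]
    exact mul_le_of_le_one_right (abs_nonneg _) (χ01 n x)
  · obtain ⟨N, hN⟩ := exists_nat_gt ‖x‖
    filter_upwards [Filter.eventually_ge_atTop N] with n hn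
    have hx : ‖x‖ < n + 1 := by
      have : (N : ℝ) ≤ n := by exact_mod_cast hn
      linarith
    have : ∀ᶠ y in nhds x, ‖y‖ < (n : ℝ) + 1 := continuous_norm.continuousAt.eventually_lt_const hx
    filter_upwards [this] with y hy
    have : χ n y = 1 := by
      refine B.one_of_mem_closedBall ?_
      rw [mem_closedBall_zero_iff, norm_smul, Real.norm_of_nonneg (hc0 n).le]
      change 1 / ((n : ℝ) + 1) * ‖y‖ ≤ 1
      rw [one_div, inv_mul_le_iff₀ (by positivity), mul_one]
      exact hy.le
    simp [this]
  · rw [dirDeriv_mul hφd ((hχ n).differentiable (by simp))]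
    have a1 := first n v x
    have a2 : |χ n x * dirDeriv v φ x| ≤ K * ‖v‖ := by
      rw [abs_mul]
      exact (mul_le_of_le_one_left (abs_nonneg _) (χ01 n x)).trans (h1 v x)
    calc _ ≤ P * G₁ * ‖v‖ + K * ‖v‖ := (abs_add_le _ _).trans (add_le_add a1 a2)
      _ = (P * G₁ + K) * ‖v‖ := by ring
      _ ≤ _ := by
        refine mul_le_mul_of_nonneg_right ?_ (norm_nonneg v)
        have : 0 ≤ P * G₂ := by positivity
        linarith
  · rw [dirLaplacian_mul hφ (hχ n)]
    have a1 := second n x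
    have a2 : |χ n x * dirLaplacian e φ x| ≤ K := by
      rw [abs_mul]
      exact (mul_le_of_le_one_left (abs_nonneg _) (χ01 n x)).trans (h2 x)
    have a3 : |2 * ∑ i, dirDeriv (e i) φ x * dirDeriv (e i) (χ n) x| ≤ 2 * S := by
      rw [abs_mul, abs_two]
      refine mul_le_mul_of_nonneg_left ((Finset.abs_sum_le_sum_abs _ _).trans ?_) zero_le_two
      refine Finset.sum_le_sum fun i _ => ?_
      rw [abs_mul]
      exact mul_le_mul (h1 _ _) (dχ' _ _ _) (abs_nonneg _) (by positivity)
    have : 0 ≤ P * G₁ := by positivity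
    refine (abs_add_le _ _).trans ?_
    have := abs_add_le (φ x * dirLaplacian e (χ n) x) (χ n x * dirLaplacian e φ x)
    linarith

end Cutoff

/-! ### Linear Fokker-Planck equations in weak form. -/

section WeakSolution

open Filter Topology

variable {E : Type*} [NormedAddCommGroup E] [NormedSpace ℝ E] {ι : Type*} [Fintype ι]

/-- The second-order operator `b · ∇ + ∑ i, ∂_{e i}²`. -/
noncomputable def fpOp (e : ι → E) (b : E → E) (φ : E → ℝ) (x : E) : ℝ :=
  dirDeriv (b x) φ x + dirLaplacian e φ x

/-- Smooth functions with bounded gradient and bounded second derivatives along the `e i`. -/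
structure HasBoundedDerivs (e : ι → E) (φ : E → ℝ) (K : ℝ) : Prop where
  contDiff : ContDiff ℝ (⊤ : ℕ∞) φ
  abs_dirDeriv_le : ∀ v x, |dirDeriv v φ x| ≤ K * ‖v‖
  abs_dirLaplacian_le : ∀ x, |dirLaplacian e φ x| ≤ K

lemma HasBoundedDerivs.differentiable {e : ι → E} {φ : E → ℝ} {K : ℝ}
    (h : HasBoundedDerivs e φ K) : Differentiable ℝ φ :=
  h.contDiff.differentiable (by simp)

lemma HasBoundedDerivs.nonneg {e : ι → E} {φ : E → ℝ} {K : ℝ}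
    (h : HasBoundedDerivs e φ K) : 0 ≤ K :=
  (abs_nonneg _).trans (h.abs_dirLaplacian_le 0)

lemma HasBoundedDerivs.abs_le {e : ι → E} {φ : E → ℝ} {K : ℝ}
    (h : HasBoundedDerivs e φ K) (x : E) : |φ x| ≤ |φ 0| + K * ‖x‖ := by
  have := lipschitz_of_abs_dirDeriv_le h.differentiable h.abs_dirDeriv_le x 0
  rw [sub_zero] at this
  have := abs_sub_abs_le_abs_sub (φ x) (φ 0)
  linarith

lemma HasBoundedDerivs.abs_fpOp_le {e : ι → E} {φ : E → ℝ} {K : ℝ}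
    (h : HasBoundedDerivs e φ K) (b : E → E) (x : E) : |fpOp e b φ x| ≤ K * (1 + ‖b x‖) := by
  have := h.abs_dirDeriv_le (b x) x
  have := h.abs_dirLaplacian_le x
  have := abs_add_le (dirDeriv (b x) φ x) (dirLaplacian e φ x)
  rw [fpOp]
  linarith

lemma continuous_fpOp (e : ι → E) {b : E → E} (hb : Continuous b) {φ : E → ℝ}
    (hφ : ContDiff ℝ (⊤ : ℕ∞) φ) : Continuous (fpOp e b φ) := by
  have h1 : Continuous (fun x => fderiv ℝ φ x (b x)) :=
    (hφ.continuous_fderiv (by simp)).clm_apply hb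
  exact h1.add (contDiff_dirLaplacian hφ e).continuous

variable [MeasurableSpace E] [BorelSpace E]

/-- Distributional solutions of `∂_t ρ = -div (b_t ρ) + ∑ i, ∂_{e i}² ρ` whose drift grows at most
linearly. -/
structure IsFPSolution (e : ι → E) (b : ℝ → E → E) (ρ : ℝ → ProbabilityMeasure E) : Prop where
  continuousOn : ContinuousOn ρ (Ici 0)
  integrable_norm : ∀ t, 0 ≤ t → Integrable (fun x => ‖x‖) (ρ t : Measure E)
  lintegral_norm : ∀ T, 0 ≤ T → ∫⁻ t in Icc 0 T, ∫⁻ x, ‖x‖ₑ ∂(ρ t : Measure E) < ⊤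
  continuous_drift : ∀ t, 0 ≤ t → Continuous (b t)
  growth : ∃ K, 0 ≤ K ∧ ∀ t, 0 ≤ t → ∀ x, ‖b t x‖ ≤ K * (1 + ‖x‖ + ∫ y, ‖y‖ ∂(ρ t : Measure E))
  weak_integrable : ∀ φ : E → ℝ, ContDiff ℝ (⊤ : ℕ∞) φ → HasCompactSupport φ → ∀ t, 0 ≤ t →
    IntervalIntegrable (fun s => ∫ x, fpOp e (b s) φ x ∂(ρ s : Measure E)) volume 0 t
  weak_eq : ∀ φ : E → ℝ, ContDiff ℝ (⊤ : ℕ∞) φ → HasCompactSupport φ → ∀ t, 0 ≤ t →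
    ∫ x, φ x ∂(ρ t : Measure E) - ∫ x, φ x ∂(ρ 0 : Measure E) =
      ∫ s in (0 : ℝ)..t, ∫ x, fpOp e (b s) φ x ∂(ρ s : Measure E)

variable [FiniteDimensional ℝ E] {e : ι → E} {b : ℝ → E → E}
  {ρ : ℝ → ProbabilityMeasure E}

omit [NormedSpace ℝ E] [FiniteDimensional ℝ E] in
lemma integrable_of_abs_le_linear [SecondCountableTopology E] {μ : Measure E}
    [IsFiniteMeasure μ] (hμ : Integrable (fun x => ‖x‖) μ) {f : E → ℝ} (hf : Continuous f)
    {A B : ℝ} (h : ∀ x, |f x| ≤ A + B * ‖x‖) : Integrable f μ :=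
  ((integrable_const A).add (hμ.const_mul B)).mono' hf.aestronglyMeasurable (ae_of_all _ h)

omit [NormedSpace ℝ E] [FiniteDimensional ℝ E] in
lemma continuousOn_integral_of_bounded {s : Set ℝ} (hρ : ContinuousOn ρ s) {f : E → ℝ}
    (hf : Continuous f) {C : ℝ} (hC : ∀ x, |f x| ≤ C) :
    ContinuousOn (fun t => ∫ x, f x ∂(ρ t : Measure E)) s :=
  (ProbabilityMeasure.continuous_integral_boundedContinuousFunction
    (BoundedContinuousFunction.ofNormedAddCommGroup f hf C hC)).comp_continuousOn hρ

/-- The point is measurability in time: truncated first moments are continuous in time by narrow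
continuity, and they converge pointwise to the first moment. -/
lemma IsFPSolution.intervalIntegrable_firstMoment (h : IsFPSolution e b ρ) {t : ℝ} (ht : 0 ≤ t) :
    IntervalIntegrable (fun s => ∫ y, ‖y‖ ∂(ρ s : Measure E)) volume 0 t := by
  rw [intervalIntegrable_iff_integrableOn_Icc_of_le ht]
  constructor
  · have hc : ∀ n : ℕ, AEStronglyMeasurable
        (fun s => ∫ y, min ‖y‖ n ∂(ρ s : Measure E)) (volume.restrict (Icc 0 t)) := fun n =>
      (continuousOn_integral_of_bounded (C := n) (h.continuousOn.mono Icc_subset_Ici_self)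
        (by fun_prop) fun x => by
          rw [abs_of_nonneg (le_min (norm_nonneg _) (Nat.cast_nonneg n))]
          exact min_le_right _ _).aestronglyMeasurable measurableSet_Icc
    refine aestronglyMeasurable_of_tendsto_ae atTop hc ?_
    filter_upwards [ae_restrict_mem measurableSet_Icc] with s hs
    refine tendsto_integral_of_dominated_convergence (fun y => ‖y‖)
      (fun n => (Continuous.aestronglyMeasurable (by fun_prop))) (h.integrable_norm s hs.1)
      (fun n => ae_of_all _ fun y => ?_) (ae_of_all _ fun y => ?_)
    · rw [Real.norm_of_nonneg (le_min (norm_nonneg _) (Nat.cast_nonneg n))]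
      exact min_le_left _ _
    · refine tendsto_const_nhds.congr' ?_
      obtain ⟨N, hN⟩ := exists_nat_ge ‖y‖
      filter_upwards [eventually_ge_atTop N] with n hn
      rw [min_eq_left (hN.trans (by exact_mod_cast hn))]
  · refine lt_of_le_of_lt (lintegral_mono_ae ?_) (h.lintegral_norm t ht)
    filter_upwards [ae_restrict_mem measurableSet_Icc] with s hs
    rw [Real.enorm_of_nonneg (integral_nonneg fun _ => norm_nonneg _),
      ofReal_integral_norm_eq_lintegral_enorm]
    exact (integrable_norm_iff aestronglyMeasurable_id).1 (h.integrable_norm s hs.1)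

lemma IsFPSolution.integrable_fpOp (h : IsFPSolution e b ρ) {φ : E → ℝ} {K : ℝ}
    (hφ : HasBoundedDerivs e φ K) {t : ℝ} (ht : 0 ≤ t) :
    Integrable (fpOp e (b t) φ) (ρ t : Measure E) := by
  obtain ⟨G, hG, hb⟩ := h.growth
  refine integrable_of_abs_le_linear (h.integrable_norm t ht)
    (continuous_fpOp e (h.continuous_drift t ht) hφ.contDiff)
    (A := K * (1 + G * (1 + ∫ y, ‖y‖ ∂(ρ t : Measure E)))) (B := K * G) fun x => ?_
  refine (hφ.abs_fpOp_le (b t) x).trans ?_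
  have := mul_le_mul_of_nonneg_left (hb t ht x) hφ.nonneg
  linarith

/-- The weak formulation extends to smooth functions with bounded derivatives. -/
lemma IsFPSolution.weak_extend (h : IsFPSolution e b ρ) {φ : E → ℝ} {K : ℝ}
    (hφ : HasBoundedDerivs e φ K) {t : ℝ} (ht : 0 ≤ t) :
    IntervalIntegrable (fun s => ∫ x, fpOp e (b s) φ x ∂(ρ s : Measure E)) volume 0 t ∧
    ∫ x, φ x ∂(ρ t : Measure E) - ∫ x, φ x ∂(ρ 0 : Measure E) =
      ∫ s in (0 : ℝ)..t, ∫ x, fpOp e (b s) φ x ∂(ρ s : Measure E) := by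
  obtain ⟨M, hM, φn, hs, hc, hle, hev, hd, hl⟩ :=
    exists_cutoff_seq e hφ.contDiff hφ.abs_dirDeriv_le hφ.abs_dirLaplacian_le
  obtain ⟨G, hG, hb⟩ := h.growth
  have hbd : ∀ n, HasBoundedDerivs e (φn n) M := fun n => ⟨hs n, hd n, hl n⟩
  -- The bounds on the truncated functions are uniform in `n`, so one linear majorant serves
  -- dominated convergence in space and, once integrated, in time.
  have bound : ∀ n s, 0 ≤ s → ∀ x, ‖fpOp e (b s) (φn n) x‖ ≤
      M * (1 + G * (1 + ∫ y, ‖y‖ ∂(ρ s : Measure E))) + M * G * ‖x‖ := by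
    intro n s hs0 x
    refine ((hbd n).abs_fpOp_le (b s) x).trans ?_
    have := mul_le_mul_of_nonneg_left (hb s hs0 x) hM
    linarith
  have lim : ∀ s, 0 ≤ s → Tendsto (fun n => ∫ x, fpOp e (b s) (φn n) x ∂(ρ s : Measure E)) atTop
      (𝓝 (∫ x, fpOp e (b s) φ x ∂(ρ s : Measure E))) := by
    intro s hs0
    refine tendsto_integral_of_dominated_convergence _
      (fun n => (continuous_fpOp e (h.continuous_drift s hs0) (hs n)).aestronglyMeasurable)
      ((integrable_const _).add ((h.integrable_norm s hs0).const_mul (M * G)))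
      (fun n => ae_of_all _ (bound n s hs0)) (ae_of_all _ fun x => ?_)
    refine tendsto_const_nhds.congr' ?_
    filter_upwards [hev x] with n hn
    rw [fpOp, fpOp, dirLaplacian_congr hn, (dirDeriv_congr hn _).eq_of_nhds]
  have bound' : ∀ n s, 0 ≤ s → ‖∫ x, fpOp e (b s) (φn n) x ∂(ρ s : Measure E)‖ ≤
      M * (1 + G) + 2 * M * G * ∫ y, ‖y‖ ∂(ρ s : Measure E) := by
    intro n s hs0
    refine (norm_integral_le_of_norm_le
      ((integrable_const _).add ((h.integrable_norm s hs0).const_mul (M * G)))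
      (ae_of_all _ (bound n s hs0))).trans (le_of_eq ?_)
    rw [integral_add' (integrable_const _) ((h.integrable_norm s hs0).const_mul (M * G)),
      integral_const, integral_const_mul]
    simp
    ring
  have hbi : IntervalIntegrable
      (fun s => M * (1 + G) + 2 * M * G * ∫ y, ‖y‖ ∂(ρ s : Measure E)) volume 0 t :=
    intervalIntegrable_const.add ((h.intervalIntegrable_firstMoment ht).const_mul _)
  have hm : ∀ n, AEStronglyMeasurable (fun s => ∫ x, fpOp e (b s) (φn n) x ∂(ρ s : Measure E))
      (volume.restrict (uIoc 0 t)) := fun n =>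
    (intervalIntegrable_iff.1 (h.weak_integrable (φn n) (hs n) (hc n) t ht)).aestronglyMeasurable
  have pos : ∀ s ∈ uIoc 0 t, 0 ≤ s := fun s hs => by
    rw [uIoc_of_le ht] at hs
    exact hs.1.le
  have lim2 := intervalIntegral.tendsto_integral_filter_of_dominated_convergence
    (F := fun n s => ∫ x, fpOp e (b s) (φn n) x ∂(ρ s : Measure E)) (l := atTop) (a := 0) (b := t)
    _ (Eventually.of_forall hm)
    (Eventually.of_forall fun n => ae_of_all _ fun s hs => bound' n s (pos s hs)) hbi
    (ae_of_all _ fun s hs => lim s (pos s hs))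
  have lim1 : ∀ s, 0 ≤ s → Tendsto (fun n => ∫ x, φn n x ∂(ρ s : Measure E)) atTop
      (𝓝 (∫ x, φ x ∂(ρ s : Measure E))) := by
    intro s hs0
    refine tendsto_integral_of_dominated_convergence (fun x => |φ 0| + K * ‖x‖)
      (fun n => (hs n).continuous.aestronglyMeasurable)
      ((integrable_const _).add ((h.integrable_norm s hs0).const_mul K))
      (fun n => ae_of_all _ fun x => (hle n x).trans (hφ.abs_le x)) (ae_of_all _ fun x => ?_)
    refine tendsto_const_nhds.congr' ?_
    filter_upwards [hev x] with n hn
    exact hn.eq_of_nhds.symm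
  constructor
  · rw [intervalIntegrable_iff] at hbi ⊢
    have hae : ∀ᵐ s ∂(volume.restrict (uIoc 0 t)), 0 ≤ s := by
      filter_upwards [ae_restrict_mem measurableSet_uIoc] with s hs using pos s hs
    refine hbi.mono' (aestronglyMeasurable_of_tendsto_ae atTop hm ?_) ?_
    · filter_upwards [hae] with s hs using lim s hs
    · filter_upwards [hae] with s hs
      exact le_of_tendsto (lim s hs).norm (Eventually.of_forall fun n => bound' n s hs)
  · refine tendsto_nhds_unique ((lim1 t ht).sub (lim1 0 le_rfl)) (lim2.congr fun n => ?_)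
    exact (h.weak_eq (φn n) (hs n) (hc n) t ht).symm

lemma IsFPSolution.weak_between (h : IsFPSolution e b ρ) {φ : E → ℝ} {K : ℝ}
    (hφ : HasBoundedDerivs e φ K) {s t : ℝ} (hs : 0 ≤ s) (hst : s ≤ t) :
    IntervalIntegrable (fun r => ∫ x, fpOp e (b r) φ x ∂(ρ r : Measure E)) volume s t ∧
    ∫ x, φ x ∂(ρ t : Measure E) - ∫ x, φ x ∂(ρ s : Measure E) =
      ∫ r in s..t, ∫ x, fpOp e (b r) φ x ∂(ρ r : Measure E) := by
  obtain ⟨i1, e1⟩ := h.weak_extend hφ hs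
  obtain ⟨i2, e2⟩ := h.weak_extend hφ (hs.trans hst)
  refine ⟨i1.symm.trans i2, ?_⟩
  rw [← intervalIntegral.integral_interval_sub_left i2 i1, ← e1, ← e2]
  ring

end WeakSolution

/-! ### Moment bounds and continuity in time. -/

section Moments

open Filter Topology

variable {E : Type*} [NormedAddCommGroup E] [NormedSpace ℝ E] {ι : Type*} [Fintype ι]
  [MeasureSpace E] [BorelSpace E] [FiniteDimensional ℝ E] [(volume : Measure E).IsAddHaarMeasure]
  {e : ι → E} {b : ℝ → E → E} {ρ : ℝ → ProbabilityMeasure E}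

omit [NormedSpace ℝ E] [MeasureSpace E] [BorelSpace E] [FiniteDimensional ℝ E]
  [(volume : Measure E).IsAddHaarMeasure] in
lemma continuous_of_abs_sub_le {u : E → ℝ} {Λ : ℝ} (hΛ : 0 ≤ Λ)
    (hu : ∀ x y, |u x - u y| ≤ Λ * ‖x - y‖) : Continuous u :=
  (LipschitzWith.of_dist_le_mul (K := Λ.toNNReal) fun x y => by
    rw [Real.dist_eq, dist_eq_norm, Real.coe_toNNReal Λ hΛ]
    exact hu x y).continuous

omit [NormedSpace ℝ E] [FiniteDimensional ℝ E] in
lemma IsMollifier.lipschitz_moll [NormedSpace ℝ E] {k : E → ℝ} {δ : ℝ} (hk : IsMollifier k δ)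
    {u : E → ℝ} {Λ : ℝ}
    (hΛ : 0 ≤ Λ) (hu : ∀ x y, |u x - u y| ≤ Λ * ‖x - y‖) (x y : E) :
    |moll k u x - moll k u y| ≤ Λ * ‖x - y‖ := by
  have hc := continuous_of_abs_sub_le hΛ hu
  have := abs_moll_sub_moll_le hk.contDiff.continuous hk.hasCompactSupport hc hc (x := x) (x' := y)
    (c := Λ * ‖x - y‖) (fun z _ => (hu _ _).trans (le_of_eq (by rw [sub_sub_sub_cancel_right])))
  rwa [hk.integral_abs, mul_one] at this

/-- One derivative is carried by the Lipschitz function, the second falls on the kernel and costs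
`gradMass k`. The bound is linear in `Λ`, which makes the later time modulus uniform over Lipschitz
functions. -/
lemma IsMollifier.hasBoundedDerivs {k : E → ℝ} {δ : ℝ} (hk : IsMollifier k δ) (e : ι → E)
    {u : E → ℝ} {Λ : ℝ} (hΛ : 0 ≤ Λ) (hu : ∀ x y, |u x - u y| ≤ Λ * ‖x - y‖) :
    HasBoundedDerivs e (moll k u) (Λ * (1 + gradMass k * ∑ i, ‖e i‖ ^ 2)) := by
  have hc := continuous_of_abs_sub_le hΛ hu
  have h0 : 0 ≤ gradMass k * ∑ i, ‖e i‖ ^ 2 :=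
    mul_nonneg (gradMass_nonneg k) (Finset.sum_nonneg fun i _ => sq_nonneg _)
  refine ⟨contDiff_moll hk.contDiff hk.hasCompactSupport hc, fun v x => ?_, fun x => ?_⟩
  · refine (abs_dirDeriv_le_of_lipschitz hΛ (hk.lipschitz_moll hΛ hu) v x).trans ?_
    refine mul_le_mul_of_nonneg_right ?_ (norm_nonneg v)
    exact le_mul_of_one_le_right hΛ (by linarith)
  · have h1 : ∀ i, |dirDeriv (e i) (dirDeriv (e i) (moll k u)) x| ≤
        Λ * (gradMass k * ‖e i‖ ^ 2) := by
      intro i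
      have hg := gradMass_nonneg k
      refine (abs_dirDeriv_le_of_lipschitz (K := Λ * (gradMass k * ‖e i‖)) (by positivity)
        (fun y z => ?_) (e i) x).trans (le_of_eq (by ring))
      refine (abs_dirDeriv_moll_sub_le hk.contDiff hk.hasCompactSupport hc (c := Λ * ‖y - z‖)
        (by positivity) fun w => (hu _ _).trans (le_of_eq ?_)).trans (le_of_eq (by ring))
      rw [sub_sub_sub_cancel_right]
    refine ((Finset.abs_sum_le_sum_abs _ _).trans (Finset.sum_le_sum fun i _ => h1 i)).trans ?_
    rw [← Finset.mul_sum, ← Finset.mul_sum]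
    exact mul_le_mul_of_nonneg_left (by linarith) hΛ

omit [NormedSpace ℝ E] [FiniteDimensional ℝ E] in
lemma IsMollifier.abs_moll_sub_le_of_lipschitz [NormedSpace ℝ E] {k : E → ℝ} {δ : ℝ}
    (hk : IsMollifier k δ)
    {u : E → ℝ} {Λ : ℝ} (hΛ : 0 ≤ Λ) (hu : ∀ x y, |u x - u y| ≤ Λ * ‖x - y‖) (x : E) :
    |moll k u x - u x| ≤ Λ * δ :=
  hk.abs_moll_sub_le (continuous_of_abs_sub_le hΛ hu) fun y hy => (hu _ _).trans (by
    rw [sub_sub_cancel_left, norm_neg]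
    exact mul_le_mul_of_nonneg_left hy.le hΛ)

/-- On bounded time intervals the first moments are bounded and the drift grows linearly in
space, uniformly in time. -/
lemma IsFPSolution.exists_bound (h : IsFPSolution e b ρ) {T : ℝ} (hT : 0 ≤ T) :
    ∃ K, 0 ≤ K ∧ ∀ t ∈ Icc 0 T, ∫ y, ‖y‖ ∂(ρ t : Measure E) ≤ K ∧
      ∀ x, ‖b t x‖ ≤ K * (1 + ‖x‖) := by
  -- The test function is the norm mollified at radius one: it stays within distance one of the
  -- norm. Its evolution is bounded by the first moment, whose integrability in time is assumed, so
  -- no Gronwall argument is needed.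
  obtain ⟨k, hk⟩ := exists_isMollifier (E := E) one_pos
  have hn : ∀ x y : E, |‖x‖ - ‖y‖| ≤ 1 * ‖x - y‖ := fun x y => by
    rw [one_mul]; exact abs_norm_sub_norm_le x y
  have hφ := hk.hasBoundedDerivs e zero_le_one hn
  set φ := moll k (fun x : E => ‖x‖)
  set K := 1 * (1 + gradMass k * ∑ i, ‖e i‖ ^ 2)
  have hK := hφ.nonneg
  obtain ⟨G, hG, hb⟩ := h.growth
  have hm0 : ∀ t, 0 ≤ ∫ y, ‖y‖ ∂(ρ t : Measure E) := fun t => integral_nonneg fun _ => norm_nonneg _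
  have near : ∀ x, |φ x - ‖x‖| ≤ 1 := fun x => by
    simpa using hk.abs_moll_sub_le_of_lipschitz zero_le_one hn x
  have hφi : ∀ t, 0 ≤ t → Integrable φ (ρ t : Measure E) := fun t ht =>
    integrable_of_abs_le_linear (h.integrable_norm t ht) hφ.contDiff.continuous hφ.abs_le
  have hg : ∀ s, 0 ≤ s → ‖∫ x, fpOp e (b s) φ x ∂(ρ s : Measure E)‖ ≤
      K * (1 + G) + 2 * K * G * ∫ y, ‖y‖ ∂(ρ s : Measure E) := by
    intro s hs
    refine (norm_integral_le_of_norm_le ((integrable_const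
      (K * (1 + G * (1 + ∫ y, ‖y‖ ∂(ρ s : Measure E))))).add
      ((h.integrable_norm s hs).const_mul (K * G))) (ae_of_all _ fun x => ?_)).trans (le_of_eq ?_)
    · refine (hφ.abs_fpOp_le (b s) x).trans ?_
      have := mul_le_mul_of_nonneg_left (hb s hs x) hK
      simp only [Pi.add_apply]
      linarith
    · rw [integral_add' (integrable_const _) ((h.integrable_norm s hs).const_mul (K * G)),
        integral_const, integral_const_mul]
      simp
      ring
  have hbi : ∀ t, 0 ≤ t → IntervalIntegrable
      (fun s => K * (1 + G) + 2 * K * G * ∫ y, ‖y‖ ∂(ρ s : Measure E)) volume 0 t := fun t ht =>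
    intervalIntegrable_const.add ((h.intervalIntegrable_firstMoment ht).const_mul _)
  set J := ∫ s in (0 : ℝ)..T, (K * (1 + G) + 2 * K * G * ∫ y, ‖y‖ ∂(ρ s : Measure E)) with hJ
  have main : ∀ t ∈ Icc 0 T, ∫ y, ‖y‖ ∂(ρ t : Measure E) ≤
      1 + |∫ x, φ x ∂(ρ 0 : Measure E)| + J := by
    intro t ht
    obtain ⟨-, e1⟩ := h.weak_extend hφ ht.1
    have a1 : ∫ y, ‖y‖ ∂(ρ t : Measure E) ≤ 1 + ∫ x, φ x ∂(ρ t : Measure E) := by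
      have : ∫ y, ‖y‖ ∂(ρ t : Measure E) ≤ ∫ x, (1 + φ x) ∂(ρ t : Measure E) := by
        refine integral_mono (h.integrable_norm t ht.1) ((integrable_const _).add (hφi t ht.1))
          fun x => ?_
        have := (abs_le.1 (near x)).1
        simp only
        linarith
      rwa [integral_add (integrable_const _) (hφi t ht.1), integral_const, probReal_univ,
        one_smul] at this
    have a2 : ‖∫ s in (0 : ℝ)..t, ∫ x, fpOp e (b s) φ x ∂(ρ s : Measure E)‖ ≤
        ∫ s in (0 : ℝ)..t, (K * (1 + G) + 2 * K * G * ∫ y, ‖y‖ ∂(ρ s : Measure E)) :=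
      intervalIntegral.norm_integral_le_of_norm_le ht.1
        (ae_of_all _ fun s hs => hg s hs.1.le) (hbi t ht.1)
    have a3 : ∫ s in (0 : ℝ)..t, (K * (1 + G) + 2 * K * G * ∫ y, ‖y‖ ∂(ρ s : Measure E)) ≤ J := by
      refine intervalIntegral.integral_mono_interval le_rfl ht.1 ht.2 (ae_of_all _ fun s => ?_)
        (hbi T hT)
      have := hm0 s
      simp only [Pi.zero_apply]
      positivity
    have := le_abs_self (∫ x, φ x ∂(ρ 0 : Measure E))
    have := (Real.le_norm_self _).trans a2
    linarith
  set R := 1 + |∫ x, φ x ∂(ρ 0 : Measure E)| + J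
  have hR : 0 ≤ R := (hm0 0).trans (main 0 ⟨le_rfl, hT⟩)
  refine ⟨R + G * (1 + R), by positivity, fun t ht => ⟨?_, fun x => ?_⟩⟩
  · have : 0 ≤ G * (1 + R) := by positivity
    linarith [main t ht]
  · refine (hb t ht.1 x).trans ?_
    have h1 := main t ht
    have h2 := norm_nonneg x
    calc G * (1 + ‖x‖ + ∫ y, ‖y‖ ∂(ρ t : Measure E)) ≤ G * ((1 + R) * (1 + ‖x‖)) := by
          refine mul_le_mul_of_nonneg_left ?_ hG
          nlinarith
      _ ≤ (R + G * (1 + R)) * (1 + ‖x‖) := by nlinarith [mul_nonneg hR h2]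

omit [MeasureSpace E] [BorelSpace E] [FiniteDimensional ℝ E]
  [(volume : Measure E).IsAddHaarMeasure] in
lemma abs_integral_fpOp_le [MeasurableSpace E] {μ : Measure E} [IsProbabilityMeasure μ]
    {φ : E → ℝ} {K G M : ℝ}
    (hφ : HasBoundedDerivs e φ K) {b : E → E} (hi : Integrable (fun x => ‖x‖) μ)
    (hG : 0 ≤ G) (hM : ∫ y, ‖y‖ ∂μ ≤ M) (hb : ∀ x, ‖b x‖ ≤ G * (1 + ‖x‖)) :
    |∫ x, fpOp e b φ x ∂μ| ≤ K * (1 + G * (1 + M)) := by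
  have hK := hφ.nonneg
  rw [← Real.norm_eq_abs]
  refine (norm_integral_le_of_norm_le ((integrable_const (K * (1 + G))).add
    (hi.const_mul (K * G))) (ae_of_all _ fun x => ?_)).trans ?_
  · refine (hφ.abs_fpOp_le b x).trans ?_
    have := mul_le_mul_of_nonneg_left (hb x) hK
    simp only [Pi.add_apply]
    linarith
  · rw [integral_add' (integrable_const _) (hi.const_mul (K * G)), integral_const,
      integral_const_mul]
    have := mul_le_mul_of_nonneg_left hM (mul_nonneg hK hG)
    simp
    linarith

/-- Integrals of Lipschitz functions are uniformly continuous in time, with a modulus that only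
depends on the Lipschitz constant. -/
lemma IsFPSolution.exists_time_modulus (h : IsFPSolution e b ρ) {T : ℝ} (hT : 0 ≤ T) {ε : ℝ}
    (hε : 0 < ε) : ∃ h₀ > 0, ∀ s ∈ Icc 0 T, ∀ t ∈ Icc 0 T, |t - s| ≤ h₀ →
      ∀ (Λ : ℝ) (u : E → ℝ), 0 ≤ Λ → (∀ x y, |u x - u y| ≤ Λ * ‖x - y‖) →
        |∫ x, u x ∂(ρ t : Measure E) - ∫ x, u x ∂(ρ s : Measure E)| ≤ Λ * ε := by
  -- Mollification at the two times costs `Λ ε / 4` each; the other half of `Λ ε` is left for the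
  -- evolution of the mollified function.
  obtain ⟨k, hk⟩ := exists_isMollifier (E := E) (δ := ε / 4) (by positivity)
  obtain ⟨K, hK, hb⟩ := h.exists_bound hT
  set D := 1 + gradMass k * ∑ i, ‖e i‖ ^ 2 with hD
  have hD1 : 1 ≤ D := by
    have := mul_nonneg (gradMass_nonneg k) (Finset.sum_nonneg fun i _ => sq_nonneg ‖e i‖ :
      0 ≤ ∑ i, ‖e i‖ ^ 2)
    linarith
  set C := D * (1 + K * (1 + K)) with hC
  have hC0 : 0 < C := by positivity
  refine ⟨ε / (2 * C), by positivity, ?_⟩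
  suffices H : ∀ s ∈ Icc 0 T, ∀ t ∈ Icc 0 T, s ≤ t → |t - s| ≤ ε / (2 * C) →
      ∀ (Λ : ℝ) (u : E → ℝ), 0 ≤ Λ → (∀ x y, |u x - u y| ≤ Λ * ‖x - y‖) →
        |∫ x, u x ∂(ρ t : Measure E) - ∫ x, u x ∂(ρ s : Measure E)| ≤ Λ * ε by
    intro s hs t ht hst Λ u hΛ hu
    rcases le_total s t with h' | h'
    · exact H s hs t ht h' hst Λ u hΛ hu
    · rw [abs_sub_comm]
      rw [abs_sub_comm] at hst
      exact H t ht s hs h' hst Λ u hΛ hu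
  intro s hs t ht hle hst Λ u hΛ hu
  have hφ := hk.hasBoundedDerivs e hΛ hu
  obtain ⟨-, e1⟩ := h.weak_between hφ hs.1 hle
  have hui : ∀ r ∈ Icc 0 T, Integrable u (ρ r : Measure E) := fun r hr =>
    integrable_of_abs_le_linear (h.integrable_norm r hr.1) (continuous_of_abs_sub_le hΛ hu)
      (A := |u 0|) (B := Λ) fun x => by
        have h1 := hu x 0
        rw [sub_zero] at h1
        have := abs_sub_abs_le_abs_sub (u x) (u 0)
        linarith
  have hφi : ∀ r ∈ Icc 0 T, Integrable (moll k u) (ρ r : Measure E) := fun r hr =>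
    integrable_of_abs_le_linear (h.integrable_norm r hr.1) hφ.contDiff.continuous hφ.abs_le
  have near : ∀ r ∈ Icc 0 T, |∫ x, moll k u x ∂(ρ r : Measure E) - ∫ x, u x ∂(ρ r : Measure E)| ≤
      Λ * (ε / 4) := by
    intro r hr
    rw [← integral_sub (hφi r hr) (hui r hr), ← Real.norm_eq_abs]
    refine (norm_integral_le_of_norm_le_const (ae_of_all _ fun x =>
      hk.abs_moll_sub_le_of_lipschitz hΛ hu x)).trans (le_of_eq ?_)
    simp
  have hint : |∫ r in s..t, ∫ x, fpOp e (b r) (moll k u) x ∂(ρ r : Measure E)| ≤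
      Λ * C * |t - s| := by
    rw [← Real.norm_eq_abs]
    refine intervalIntegral.norm_integral_le_of_norm_le_const fun r hr => ?_
    rw [uIoc_of_le hle] at hr
    have hr' : r ∈ Icc 0 T := ⟨hs.1.trans hr.1.le, hr.2.trans ht.2⟩
    refine (abs_integral_fpOp_le hφ (h.integrable_norm r hr'.1) hK (hb r hr').1
      (hb r hr').2).trans (le_of_eq ?_)
    rw [hC]; ring
  rw [← e1] at hint
  have h2 : Λ * C * |t - s| ≤ Λ * (ε / 2) := by
    rw [mul_assoc]
    refine mul_le_mul_of_nonneg_left ?_ hΛ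
    calc C * |t - s| ≤ C * (ε / (2 * C)) := mul_le_mul_of_nonneg_left hst hC0.le
      _ = ε / 2 := by field_simp
  have n1 := near s hs
  have n2 := near t ht
  have h3 := hint.trans h2
  rw [abs_le] at n1 n2 h3 ⊢
  constructor <;> linarith [n1.1, n1.2, n2.1, n2.2, h3.1, h3.2]

omit [(volume : Measure E).IsAddHaarMeasure] in
/-- A Gronwall estimate for the integrals of a bounded test function. -/
lemma IsFPSolution.integral_le_exp (h : IsFPSolution e b ρ) {T K : ℝ} (hT : 0 ≤ T) (hK : 0 ≤ K)
    (hb : ∀ t ∈ Icc 0 T, ∀ x, ‖b t x‖ ≤ K * (1 + ‖x‖)) {φ : E → ℝ} {D A R : ℝ}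
    (hφ : HasBoundedDerivs e φ D) (hA : 0 < A) (h0 : ∀ x, 0 ≤ φ x) (hR : ∀ x, φ x ≤ R)
    (h1 : ∀ v x, |dirDeriv v φ x| * (1 + ‖x‖) ≤ A * (1 + φ x) * ‖v‖)
    (h2 : ∀ x, |dirLaplacian e φ x| ≤ A) {t : ℝ} (ht : t ∈ Icc 0 T) :
    ∫ x, φ x ∂(ρ t : Measure E) ≤
      2 * (1 + ∫ x, φ x ∂(ρ 0 : Measure E)) * Real.exp (2 * (A * (K + 1)) * T) := by
  set a := A * (K + 1) with ha
  have ha0 : 0 < a := by positivity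
  set f : ℝ → ℝ := fun t => ∫ x, φ x ∂(ρ t : Measure E) with hf
  have hφi : ∀ r, Integrable φ (ρ r : Measure E) := fun r =>
    (integrable_const R).mono' hφ.contDiff.continuous.aestronglyMeasurable
      (ae_of_all _ fun x => by rw [Real.norm_of_nonneg (h0 x)]; exact hR x)
  have hf0 : ∀ r, 0 ≤ f r := fun r => integral_nonneg h0
  have hfR : ∀ r, f r ≤ R := fun r => by
    have := integral_mono (hφi r) (integrable_const R) hR
    simpa using this
  have pt : ∀ r ∈ Icc 0 T, ∀ x, |fpOp e (b r) φ x| ≤ a * (1 + φ x) := by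
    intro r hr x
    have h3 : |dirDeriv (b r x) φ x| ≤ A * (1 + φ x) * K := by
      by_cases hd : dirDeriv (b r x) φ x = 0
      · rw [hd, abs_zero]
        have := h0 x
        positivity
      · have hx : 0 < 1 + ‖x‖ := by positivity
        have := h1 (b r x) x
        have h4 := mul_le_mul_of_nonneg_left (hb r hr x)
          (by have := h0 x; positivity : 0 ≤ A * (1 + φ x))
        refine le_of_mul_le_mul_right ?_ hx
        linarith
    have h4 := h2 x
    have h5 := abs_add_le (dirDeriv (b r x) φ x) (dirLaplacian e φ x)
    rw [fpOp, ha]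
    have := mul_nonneg hA.le (h0 x)
    linarith
  have hg : ∀ r ∈ Icc 0 T, ∫ x, fpOp e (b r) φ x ∂(ρ r : Measure E) ≤ a * (1 + f r) := by
    intro r hr
    refine (le_abs_self _).trans ?_
    rw [← Real.norm_eq_abs]
    refine (norm_integral_le_of_norm_le (((integrable_const 1).add (hφi r)).const_mul a)
      (ae_of_all _ (pt r hr))).trans (le_of_eq ?_)
    rw [integral_const_mul, integral_add' (integrable_const _) (hφi r)]
    simp [hf]
  -- Gronwall by a weighted supremum. The weight has rate `2 a`, twice the growth rate, so that
  -- integration gains a factor `1/2` and `V ≤ 1 + f 0 + V / 2`. The bound `R` makes `V` finite and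
  -- does not enter the conclusion.
  set S : Set ℝ := (fun s => Real.exp (-(2 * a * s)) * (1 + f s)) '' Icc 0 T with hS
  have hSb : BddAbove S := by
    refine ⟨1 + R, ?_⟩
    rintro _ ⟨s, hs, rfl⟩
    have : Real.exp (-(2 * a * s)) ≤ 1 := Real.exp_le_one_iff.2 (by
      have := mul_nonneg ha0.le hs.1
      linarith)
    have h3 := hfR s
    have h4 := hf0 s
    calc _ ≤ 1 * (1 + R) := mul_le_mul this (by linarith) (by linarith) zero_le_one
      _ = 1 + R := one_mul _
  set V := sSup S with hV
  have hSV : ∀ s ∈ Icc 0 T, 1 + f s ≤ V * Real.exp (2 * a * s) := by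
    intro s hs
    have h3 : Real.exp (-(2 * a * s)) * (1 + f s) ≤ V := le_csSup hSb ⟨s, hs, rfl⟩
    rw [Real.exp_neg, inv_mul_le_iff₀ (Real.exp_pos _)] at h3
    linarith
  have step : ∀ s ∈ Icc 0 T, Real.exp (-(2 * a * s)) * (1 + f s) ≤ 1 + f 0 + V / 2 := by
    intro s hs
    obtain ⟨i1, e1⟩ := h.weak_extend hφ hs.1
    have i2 : IntervalIntegrable (fun r => a * (V * Real.exp (2 * a * r))) volume 0 s :=
      Continuous.intervalIntegrable (by fun_prop) _ _
    have h3 : ∫ r in (0 : ℝ)..s, ∫ x, fpOp e (b r) φ x ∂(ρ r : Measure E) ≤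
        ∫ r in (0 : ℝ)..s, a * (V * Real.exp (2 * a * r)) := by
      refine intervalIntegral.integral_mono_on hs.1 i1 i2 fun r hr => ?_
      have hr' : r ∈ Icc 0 T := ⟨hr.1, hr.2.trans hs.2⟩
      exact (hg r hr').trans (mul_le_mul_of_nonneg_left (hSV r hr') ha0.le)
    have h4 : ∫ r in (0 : ℝ)..s, a * (V * Real.exp (2 * a * r)) =
        V / 2 * (Real.exp (2 * a * s) - 1) := by
      rw [intervalIntegral.integral_const_mul, intervalIntegral.integral_const_mul,
        intervalIntegral.integral_comp_mul_left (fun x => Real.exp x) (by positivity),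
        integral_exp]
      simp
      field_simp
    have hV0 : 0 ≤ V := by
      have := hSV 0 ⟨le_rfl, hT⟩
      have h5 := hf0 0
      simp at this
      linarith
    have h5 : Real.exp (-(2 * a * s)) ≤ 1 := Real.exp_le_one_iff.2 (by
      have := mul_nonneg ha0.le hs.1
      linarith)
    have h6 : 1 + f s ≤ (1 + f 0) + V / 2 * Real.exp (2 * a * s) := by
      have : f s - f 0 ≤ V / 2 * (Real.exp (2 * a * s) - 1) := by
        rw [← h4]
        exact e1.trans_le h3
      linarith
    have h7 := mul_le_mul_of_nonneg_left h6 (Real.exp_pos (-(2 * a * s))).le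
    have h8 : Real.exp (-(2 * a * s)) * Real.exp (2 * a * s) = 1 := by
      rw [← Real.exp_add]; simp
    have h9 : Real.exp (-(2 * a * s)) * (1 + f 0) ≤ 1 + f 0 :=
      mul_le_of_le_one_left (by linarith [hf0 0]) h5
    calc _ ≤ _ := h7
      _ = Real.exp (-(2 * a * s)) * (1 + f 0)
          + V / 2 * (Real.exp (-(2 * a * s)) * Real.exp (2 * a * s)) := by ring
      _ ≤ _ := by rw [h8]; linarith
  have hVle : V ≤ 1 + f 0 + V / 2 := by
    refine csSup_le ⟨_, 0, ⟨le_rfl, hT⟩, rfl⟩ ?_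
    rintro _ ⟨s, hs, rfl⟩
    exact step s hs
  have h3 := hSV t ht
  have h4 : Real.exp (2 * a * t) ≤ Real.exp (2 * a * T) :=
    Real.exp_le_exp.2 (mul_le_mul_of_nonneg_left ht.2 (by positivity))
  calc f t ≤ V * Real.exp (2 * a * t) := by linarith
    _ ≤ 2 * (1 + f 0) * Real.exp (2 * a * T) :=
      mul_le_mul (by linarith) h4 (Real.exp_pos _).le (by linarith [hf0 0])

end Moments

/-! ### Averages of image measures. -/

section AverageMap

variable {J X Y Z : Type*} [Fintype J] [MeasurableSpace X] [MeasurableSpace Y] [MeasurableSpace Z]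

/-- The average of the images of `μ` under the maps `f j`. -/
noncomputable def avgMap (f : J → X → Y) (μ : Measure X) : Measure Y :=
  (Fintype.card J : ℝ≥0∞)⁻¹ • ∑ j, μ.map (f j)

lemma lintegral_avgMap {f : J → X → Y} (hf : ∀ j, Measurable (f j)) (μ : Measure X)
    {g : Y → ℝ≥0∞} (hg : Measurable g) :
    ∫⁻ y, g y ∂(avgMap f μ) = (Fintype.card J : ℝ≥0∞)⁻¹ * ∑ j, ∫⁻ x, g (f j x) ∂μ := by
  rw [avgMap, lintegral_smul_measure, lintegral_finsetSum_measure, smul_eq_mul]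
  congr 1
  exact Finset.sum_congr rfl fun j _ => lintegral_map hg (hf j)

lemma isProbabilityMeasure_avgMap [Nonempty J] {f : J → X → Y} (hf : ∀ j, Measurable (f j))
    (μ : Measure X) [IsProbabilityMeasure μ] : IsProbabilityMeasure (avgMap f μ) := by
  constructor
  have h : ∀ j, (μ.map (f j)) univ = 1 := fun j => by
    rw [Measure.map_apply (hf j) MeasurableSet.univ, preimage_univ, measure_univ]
  simp [avgMap, h]
  exact ENNReal.inv_mul_cancel (by simp) (by simp)

lemma integral_avgMap {f : J → X → Y} (hf : ∀ j, Measurable (f j)) (μ : Measure X)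
    {g : Y → ℝ} (hg : StronglyMeasurable g) (hi : ∀ j, Integrable (fun x => g (f j x)) μ) :
    ∫ y, g y ∂(avgMap f μ) = (Fintype.card J : ℝ)⁻¹ * ∑ j, ∫ x, g (f j x) ∂μ := by
  rw [avgMap, integral_smul_measure, integral_finsetSum_measure, smul_eq_mul]
  · simp only [ENNReal.toReal_inv, ENNReal.toReal_natCast]
    congr 1
    exact Finset.sum_congr rfl fun j _ => integral_map (hf j).aemeasurable hg.aestronglyMeasurable
  · intro j _
    exact (integrable_map_measure hg.aestronglyMeasurable (hf j).aemeasurable).2 (hi j)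

lemma map_avgMap {f : J → X → Y} (hf : ∀ j, Measurable (f j)) (μ : Measure X) {g : Y → Z}
    (hg : Measurable g) : (avgMap f μ).map g = avgMap (fun j x => g (f j x)) μ := by
  ext s hs
  rw [Measure.map_apply hg hs]
  simp only [avgMap, Measure.smul_apply, Measure.finsetSum_apply]
  congr 1
  refine Finset.sum_congr rfl fun j _ => ?_
  rw [Measure.map_apply (hf j) (hg hs)]
  exact (Measure.map_apply (hg.comp (hf j)) hs).symm

lemma avgMap_map {f : J → Y → Z} (hf : ∀ j, Measurable (f j)) (μ : Measure X) {g : X → Y}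
    (hg : Measurable g) : avgMap f (μ.map g) = avgMap (fun j x => f j (g x)) μ := by
  simp only [avgMap]
  congr 1
  exact Finset.sum_congr rfl fun j _ => Measure.map_map (hf j) hg

end AverageMap

/-! ### The Euler scheme with finitely valued noise. -/

section Scheme

variable {E : Type*} [NormedAddCommGroup E] [NormedSpace ℝ E] {ι : Type*} [Fintype ι]

/-- The increments of the noise during a time step `τ`: `0` and `± √((2 |ι| + 1) τ) e i`. -/
noncomputable def noiseVec (e : ι → E) (τ : ℝ) : Option (ι × Bool) → E
  | none => 0
  | some (i, true) => √((2 * Fintype.card ι + 1) * τ) • e i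
  | some (i, false) => -(√((2 * Fintype.card ι + 1) * τ) • e i)

/-- This cardinality normalises the noise: each direction is hit with probability `2 / (2 |ι| + 1)`,
and the squared amplitude `(2 |ι| + 1) τ` turns this into the variance `2 τ` that belongs to a
Laplacian without factor `1/2`. The zero outcome keeps the set of outcomes nonempty when `ι` is
empty. -/
lemma card_option_prod_bool :
    (Fintype.card (Option (ι × Bool)) : ℝ) = 2 * Fintype.card ι + 1 := by
  simp [mul_comm]

lemma sum_option_prod_bool {M : Type*} [AddCommMonoid M] (g : Option (ι × Bool) → M) :
    ∑ j, g j = g none + ∑ i, (g (some (i, true)) + g (some (i, false))) := by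
  rw [Fintype.sum_option, Fintype.sum_prod_type]
  simp

/-- One step of the Euler scheme with drift `b`, for a given value of the noise. -/
noncomputable def eulerStep (e : ι → E) (τ : ℝ) (b : E → E) (j : Option (ι × Bool)) (x : E) : E :=
  x + τ • b x + noiseVec e τ j

/-- The Markov operator of one step of the Euler scheme. -/
noncomputable def eulerOp (e : ι → E) (τ : ℝ) (b : E → E) (u : E → ℝ) (x : E) : ℝ :=
  (Fintype.card (Option (ι × Bool)) : ℝ)⁻¹ * ∑ j, u (eulerStep e τ b j x)

lemma abs_avg_le {J : Type*} [Fintype J] [Nonempty J] {a : J → ℝ} {c : ℝ} (h : ∀ j, |a j| ≤ c) :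
    |(Fintype.card J : ℝ)⁻¹ * ∑ j, a j| ≤ c := by
  have hJ : (0 : ℝ) < Fintype.card J := by exact_mod_cast Fintype.card_pos
  rw [abs_mul, abs_of_pos (inv_pos.2 hJ), inv_mul_le_iff₀ hJ]
  refine (Finset.abs_sum_le_sum_abs _ _).trans ((Finset.sum_le_sum fun j _ => h j).trans ?_)
  simp

lemma avg_sub_avg {J : Type*} [Fintype J] (a a' : J → ℝ) :
    (Fintype.card J : ℝ)⁻¹ * ∑ j, a j - (Fintype.card J : ℝ)⁻¹ * ∑ j, a' j =
      (Fintype.card J : ℝ)⁻¹ * ∑ j, (a j - a' j) := by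
  rw [Finset.sum_sub_distrib, mul_sub]

lemma avg_const {J : Type*} [Fintype J] [Nonempty J] (a : ℝ) :
    (Fintype.card J : ℝ)⁻¹ * ∑ _j : J, a = a := by
  simp

lemma continuous_eulerStep (e : ι → E) (τ : ℝ) {b : E → E} (hb : Continuous b)
    (j : Option (ι × Bool)) : Continuous (eulerStep e τ b j) := by
  unfold eulerStep
  fun_prop

lemma continuous_eulerOp (e : ι → E) (τ : ℝ) {b : E → E} (hb : Continuous b) {u : E → ℝ}
    (hu : Continuous u) : Continuous (eulerOp e τ b u) :=
  continuous_const.mul (continuous_finsetSum _ fun j _ => hu.comp (continuous_eulerStep e τ hb j))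

lemma abs_eulerOp_le (e : ι → E) (τ : ℝ) (b : E → E) {u : E → ℝ} {C : ℝ} (hu : ∀ x, |u x| ≤ C)
    (x : E) : |eulerOp e τ b u x| ≤ C :=
  abs_avg_le fun _ => hu _

/-- Additive noise cancels in the difference of two steps, so only the drift enlarges the Lipschitz
constant. Over `m` steps of total length `T` the factor stays below `exp (L T)`. -/
lemma lipschitz_eulerOp (e : ι → E) {τ L Λ : ℝ} (hτ : 0 ≤ τ) {b : E → E} (hΛ : 0 ≤ Λ)
    (hb : ∀ x y, ‖b x - b y‖ ≤ L * ‖x - y‖) {u : E → ℝ} (hu : ∀ x y, |u x - u y| ≤ Λ * ‖x - y‖)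
    (x y : E) : |eulerOp e τ b u x - eulerOp e τ b u y| ≤ Λ * (1 + τ * L) * ‖x - y‖ := by
  rw [eulerOp, eulerOp, avg_sub_avg]
  refine abs_avg_le fun j => (hu _ _).trans ?_
  rw [mul_assoc]
  refine mul_le_mul_of_nonneg_left ?_ hΛ
  have : eulerStep e τ b j x - eulerStep e τ b j y = (x - y) + τ • (b x - b y) := by
    simp only [eulerStep, smul_sub]; abel
  rw [this]
  refine (norm_add_le _ _).trans ?_
  rw [norm_smul, Real.norm_of_nonneg hτ]
  have := mul_le_mul_of_nonneg_left (hb x y) hτ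
  linarith

lemma norm_noiseVec_le (e : ι → E) (τ : ℝ) (j : Option (ι × Bool)) :
    ‖noiseVec e τ j‖ ≤ √τ * (√(2 * Fintype.card ι + 1) * ∑ i, ‖e i‖) := by
  have h0 : 0 ≤ ∑ i, ‖e i‖ := Finset.sum_nonneg fun i _ => norm_nonneg _
  have key : ∀ i, ‖√((2 * Fintype.card ι + 1) * τ) • e i‖ ≤
      √τ * (√(2 * Fintype.card ι + 1) * ∑ i, ‖e i‖) := by
    intro i
    rw [norm_smul, Real.norm_of_nonneg (Real.sqrt_nonneg _), Real.sqrt_mul (by positivity),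
      mul_comm (√(2 * (Fintype.card ι : ℝ) + 1)), mul_assoc]
    gcongr
    exact Finset.single_le_sum (f := fun i => ‖e i‖) (fun i _ => norm_nonneg _) (Finset.mem_univ i)
  rcases j with _ | ⟨i, _ | _⟩
  · simp only [noiseVec, norm_zero]
    positivity
  · simpa only [noiseVec, norm_neg] using key i
  · exact key i

/-- A noisy step has length of order `√τ`, and a Lipschitz function cannot exploit the symmetry of
the noise. The contribution of the drift is absorbed through `τ ≤ √τ`. -/
lemma abs_eulerOp_sub_le (e : ι → E) {τ Λ : ℝ} (hτ : 0 ≤ τ) (hτ1 : τ ≤ 1) {b : E → E} (hΛ : 0 ≤ Λ)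
    {K : ℝ} (hb : ∀ x, ‖b x‖ ≤ K * (1 + ‖x‖))
    {u : E → ℝ} (hu : ∀ x y, |u x - u y| ≤ Λ * ‖x - y‖) (x : E) :
    |eulerOp e τ b u x - u x| ≤
      Λ * √τ * (K + √(2 * Fintype.card ι + 1) * ∑ i, ‖e i‖) * (1 + ‖x‖) := by
  rw [eulerOp, ← avg_const (J := Option (ι × Bool)) (u x), avg_sub_avg]
  refine abs_avg_le fun j => (hu _ _).trans ?_
  rw [mul_assoc, mul_assoc]
  refine mul_le_mul_of_nonneg_left ?_ hΛ
  have h1 : eulerStep e τ b j x - x = τ • b x + noiseVec e τ j := by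
    simp only [eulerStep]; abel
  rw [h1]
  refine (norm_add_le _ _).trans ?_
  rw [norm_smul, Real.norm_of_nonneg hτ]
  have h2 := norm_noiseVec_le e τ j
  have h3 : τ ≤ √τ := Real.le_sqrt_of_sq_le (by nlinarith)
  have h4 : τ * ‖b x‖ ≤ √τ * (K * (1 + ‖x‖)) :=
    mul_le_mul h3 (hb x) (norm_nonneg _) (Real.sqrt_nonneg _)
  have h5 : 0 ≤ √τ * (√(2 * Fintype.card ι + 1) * ∑ i, ‖e i‖) := (norm_nonneg _).trans h2
  have h6 := mul_nonneg h5 (norm_nonneg x)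
  linarith

end Scheme

/-! ### Consistency of the Euler scheme. -/

section LocalError

open Filter Topology

variable {E : Type*} [NormedAddCommGroup E] [NormedSpace ℝ E] {ι : Type*} [Fintype ι]

lemma HasBoundedDerivs.sub {e : ι → E} {φ ψ : E → ℝ} {K K' : ℝ} (hφ : HasBoundedDerivs e φ K)
    (hψ : HasBoundedDerivs e ψ K') : HasBoundedDerivs e (fun x => φ x - ψ x) (K + K') := by
  refine ⟨hφ.contDiff.sub hψ.contDiff, fun v x => ?_, fun x => ?_⟩
  · rw [dirDeriv_sub hφ.differentiable hψ.differentiable, add_mul]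
    exact (abs_sub _ _).trans (add_le_add (hφ.abs_dirDeriv_le v x) (hψ.abs_dirDeriv_le v x))
  · rw [dirLaplacian_sub hφ.contDiff hψ.contDiff]
    exact (abs_sub _ _).trans (add_le_add (hφ.abs_dirLaplacian_le x) (hψ.abs_dirLaplacian_le x))

lemma dirDeriv_smul (r : ℝ) (v : E) (φ : E → ℝ) :
    dirDeriv (r • v) φ = fun x => r * dirDeriv v φ x := by
  ext x
  simp [dirDeriv]

lemma dirDeriv_dirDeriv_smul {φ : E → ℝ} (hφ : ContDiff ℝ (⊤ : ℕ∞) φ) (r : ℝ) (v x : E) :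
    dirDeriv (r • v) (dirDeriv (r • v) φ) x = r ^ 2 * dirDeriv v (dirDeriv v φ) x := by
  rw [dirDeriv_smul r v (dirDeriv _ _), dirDeriv_smul,
    dirDeriv_const_mul ((contDiff_dirDeriv hφ v).differentiable (by simp))]
  ring

/-- Consistency of the Euler scheme on functions with Lipschitz derivatives. -/
lemma abs_eulerOp_sub_sub_le {e : ι → E} {F : E → ℝ} (hFs : ContDiff ℝ (⊤ : ℕ∞) F) {H : ι → ℝ} {G K τ : ℝ}
    (hH : ∀ i, 0 ≤ H i) (hG : 0 ≤ G) (hK : 0 ≤ K) (hτ : 0 ≤ τ) (hτ1 : τ ≤ 1) {b : E → E}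
    (hFH : ∀ i x y, |dirDeriv (e i) (dirDeriv (e i) F) x - dirDeriv (e i) (dirDeriv (e i) F) y| ≤
      H i * ‖x - y‖)
    (hFG : ∀ v x y, |dirDeriv v F x - dirDeriv v F y| ≤ G * ‖v‖ * ‖x - y‖)
    (hb : ∀ x, ‖b x‖ ≤ K * (1 + ‖x‖)) (x : E) :
    |eulerOp e τ b F x - F x - τ * fpOp e b F x| ≤
      τ * (√τ * ((2 * √(2 * Fintype.card ι + 1) * (∑ i, ‖e i‖) * (∑ i, H i)
        + K * (∑ i, H i) + G * K ^ 2) * (1 + ‖x‖) ^ 2)) := by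
  set N : ℝ := 2 * Fintype.card ι + 1 with hN
  have hN1 : 1 ≤ N := by
    have : (0 : ℝ) ≤ Fintype.card ι := Nat.cast_nonneg _
    linarith
  set r := √(N * τ) with hr
  have hr2 : r ^ 2 = N * τ := Real.sq_sqrt (by positivity)
  have hr0 : 0 ≤ r := Real.sqrt_nonneg _
  have hrs : r = √N * √τ := Real.sqrt_mul (by positivity) _
  have hS : 0 ≤ ∑ i, ‖e i‖ := Finset.sum_nonneg fun i _ => norm_nonneg _
  have hM : 0 ≤ ∑ i, H i := Finset.sum_nonneg fun i _ => hH i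
  have h3 : τ ≤ √τ := Real.le_sqrt_of_sq_le (by nlinarith)
  have hs0 := Real.sqrt_nonneg τ
  -- The step is split into a drift move from `x` to `y` and a noise move from `y`. The latter
  -- produces the Laplacian at `y` (`t1`), which is transported back to `x` (`t2`); the former
  -- produces the first-order term (`t3`). Errors of order `τ ^ 2` are weakened to `τ * √τ`.
  set y := x + τ • b x with hy
  have hbx : ‖τ • b x‖ ≤ τ * (K * (1 + ‖x‖)) := by
    rw [norm_smul, Real.norm_of_nonneg hτ]
    exact mul_le_mul_of_nonneg_left (hb x) hτ
  have hx1 : 1 ≤ 1 + ‖x‖ := by linarith [norm_nonneg x]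
  have hx2 : 1 + ‖x‖ ≤ (1 + ‖x‖) ^ 2 := by nlinarith
  have hx3 : 1 ≤ (1 + ‖x‖) ^ 2 := hx1.trans hx2
  have t1 : |eulerOp e τ b F x - F y - τ * dirLaplacian e F y| ≤
      τ * (√τ * (2 * √N * (∑ i, ‖e i‖) * (∑ i, H i))) := by
    have hsd : ∀ i, |F (y + r • e i) + F (y - r • e i) - 2 * F y
        - N * τ * dirDeriv (e i) (dirDeriv (e i) F) y| ≤
        2 * (N * τ * (H i * (r * ‖e i‖))) := by
      intro i
      have := abs_second_difference_le (φ := F) hFs (x := y) (v := r • e i)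
        (c := N * τ * (H i * (r * ‖e i‖))) ?_
      · rwa [dirDeriv_dirDeriv_smul hFs, hr2] at this
      · intro s hs
        rw [dirDeriv_dirDeriv_smul hFs, dirDeriv_dirDeriv_smul hFs, hr2, ← mul_sub, abs_mul,
          abs_of_nonneg (by positivity : 0 ≤ N * τ)]
        refine mul_le_mul_of_nonneg_left ((hFH i _ _).trans
          (mul_le_mul_of_nonneg_left ?_ (hH i))) (by positivity)
        rw [add_sub_cancel_left, norm_smul, norm_smul, Real.norm_of_nonneg hr0]
        exact mul_le_of_le_one_left (by positivity) hs
    -- The zero outcome contributes `F y` and drops out; the other outcomes pair into symmetric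
    -- second differences.
    have hsum : eulerOp e τ b F x - F y - τ * dirLaplacian e F y = N⁻¹ *
        ∑ i, (F (y + r • e i) + F (y - r • e i) - 2 * F y
          - N * τ * dirDeriv (e i) (dirDeriv (e i) F) y) := by
      rw [eulerOp, card_option_prod_bool, sum_option_prod_bool, dirLaplacian]
      simp only [eulerStep, noiseVec, add_zero, ← hN, ← hr, ← hy, ← sub_eq_add_neg]
      rw [Finset.sum_sub_distrib, Finset.sum_sub_distrib]
      simp only [Finset.sum_const, Finset.card_univ, nsmul_eq_mul, ← Finset.mul_sum]
      have : (Fintype.card ι : ℝ) = (N - 1) / 2 := by rw [hN]; ring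
      rw [this]
      field_simp
      ring
    rw [hsum, abs_mul, abs_of_pos (inv_pos.2 (by linarith : 0 < N)), inv_mul_le_iff₀ (by linarith)]
    refine (Finset.abs_sum_le_sum_abs _ _).trans ((Finset.sum_le_sum fun i _ => hsd i).trans ?_)
    have : ∀ i, 2 * (N * τ * (H i * (r * ‖e i‖))) ≤ 2 * r * N * τ * (∑ i, ‖e i‖) * H i := by
      intro i
      have h5 : ‖e i‖ ≤ ∑ i, ‖e i‖ := Finset.single_le_sum (f := fun i => ‖e i‖)
        (fun i _ => norm_nonneg _) (Finset.mem_univ i)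
      have := hH i
      calc _ = 2 * r * N * τ * ‖e i‖ * H i := by ring
        _ ≤ _ := by gcongr
    refine (Finset.sum_le_sum fun i _ => this i).trans (le_of_eq ?_)
    rw [← Finset.mul_sum, hrs]
    ring
  have t2 : |dirLaplacian e F y - dirLaplacian e F x| ≤ (∑ i, H i) * (τ * (K * (1 + ‖x‖))) := by
    rw [dirLaplacian, dirLaplacian, ← Finset.sum_sub_distrib, Finset.sum_mul]
    refine (Finset.abs_sum_le_sum_abs _ _).trans (Finset.sum_le_sum fun i _ => ?_)
    refine (hFH i _ _).trans (mul_le_mul_of_nonneg_left ?_ (hH i))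
    rwa [hy, add_sub_cancel_left]
  have t3 : |F y - F x - τ * dirDeriv (b x) F x| ≤
      G * (τ * (K * (1 + ‖x‖))) * (τ * (K * (1 + ‖x‖))) := by
    have := abs_taylor_one_le (hFs.differentiable (by simp)) (x := x) (v := τ • b x)
      (c := G * (τ * (K * (1 + ‖x‖))) * (τ * (K * (1 + ‖x‖)))) ?_
    · rwa [dirDeriv_smul] at this
    · intro s hs
      refine (hFG _ _ _).trans ?_
      rw [add_sub_cancel_left]
      have : ‖s • τ • b x‖ ≤ τ * (K * (1 + ‖x‖)) := by
        rw [norm_smul, Real.norm_of_nonneg hs.1]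
        exact (mul_le_of_le_one_left (norm_nonneg _) hs.2).trans hbx
      gcongr
  have e1 : eulerOp e τ b F x - F x - τ * fpOp e b F x =
      (eulerOp e τ b F x - F y - τ * dirLaplacian e F y)
      + τ * (dirLaplacian e F y - dirLaplacian e F x)
      + (F y - F x - τ * dirDeriv (b x) F x) := by rw [fpOp]; ring
  rw [e1]
  have t2' : |τ * (dirLaplacian e F y - dirLaplacian e F x)| ≤
      τ * (√τ * (K * (∑ i, H i) * (1 + ‖x‖) ^ 2)) := by
    rw [abs_mul, abs_of_nonneg hτ]
    calc _ ≤ τ * ((∑ i, H i) * (τ * (K * (1 + ‖x‖)))) := mul_le_mul_of_nonneg_left t2 hτ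
      _ = τ * (τ * (K * (∑ i, H i) * (1 + ‖x‖))) := by ring
      _ ≤ _ := by gcongr
  have t3' : |F y - F x - τ * dirDeriv (b x) F x| ≤
      τ * (√τ * (G * K ^ 2 * (1 + ‖x‖) ^ 2)) := by
    refine t3.trans ?_
    calc _ = τ * (τ * (G * K ^ 2 * (1 + ‖x‖) ^ 2)) := by ring
      _ ≤ _ := by gcongr
  have t1' : τ * (√τ * (2 * √N * (∑ i, ‖e i‖) * (∑ i, H i))) ≤
      τ * (√τ * (2 * √N * (∑ i, ‖e i‖) * (∑ i, H i) * (1 + ‖x‖) ^ 2)) := by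
    refine mul_le_mul_of_nonneg_left (mul_le_mul_of_nonneg_left ?_ hs0) hτ
    exact le_mul_of_one_le_right (by positivity) hx3
  have := abs_add_three (eulerOp e τ b F x - F y - τ * dirLaplacian e F y)
    (τ * (dirLaplacian e F y - dirLaplacian e F x)) (F y - F x - τ * dirDeriv (b x) F x)
  linarith

variable [MeasureSpace E]

/-- The `L¹` norms of the second derivatives of `k` along the `e i`. -/
noncomputable def hessMass (e : ι → E) (k : E → ℝ) : ℝ :=
  ∑ i, ∫ y, |dirDeriv (e i) (dirDeriv (e i) k) y|

lemma hessMass_nonneg (e : ι → E) (k : E → ℝ) : 0 ≤ hessMass e k :=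
  Finset.sum_nonneg fun _ _ => integral_nonneg fun _ => abs_nonneg _

variable [BorelSpace E] [FiniteDimensional ℝ E] [(volume : Measure E).IsAddHaarMeasure]
  {e : ι → E} {k : E → ℝ} {δ : ℝ}

/-- Both derivatives fall on the kernel, so the functions need only be uniformly close near the base
points. The ball is closed because the kernel vanishes in a neighbourhood of each point outside it,
and so do its derivatives there. -/
lemma abs_dirLaplacian_moll_sub_le (hk : IsMollifier k δ) {u w : E → ℝ} (hu : Continuous u)
    (hw : Continuous w) {x x' : E} {c : ℝ} (h : ∀ y, ‖y‖ ≤ δ → |u (x - y) - w (x' - y)| ≤ c) :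
    |dirLaplacian e (moll k u) x - dirLaplacian e (moll k w) x'| ≤ c * hessMass e k := by
  rw [dirLaplacian, dirLaplacian, ← Finset.sum_sub_distrib, hessMass, Finset.mul_sum]
  refine (Finset.abs_sum_le_sum_abs _ _).trans (Finset.sum_le_sum fun i _ => ?_)
  rw [dirDeriv_dirDeriv_moll hk.contDiff hk.hasCompactSupport hu,
    dirDeriv_dirDeriv_moll hk.contDiff hk.hasCompactSupport hw]
  refine abs_moll_sub_moll_le (contDiff_dirDeriv (contDiff_dirDeriv hk.contDiff _) _).continuous
    (hasCompactSupport_dirDeriv (hasCompactSupport_dirDeriv hk.hasCompactSupport _) _) hu hw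
    fun y hy => h y ?_
  by_contra hy'
  have h0 : k =ᶠ[𝓝 y] fun _ => 0 := by
    have : ∀ᶠ z in 𝓝 y, δ < ‖z‖ := continuous_norm.continuousAt.eventually_const_lt (not_le.1 hy')
    filter_upwards [this] with z hz
    by_contra hz'
    exact absurd (hk.norm_lt z hz') (not_lt.2 hz.le)
  refine hy ?_
  rw [(dirDeriv_congr (dirDeriv_congr h0 (e i)) (e i)).eq_of_nhds, dirDeriv_const, dirDeriv_const]

lemma abs_dirDeriv_moll_sub_moll_le (hk : IsMollifier k δ) {u w : E → ℝ} (hu : Continuous u)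
    (hw : Continuous w) {x x' v : E} {c : ℝ} (hc : 0 ≤ c)
    (h : ∀ y, ‖y‖ ≤ δ → |u (x - y) - w (x' - y)| ≤ c) :
    |dirDeriv v (moll k u) x - dirDeriv v (moll k w) x'| ≤ c * (gradMass k * ‖v‖) := by
  rw [dirDeriv_moll hk.contDiff hk.hasCompactSupport hu,
    dirDeriv_moll hk.contDiff hk.hasCompactSupport hw]
  refine (abs_moll_sub_moll_le (contDiff_dirDeriv hk.contDiff v).continuous
    (hasCompactSupport_dirDeriv hk.hasCompactSupport v) hu hw fun y hy => h y ?_).trans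
    (mul_le_mul_of_nonneg_left (integral_abs_dirDeriv_le hk.contDiff hk.hasCompactSupport v) hc)
  by_contra hy'
  have h0 : k =ᶠ[𝓝 y] fun _ => 0 := by
    have : ∀ᶠ z in 𝓝 y, δ < ‖z‖ := continuous_norm.continuousAt.eventually_const_lt (not_le.1 hy')
    filter_upwards [this] with z hz
    by_contra hz'
    exact absurd (hk.norm_lt z hz') (not_lt.2 hz.le)
  refine hy ?_
  rw [(dirDeriv_congr h0 v).eq_of_nhds, dirDeriv_const]

omit [FiniteDimensional ℝ E] in
lemma moll_eulerOp {k u : E → ℝ} (hk : IsMollifier k δ) (hu : Continuous u) (τ : ℝ) {b : E → E}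
    (hb : Continuous b) (x : E) :
    moll k (eulerOp e τ b u) x = (Fintype.card (Option (ι × Bool)) : ℝ)⁻¹ *
      ∑ j, moll k (fun z => u (eulerStep e τ b j z)) x := by
  have h : ∀ j, Integrable (fun y => k y * u (eulerStep e τ b j (x - y))) := fun j =>
    integrable_mul_comp_sub hk.contDiff.continuous hk.hasCompactSupport
      (u := fun z => u (eulerStep e τ b j z)) (hu.comp (continuous_eulerStep e τ hb j)) x
  simp only [moll, eulerOp]
  rw [← integral_finsetSum _ fun j _ => h j, ← integral_const_mul]
  refine integral_congr_ae (ae_of_all _ fun y => ?_)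
  simp only [Finset.mul_sum]
  exact Finset.sum_congr rfl fun j _ => by ring

omit [FiniteDimensional ℝ E] in
/-- Mollification and the Euler operator almost commute. -/
lemma abs_moll_eulerOp_sub_le (hk : IsMollifier k δ) {u : E → ℝ} {Λ L τ : ℝ} (hΛ : 0 ≤ Λ)
    (hL : 0 ≤ L) (hτ : 0 ≤ τ) {b : E → E} (hbc : Continuous b)
    (hu : ∀ x y, |u x - u y| ≤ Λ * ‖x - y‖)
    (hb : ∀ x y, ‖b x - b y‖ ≤ L * ‖x - y‖) (x : E) :
    |moll k (eulerOp e τ b u) x - eulerOp e τ b (moll k u) x| ≤ τ * Λ * (L * δ) := by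
  have hc := continuous_of_abs_sub_le hΛ hu
  rw [moll_eulerOp hk hc τ hbc, eulerOp, avg_sub_avg]
  refine abs_avg_le fun j => ?_
  have := abs_moll_sub_moll_le hk.contDiff.continuous hk.hasCompactSupport
    (u := fun z => u (eulerStep e τ b j z)) (w := u) (x := x) (x' := eulerStep e τ b j x)
    (c := τ * Λ * (L * δ)) (hc.comp (continuous_eulerStep e τ hbc j)) hc fun y hy => by
      refine (hu _ _).trans ?_
      -- The noise commutes with translations; what is left is the variation of the drift over a
      -- distance `δ`, weighted by `τ`.
      have h1 : eulerStep e τ b j (x - y) - (eulerStep e τ b j x - y) = τ • (b (x - y) - b x) := by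
        simp only [eulerStep, smul_sub]; abel
      rw [h1, norm_smul, Real.norm_of_nonneg hτ]
      have h2 := hb (x - y) x
      rw [sub_sub_cancel_left, norm_neg] at h2
      have h3 := h2.trans (mul_le_mul_of_nonneg_left (hk.norm_lt y hy).le hL)
      calc Λ * (τ * ‖b (x - y) - b x‖) ≤ Λ * (τ * (L * δ)) := by gcongr
        _ = τ * Λ * (L * δ) := by ring
  rwa [hk.integral_abs, mul_one] at this

/-- Consistency of the Euler scheme on mollified Lipschitz functions. -/
lemma abs_eulerOp_moll_sub_le (hk : IsMollifier k δ) {u : E → ℝ} {Λ K τ : ℝ} (hΛ : 0 ≤ Λ)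
    (hK : 0 ≤ K) (hτ : 0 ≤ τ) (hτ1 : τ ≤ 1) {b : E → E}
    (hu : ∀ x y, |u x - u y| ≤ Λ * ‖x - y‖)
    (hb : ∀ x, ‖b x‖ ≤ K * (1 + ‖x‖)) (x : E) :
    |eulerOp e τ b (moll k u) x - moll k u x - τ * fpOp e b (moll k u) x| ≤
      τ * Λ * (√τ * ((2 * √(2 * Fintype.card ι + 1) * (∑ i, ‖e i‖) * hessMass e k
        + K * hessMass e k + gradMass k * K ^ 2) * (1 + ‖x‖) ^ 2)) := by
  have hc := continuous_of_abs_sub_le hΛ hu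
  have hu' : ∀ x y z : E, |u (x - z) - u (y - z)| ≤ Λ * ‖x - y‖ := fun x y z => by
    have := hu (x - z) (y - z)
    rwa [sub_sub_sub_cancel_right] at this
  have := abs_eulerOp_sub_sub_le (e := e) (F := moll k u)
    (contDiff_moll hk.contDiff hk.hasCompactSupport hc)
    (H := fun i => Λ * ∫ y, |dirDeriv (e i) (dirDeriv (e i) k) y|) (G := Λ * gradMass k)
    (fun i => mul_nonneg hΛ (integral_nonneg fun _ => abs_nonneg _))
    (mul_nonneg hΛ (gradMass_nonneg k)) hK hτ hτ1 (fun i x y => ?_) (fun v x y => ?_) hb x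
  · refine this.trans (le_of_eq ?_)
    rw [← Finset.mul_sum, hessMass]
    ring
  · rw [dirDeriv_dirDeriv_moll hk.contDiff hk.hasCompactSupport hc]
    refine (abs_moll_sub_moll_le
      (contDiff_dirDeriv (contDiff_dirDeriv hk.contDiff (e i)) (e i)).continuous
      (hasCompactSupport_dirDeriv (hasCompactSupport_dirDeriv hk.hasCompactSupport (e i)) (e i))
      hc hc (c := Λ * ‖x - y‖) fun z _ => hu' x y z).trans (le_of_eq (by ring))
  · exact (abs_dirDeriv_moll_sub_moll_le hk hc hc (c := Λ * ‖x - y‖) (by positivity)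
      fun z _ => hu' x y z).trans (le_of_eq (by ring))

end LocalError

/-! ### Convergence of the Euler scheme to a given solution. -/

section Convergence

open Filter Topology

variable {E : Type*} [NormedAddCommGroup E] [NormedSpace ℝ E] {ι : Type*} [Fintype ι]
  [MeasureSpace E] [BorelSpace E] [FiniteDimensional ℝ E] [(volume : Measure E).IsAddHaarMeasure]
  {e : ι → E} {b : ℝ → E → E} {ρ : ℝ → ProbabilityMeasure E}

/-- The error of one step of the Euler scheme, tested against mollified Lipschitz functions. -/
lemma IsFPSolution.exists_local_error (h : IsFPSolution e b ρ) {T K L W δ : ℝ} {k : E → ℝ}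
    (hk : IsMollifier k δ) (hδ1 : δ ≤ 1) (hK : 0 ≤ K) (hL : 0 ≤ L)
    (hgr : ∀ t ∈ Icc 0 T, ∀ x, ‖b t x‖ ≤ K * (1 + ‖x‖))
    (hlip : ∀ t ∈ Icc 0 T, ∀ x y, ‖b t x - b t y‖ ≤ L * ‖x - y‖)
    (hW : ∀ t ∈ Icc 0 T, Integrable (fun x => (1 + ‖x‖) ^ 2) (ρ t : Measure E) ∧
      ∫ x, (1 + ‖x‖) ^ 2 ∂(ρ t : Measure E) ≤ W) :
    ∃ C, 0 ≤ C ∧ ∀ t τ ω Λ : ℝ, ∀ u : E → ℝ, 0 ≤ t → 0 < τ → τ ≤ 1 → t + τ ≤ T → 0 ≤ Λ →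
      (∀ r ∈ Icc t (t + τ), ∀ x, ‖b r x - b t x‖ ≤ ω) →
      (∀ x y, |u x - u y| ≤ Λ * ‖x - y‖) →
      |∫ x, moll k u x ∂(ρ (t + τ) : Measure E)
        - ∫ x, moll k (eulerOp e τ (b t) u) x ∂(ρ t : Measure E)| ≤
          τ * Λ * (L * δ + ω + √τ * C) := by
  set C₁ := 2 * √(2 * Fintype.card ι + 1) * (∑ i, ‖e i‖) * hessMass e k
        + K * hessMass e k + gradMass k * K ^ 2 with hC₁
  set C₂ := 2 * (K + √(2 * Fintype.card ι + 1) * ∑ i, ‖e i‖) with hC₂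
  set C₃ := C₂ * (gradMass k * K + hessMass e k) with hC₃
  have hS : 0 ≤ ∑ i, ‖e i‖ := Finset.sum_nonneg fun i _ => norm_nonneg _
  have hH := hessMass_nonneg e k
  have hG := gradMass_nonneg k
  have hC₁0 : 0 ≤ C₁ := by positivity
  have hC₂0 : 0 ≤ C₂ := by positivity
  have hC₃0 : 0 ≤ C₃ := by positivity
  by_cases hT : 0 ≤ T
  swap
  · refine ⟨0, le_rfl, fun t τ ω Λ u ht hτ _ hT' => ?_⟩
    linarith
  have hW0 : 0 ≤ W := (integral_nonneg fun x => sq_nonneg _).trans (hW 0 ⟨le_rfl, hT⟩).2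
  refine ⟨(C₁ + C₃) * W, by positivity, fun t τ ω Λ u ht hτ hτ1 htT hΛ hω hu => ?_⟩
  have htI : t ∈ Icc 0 T := ⟨ht, by linarith⟩
  set v := eulerOp e τ (b t) u with hv
  have huc := continuous_of_abs_sub_le hΛ hu
  have hΛ' : 0 ≤ Λ * (1 + τ * L) := by positivity
  have hvl : ∀ x y, |v x - v y| ≤ Λ * (1 + τ * L) * ‖x - y‖ :=
    lipschitz_eulerOp e hτ.le hΛ (hlip t htI) hu
  have hvc := continuous_of_abs_sub_le hΛ' hvl
  have hF := hk.hasBoundedDerivs e hΛ hu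
  have hGv := hk.hasBoundedDerivs e hΛ' hvl
  set F := moll k u with hFdef
  set G := moll k v with hGdef
  have hD := hGv.sub hF
  -- The increment of `F` in time has to be compared with the integral of `D` at the single time
  -- `t`. Pointwise, `D` is `τ` times the operator applied to `F`, up to the error in `hpt`. Moving
  -- the integral of `D` from time `r` to `t` is cheap (`hDt`) because `D` and its derivatives
  -- inherit the size `√τ` of `v - u`.
  set D : E → ℝ := fun x => G x - F x with hDdef
  have hs0 := Real.sqrt_nonneg τ
  have hω0 : 0 ≤ ω := (norm_nonneg _).trans (hω t ⟨le_rfl, by linarith⟩ 0)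
  have sub_Icc : ∀ r ∈ Icc t (t + τ), r ∈ Icc 0 T := fun r hr =>
    ⟨ht.trans hr.1, hr.2.trans htT⟩
  have int_of : ∀ r ∈ Icc 0 T, ∀ {φ : E → ℝ} {K' : ℝ}, HasBoundedDerivs e φ K' →
      Integrable φ (ρ r : Measure E) := fun r hr φ K' hφ =>
    integrable_of_abs_le_linear (h.integrable_norm r hr.1) hφ.contDiff.continuous hφ.abs_le
  have hvu : ∀ x, |v x - u x| ≤ Λ * √τ * (C₂ / 2) * (1 + ‖x‖) := fun x => by
    have := abs_eulerOp_sub_le e hτ.le hτ1 hΛ (hgr t htI) hu x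
    rwa [hC₂, mul_div_cancel_left₀ _ two_ne_zero]
  have hnear : ∀ x y : E, ‖y‖ ≤ δ → |v (x - y) - u (x - y)| ≤ Λ * √τ * C₂ * (1 + ‖x‖) := by
    intro x y hy
    refine (hvu _).trans ?_
    have h1 : 1 + ‖x - y‖ ≤ 2 * (1 + ‖x‖) := by
      have := norm_sub_le x y
      linarith [norm_nonneg x]
    calc _ ≤ Λ * √τ * (C₂ / 2) * (2 * (1 + ‖x‖)) := by gcongr
      _ = _ := by ring
  have hDop : ∀ r ∈ Icc t (t + τ), |∫ x, fpOp e (b r) D x ∂(ρ r : Measure E)| ≤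
      Λ * √τ * C₃ * W := by
    intro r hr
    have hr' := sub_Icc r hr
    rw [← Real.norm_eq_abs]
    refine (norm_integral_le_of_norm_le ((hW r hr').1.const_mul (Λ * √τ * C₃))
      (ae_of_all _ fun x => ?_)).trans ?_
    · have hx := norm_nonneg x
      have a1 : |dirDeriv (b r x) D x| ≤
          Λ * √τ * C₂ * (1 + ‖x‖) * (gradMass k * (K * (1 + ‖x‖))) := by
        rw [hDdef, dirDeriv_sub hGv.differentiable hF.differentiable]
        refine (abs_dirDeriv_moll_sub_moll_le hk hvc huc (by positivity) (hnear x)).trans ?_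
        have := hgr r hr' x
        gcongr
      have a2 : |dirLaplacian e D x| ≤ Λ * √τ * C₂ * (1 + ‖x‖) * hessMass e k := by
        rw [hDdef, dirLaplacian_sub hGv.contDiff hF.contDiff]
        exact abs_dirLaplacian_moll_sub_le hk hvc huc (hnear x)
      have a3 : Λ * √τ * C₂ * (1 + ‖x‖) * hessMass e k ≤
          Λ * √τ * C₂ * (1 + ‖x‖) ^ 2 * hessMass e k := by
        gcongr
        nlinarith
      rw [Real.norm_eq_abs, fpOp]
      refine (abs_add_le _ _).trans ((add_le_add a1 (a2.trans a3)).trans (le_of_eq ?_))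
      rw [hC₃]; ring
    · rw [integral_const_mul]
      exact mul_le_mul_of_nonneg_left (hW r hr').2 (by positivity)
  have hpt : ∀ r ∈ Icc t (t + τ), ∀ x, |τ * fpOp e (b r) F x - D x| ≤
      τ * Λ * (L * δ + ω) + τ * Λ * √τ * C₁ * (1 + ‖x‖) ^ 2 := by
    intro r hr x
    have a1 := abs_moll_eulerOp_sub_le (e := e) hk hΛ hL hτ.le (h.continuous_drift t ht) hu
      (hlip t htI) x
    have a2 := abs_eulerOp_moll_sub_le (e := e) hk hΛ hK hτ.le hτ1 hu (hgr t htI) x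
    have a3 : |dirDeriv (b r x - b t x) F x| ≤ Λ * ω := by
      refine (abs_dirDeriv_le_of_lipschitz hΛ (hk.lipschitz_moll hΛ hu) _ x).trans ?_
      exact mul_le_mul_of_nonneg_left (hω r hr x) hΛ
    have a4 : fpOp e (b r) F x = fpOp e (b t) F x + dirDeriv (b r x - b t x) F x := by
      simp only [fpOp, dirDeriv, map_sub]; ring
    have a5 : τ * fpOp e (b r) F x - D x = τ * dirDeriv (b r x - b t x) F x
        - (G x - eulerOp e τ (b t) F x)
        - (eulerOp e τ (b t) F x - F x - τ * fpOp e (b t) F x) := by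
      rw [a4, hDdef]; ring
    rw [a5]
    have a6 : |τ * dirDeriv (b r x - b t x) F x| ≤ τ * (Λ * ω) := by
      rw [abs_mul, abs_of_pos hτ]
      exact mul_le_mul_of_nonneg_left a3 hτ.le
    have a7 := abs_sub (τ * dirDeriv (b r x - b t x) F x - (G x - eulerOp e τ (b t) F x))
      (eulerOp e τ (b t) F x - F x - τ * fpOp e (b t) F x)
    have a8 := abs_sub (τ * dirDeriv (b r x - b t x) F x) (G x - eulerOp e τ (b t) F x)
    have a9 : τ * Λ * (√τ * (C₁ * (1 + ‖x‖) ^ 2)) = τ * Λ * √τ * C₁ * (1 + ‖x‖) ^ 2 := by ring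
    rw [a9] at a2
    linarith
  have hpt' : ∀ r ∈ Icc t (t + τ), |τ * ∫ x, fpOp e (b r) F x ∂(ρ r : Measure E)
      - ∫ x, D x ∂(ρ r : Measure E)| ≤ τ * Λ * (L * δ + ω) + τ * Λ * √τ * C₁ * W := by
    intro r hr
    have hr' := sub_Icc r hr
    rw [← integral_const_mul, ← integral_sub ((h.integrable_fpOp hF hr'.1).const_mul τ)
      (int_of r hr' hD), ← Real.norm_eq_abs]
    refine (norm_integral_le_of_norm_le ((integrable_const (τ * Λ * (L * δ + ω))).add
      ((hW r hr').1.const_mul (τ * Λ * √τ * C₁))) (ae_of_all _ (hpt r hr))).trans ?_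
    rw [integral_add' (integrable_const _) ((hW r hr').1.const_mul _), integral_const,
      integral_const_mul, probReal_univ, one_smul]
    gcongr
    exact (hW r hr').2
  have hDt : ∀ r ∈ Icc t (t + τ), |∫ x, D x ∂(ρ r : Measure E) - ∫ x, D x ∂(ρ t : Measure E)| ≤
      τ * (Λ * √τ * C₃ * W) := by
    intro r hr
    obtain ⟨-, e1⟩ := h.weak_between hD ht hr.1
    rw [e1, ← Real.norm_eq_abs]
    refine (intervalIntegral.norm_integral_le_of_norm_le_const (C := Λ * √τ * C₃ * W)
      fun s hs => ?_).trans ?_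
    · rw [uIoc_of_le hr.1] at hs
      exact hDop s ⟨hs.1.le, hs.2.trans hr.2⟩
    · rw [mul_comm, abs_of_nonneg (by linarith [hr.1])]
      exact mul_le_mul_of_nonneg_right (by linarith [hr.2]) (by positivity)
  obtain ⟨i1, e1⟩ := h.weak_between hF ht (by linarith : t ≤ t + τ)
  -- The integral of `D` at time `t` is spread evenly over the time step, so that the two terms can
  -- be compared at each time `r`.
  have e2 : ∫ x, F x ∂(ρ (t + τ) : Measure E) - ∫ x, G x ∂(ρ t : Measure E) =
      ∫ r in t..(t + τ), (∫ x, fpOp e (b r) F x ∂(ρ r : Measure E)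
        - τ⁻¹ * ∫ x, D x ∂(ρ t : Measure E)) := by
    rw [intervalIntegral.integral_sub i1 intervalIntegrable_const, ← e1,
      intervalIntegral.integral_const, add_sub_cancel_left, smul_eq_mul,
      mul_inv_cancel_left₀ hτ.ne', integral_sub (int_of t htI hGv) (int_of t htI hF)]
    ring
  rw [e2, ← Real.norm_eq_abs]
  refine (intervalIntegral.norm_integral_le_of_norm_le_const
    (C := Λ * (L * δ + ω + √τ * ((C₁ + C₃) * W))) fun r hr => ?_).trans (le_of_eq ?_)
  · rw [uIoc_of_le (by linarith)] at hr
    have hr' : r ∈ Icc t (t + τ) := ⟨hr.1.le, hr.2⟩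
    have b1 := hpt' r hr'
    have b2 := hDt r hr'
    refine le_of_mul_le_mul_left ?_ hτ
    rw [Real.norm_eq_abs, ← abs_of_pos hτ, ← abs_mul, abs_of_pos hτ, mul_sub,
      mul_inv_cancel_left₀ hτ.ne']
    have b3 : τ * ∫ x, fpOp e (b r) F x ∂(ρ r : Measure E) - ∫ x, D x ∂(ρ t : Measure E) =
        (τ * ∫ x, fpOp e (b r) F x ∂(ρ r : Measure E) - ∫ x, D x ∂(ρ r : Measure E))
        + (∫ x, D x ∂(ρ r : Measure E) - ∫ x, D x ∂(ρ t : Measure E)) := by ring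
    rw [b3]
    refine (abs_add_le _ _).trans ((add_le_add b1 b2).trans (le_of_eq ?_))
    ring
  · rw [add_sub_cancel_left, abs_of_pos hτ]; ring

/-- The laws of the Euler scheme with time step `τ` started from `μ`. -/
noncomputable def schemeLaw (e : ι → E) (b : ℝ → E → E) (τ : ℝ) (μ : Measure E) : ℕ → Measure E
  | 0 => μ
  | m + 1 => avgMap (eulerStep e τ (b (m * τ))) (schemeLaw e b τ μ m)

omit [FiniteDimensional ℝ E] [(volume : Measure E).IsAddHaarMeasure] in
lemma isProbabilityMeasure_schemeLaw [SecondCountableTopology E] {τ : ℝ} (hτ : 0 ≤ τ)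
    (hb : ∀ t, 0 ≤ t → Continuous (b t)) (μ : Measure E)
    [IsProbabilityMeasure μ] (m : ℕ) : IsProbabilityMeasure (schemeLaw e b τ μ m) := by
  induction m with
  | zero => assumption
  | succ m ih =>
    exact isProbabilityMeasure_avgMap
      (fun j => (continuous_eulerStep e τ (hb _ (by positivity)) j).measurable) _

/-- The accumulated error of the Euler scheme. -/
lemma IsFPSolution.abs_integral_schemeLaw_sub_le (h : IsFPSolution e b ρ) {T L δ τ ω C : ℝ}
    {k : E → ℝ} (hk : IsMollifier k δ) (hδ : 0 ≤ δ) (hL : 0 ≤ L)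
    (hlip : ∀ t ∈ Icc 0 T, ∀ x y, ‖b t x - b t y‖ ≤ L * ‖x - y‖) (hτ : 0 < τ) (hτ1 : τ ≤ 1)
    (hC : 0 ≤ C) (hω : ∀ t ∈ Icc 0 T, ∀ s ∈ Icc 0 T, |s - t| ≤ τ → ∀ x, ‖b s x - b t x‖ ≤ ω)
    (hloc : ∀ t τ ω Λ : ℝ, ∀ u : E → ℝ, 0 ≤ t → 0 < τ → τ ≤ 1 → t + τ ≤ T → 0 ≤ Λ →
      (∀ r ∈ Icc t (t + τ), ∀ x, ‖b r x - b t x‖ ≤ ω) →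
      (∀ x y, |u x - u y| ≤ Λ * ‖x - y‖) →
      |∫ x, moll k u x ∂(ρ (t + τ) : Measure E)
        - ∫ x, moll k (eulerOp e τ (b t) u) x ∂(ρ t : Measure E)| ≤
          τ * Λ * (L * δ + ω + √τ * C)) (m : ℕ) :
    m * τ ≤ T → ∀ (Λ M : ℝ) (u : E → ℝ), 0 ≤ Λ → (∀ x y, |u x - u y| ≤ Λ * ‖x - y‖) →
      (∀ x, |u x| ≤ M) →
      |∫ x, u x ∂(schemeLaw e b τ (ρ 0 : Measure E) m)
        - ∫ x, moll k u x ∂(ρ (m * τ) : Measure E)| ≤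
        Λ * (1 + τ * L) ^ m * (δ + m * τ * (L * δ + ω + √τ * C)) := by
  induction m with
  | zero =>
    intro _ Λ M u hΛ hu hM
    have hφ := hk.hasBoundedDerivs e hΛ hu
    have huc := continuous_of_abs_sub_le hΛ hu
    have i1 : Integrable u (ρ 0 : Measure E) :=
      (integrable_const M).mono' huc.aestronglyMeasurable (ae_of_all _ hM)
    have i2 : Integrable (moll k u) (ρ 0 : Measure E) :=
      integrable_of_abs_le_linear (h.integrable_norm 0 le_rfl) hφ.contDiff.continuous hφ.abs_le
    simp only [schemeLaw, Nat.cast_zero, zero_mul, pow_zero, mul_one, add_zero]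
    rw [← integral_sub i1 i2, ← Real.norm_eq_abs]
    refine (norm_integral_le_of_norm_le_const (C := Λ * δ) (ae_of_all _ fun x => ?_)).trans
      (le_of_eq (by simp))
    rw [Real.norm_eq_abs, abs_sub_comm]
    exact hk.abs_moll_sub_le_of_lipschitz hΛ hu x
  | succ m ih =>
    intro hmT Λ M u hΛ hu hM
    push_cast at hmT
    have hm0 : (0 : ℝ) ≤ m * τ := by positivity
    have hmI : (m : ℝ) * τ ∈ Icc 0 T := ⟨hm0, by nlinarith⟩
    have hω0 : 0 ≤ ω := (norm_nonneg _).trans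
      (hω (m * τ) hmI (m * τ) hmI (by rw [sub_self, abs_zero]; exact hτ.le) 0)
    have huc := continuous_of_abs_sub_le hΛ hu
    have hbc := h.continuous_drift (m * τ) hm0
    have hΛ' : 0 ≤ Λ * (1 + τ * L) := by positivity
    have hvl := lipschitz_eulerOp e hτ.le hΛ (hlip _ hmI) hu
    -- The last step of the scheme is moved onto the test function, so the induction hypothesis is
    -- needed for `eulerOp` of `u`; hence `u` and its constants are quantified inside the induction.
    have a1 := ih (by linarith) _ M _ hΛ' hvl (abs_eulerOp_le e τ (b (m * τ)) hM)
    have a2 := hloc (m * τ) τ ω Λ u hm0 hτ hτ1 (by linarith) hΛ (fun r hr x => by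
      refine hω _ hmI r ⟨hm0.trans hr.1, by linarith [hr.2]⟩ ?_ x
      rw [abs_of_nonneg (by linarith [hr.1])]
      linarith [hr.2]) hu
    have := isProbabilityMeasure_schemeLaw (e := e) hτ.le h.continuous_drift (ρ 0 : Measure E) m
    have ij : ∀ j, Integrable (fun x => u (eulerStep e τ (b (m * τ)) j x))
        (schemeLaw e b τ (ρ 0 : Measure E) m) := fun j =>
      (integrable_const M).mono'
        (huc.comp (continuous_eulerStep e τ hbc j)).aestronglyMeasurable (ae_of_all _ fun x => hM _)
    have e1 : ∫ x, u x ∂(schemeLaw e b τ (ρ 0 : Measure E) (m + 1)) =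
        ∫ x, eulerOp e τ (b (m * τ)) u x ∂(schemeLaw e b τ (ρ 0 : Measure E) m) := by
      rw [schemeLaw, integral_avgMap (fun j => (continuous_eulerStep e τ hbc j).measurable) _
        huc.stronglyMeasurable ij]
      simp only [eulerOp]
      rw [integral_const_mul, integral_finsetSum _ fun j _ => ij j]
    have e2 : ((m + 1 : ℕ) : ℝ) * τ = m * τ + τ := by push_cast; ring
    rw [e1, e2]
    set D := L * δ + ω + √τ * C with hD
    have hD0 : 0 ≤ D := by positivity
    have hp : 1 ≤ (1 + τ * L) ^ (m + 1) := one_le_pow₀ (by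
      have : 0 ≤ τ * L := by positivity
      linarith)
    have a3 : τ * Λ * D ≤ Λ * (1 + τ * L) ^ (m + 1) * (τ * D) := by
      have : Λ * 1 * (τ * D) ≤ Λ * (1 + τ * L) ^ (m + 1) * (τ * D) := by gcongr
      linarith
    rw [abs_sub_comm] at a2
    refine (abs_sub_le _ _ _).trans ((add_le_add a1 (a2.trans a3)).trans (le_of_eq ?_))
    rw [pow_succ]; ring

/-- The Euler scheme converges: a solution is determined by its initial value and its drift. -/
theorem IsFPSolution.tendsto_schemeLaw (h : IsFPSolution e b ρ) {T L W : ℝ} (hT : 0 < T)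
    (hL : 0 ≤ L) (hlip : ∀ t ∈ Icc 0 T, ∀ x y, ‖b t x - b t y‖ ≤ L * ‖x - y‖)
    (hω : ∀ ω > 0, ∃ h₀ > 0, ∀ t ∈ Icc 0 T, ∀ s ∈ Icc 0 T, |s - t| ≤ h₀ →
      ∀ x, ‖b s x - b t x‖ ≤ ω)
    (hW : ∀ t ∈ Icc 0 T, Integrable (fun x => (1 + ‖x‖) ^ 2) (ρ t : Measure E) ∧
      ∫ x, (1 + ‖x‖) ^ 2 ∂(ρ t : Measure E) ≤ W)
    (μ : ℕ → ProbabilityMeasure E)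
    (hμ : ∀ n : ℕ, (μ n : Measure E) =
      schemeLaw e b (T / (n + 1)) (ρ 0 : Measure E) (n + 1)) :
    Tendsto μ atTop (𝓝 (ρ T)) := by
  obtain ⟨K, hK, hgr⟩ := h.exists_bound hT.le
  refine tendsto_iff_forall_lipschitz_integral_tendsto.2 fun u hub hul => ?_
  obtain ⟨M₀, hM₀⟩ := hub
  obtain ⟨Λ', hΛ'⟩ := hul
  set Λ : ℝ := (Λ' : ℝ) with hΛdef
  have hΛ : 0 ≤ Λ := Λ'.2
  have hu : ∀ x y, |u x - u y| ≤ Λ * ‖x - y‖ := fun x y => by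
    have := hΛ'.dist_le_mul x y
    rwa [Real.dist_eq, dist_eq_norm] at this
  have hM : ∀ x, |u x| ≤ |u 0| + M₀ := fun x => by
    have h1 := hM₀ x 0
    rw [Real.dist_eq] at h1
    have := abs_sub_abs_le_abs_sub (u x) (u 0)
    linarith
  rw [Metric.tendsto_atTop]
  intro ε hε
  set B := Λ * Real.exp (L * T) with hB
  have hB0 : 0 ≤ B := by positivity
  set A := B * (1 + T * (L + 2)) + Λ + 1 with hA
  have hA0 : 0 < A := by positivity
  set η := min 1 (ε / (2 * A)) with hη
  have hη0 : 0 < η := by positivity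
  have hηA : A * η ≤ ε / 2 := by
    calc A * η ≤ A * (ε / (2 * A)) := mul_le_mul_of_nonneg_left (min_le_right _ _) hA0.le
      _ = ε / 2 := by field_simp
  -- The radius `η` is fixed first, because `C` depends on the kernel. Only then is the step taken
  -- so small that `√τ * C ≤ η`.
  obtain ⟨k, hk⟩ := exists_isMollifier (E := E) hη0
  obtain ⟨C, hC, hloc⟩ := h.exists_local_error hk (min_le_left _ _) hK hL
    (fun t ht => (hgr t ht).2) hlip hW
  obtain ⟨h₀, hh₀, hmod⟩ := hω η hη0
  have hlim : Tendsto (fun n : ℕ => T / ((n : ℝ) + 1)) atTop (𝓝 0) := by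
    have := (tendsto_one_div_add_atTop_nhds_zero_nat (𝕜 := ℝ)).const_mul T
    simpa [div_eq_mul_inv] using this
  have hlim2 : Tendsto (fun n : ℕ => √(T / ((n : ℝ) + 1)) * C) atTop (𝓝 0) := by
    have := ((Real.continuous_sqrt.tendsto 0).comp hlim).mul_const C
    simpa using this
  have ev : ∀ᶠ n : ℕ in atTop, T / ((n : ℝ) + 1) ≤ 1 ∧ T / ((n : ℝ) + 1) ≤ h₀ ∧
      √(T / ((n : ℝ) + 1)) * C ≤ η :=
    (hlim.eventually_le_const one_pos).and
      ((hlim.eventually_le_const hh₀).and (hlim2.eventually_le_const hη0))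
  obtain ⟨n₀, hn₀⟩ := eventually_atTop.1 ev
  refine ⟨n₀, fun n hn => ?_⟩
  obtain ⟨c1, c2, c3⟩ := hn₀ n hn
  have hn1 : (0 : ℝ) < (n : ℝ) + 1 := by positivity
  have e1 : ((n + 1 : ℕ) : ℝ) * (T / (n + 1)) = T := by
    push_cast
    field_simp
  have main := h.abs_integral_schemeLaw_sub_le hk hη0.le hL hlip (τ := T / (n + 1)) (by positivity)
    c1 hC (ω := η) (fun t ht s hs hst => hmod t ht s hs (hst.trans c2)) hloc (n + 1)
    e1.le Λ _ u hΛ hu hM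
  rw [e1, ← hμ] at main
  have hpow : (1 + T / (n + 1) * L) ^ (n + 1) ≤ Real.exp (L * T) := by
    have h1 : 1 + T / (n + 1) * L ≤ Real.exp (T / (n + 1) * L) := by
      have := Real.add_one_le_exp (T / (n + 1) * L)
      linarith
    calc (1 + T / (n + 1) * L) ^ (n + 1) ≤ (Real.exp (T / (n + 1) * L)) ^ (n + 1) :=
          pow_le_pow_left₀ (by positivity) h1 _
      _ = Real.exp (L * T) := by
          rw [← Real.exp_nat_mul]
          congr 1
          push_cast
          field_simp
  have m1 : Λ * (1 + T / (n + 1) * L) ^ (n + 1) *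
      (η + T * (L * η + η + √(T / (n + 1)) * C)) ≤ B * (1 + T * (L + 2)) * η := by
    calc _ ≤ B * (η + T * (L * η + η + η)) := by
          rw [hB]
          gcongr
      _ = _ := by ring
  have hφ := hk.hasBoundedDerivs e hΛ hu
  have huc := continuous_of_abs_sub_le hΛ hu
  have i1 : Integrable u (ρ T : Measure E) :=
    (integrable_const (|u 0| + M₀)).mono' huc.aestronglyMeasurable (ae_of_all _ hM)
  have i2 : Integrable (moll k u) (ρ T : Measure E) :=
    integrable_of_abs_le_linear (h.integrable_norm T hT.le) hφ.contDiff.continuous hφ.abs_le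
  have m2 : |∫ x, moll k u x ∂(ρ T : Measure E) - ∫ x, u x ∂(ρ T : Measure E)| ≤ Λ * η := by
    rw [← integral_sub i2 i1, ← Real.norm_eq_abs]
    refine (norm_integral_le_of_norm_le_const (C := Λ * η) (ae_of_all _ fun x => ?_)).trans
      (le_of_eq (by simp))
    exact hk.abs_moll_sub_le_of_lipschitz hΛ hu x
  rw [Real.dist_eq]
  refine lt_of_le_of_lt ((abs_sub_le _ _ _).trans (add_le_add (main.trans m1) m2)) ?_
  have : B * (1 + T * (L + 2)) * η + Λ * η = A * η - η := by rw [hA]; ring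
  linarith

end Convergence

/-! ### The phase space: the generator and the second moments. -/

section PhaseSpace

open Filter Topology

variable {d : ℕ}

/-- The directions in which the noise acts. -/
noncomputable def zDir (i : Fin d) : Phase d := (0, 0, EuclideanSpace.single i 1)

instance : (volume : Measure (Phase d)).IsAddHaarMeasure :=
  haveI : ((volume : Measure (Vec d)).prod (volume : Measure (Vec d))).IsAddHaarMeasure :=
    inferInstance
  Measure.prod.instIsAddHaarMeasure (volume : Measure (Vec d))
    ((volume : Measure (Vec d)).prod (volume : Measure (Vec d)))

lemma dirDeriv_zSlice {φ : Phase d → ℝ} (hφ : Differentiable ℝ φ) (q p z v : Vec d) :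
    fderiv ℝ (fun z : Vec d => φ (q, p, z)) z v = dirDeriv ((0, 0, v) : Phase d) φ (q, p, z) := by
  have h1 : HasFDerivAt (fun z : Vec d => ((q, p, z) : Phase d))
      ((0 : Vec d →L[ℝ] Vec d).prod ((0 : Vec d →L[ℝ] Vec d).prod (ContinuousLinearMap.id ℝ _))) z :=
    (hasFDerivAt_const q z).prodMk ((hasFDerivAt_const p z).prodMk (hasFDerivAt_id z))
  have h2 := (hφ (q, p, z)).hasFDerivAt.comp z h1
  have h3 : fderiv ℝ (fun z : Vec d => φ (q, p, z)) z = _ := h2.fderiv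
  rw [h3]
  rfl

/-- Expanding the Laplacian in the standard orthonormal basis of the `z`-space brings the equation
under the abstract theory, with noise directions `zDir`. -/
lemma generator_eq_fpOp (α β lam : ℝ) (A B : Vec d → Vec d) (μ : ProbabilityMeasure (Phase d))
    {φ : Phase d → ℝ} (hφ : ContDiff ℝ (⊤ : ℕ∞) φ) (x : Phase d) :
    generator α β lam A B μ φ x = fpOp zDir (drift α β lam A B μ) φ x := by
  obtain ⟨q, p, z⟩ := x
  simp only [generator, fpOp, dirLaplacian]
  congr 1
  rw [InnerProductSpace.laplacian_eq_iteratedFDeriv_orthonormalBasis _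
    (EuclideanSpace.basisFun (Fin d) ℝ)]
  refine Finset.sum_congr rfl fun i _ => ?_
  rw [iteratedFDeriv_two_apply]
  simp only [Matrix.cons_val_zero, Matrix.cons_val_one, EuclideanSpace.basisFun_apply]
  have hd : Differentiable ℝ φ := hφ.differentiable (by simp)
  have hs : ContDiff ℝ (⊤ : ℕ∞) (fun z : Vec d => φ (q, p, z)) := by fun_prop
  have hfd : DifferentiableAt ℝ (fderiv ℝ (fun z : Vec d => φ (q, p, z))) z :=
    (hs.fderiv_right (m := (⊤ : ℕ∞)) (by simp)).differentiable (by simp) z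
  have h1 : fderiv ℝ (fun z' => fderiv ℝ (fun z : Vec d => φ (q, p, z)) z'
      (EuclideanSpace.single i 1)) z (EuclideanSpace.single i 1) =
      fderiv ℝ (fderiv ℝ (fun z : Vec d => φ (q, p, z))) z (EuclideanSpace.single i 1)
        (EuclideanSpace.single i 1) := by
    rw [fderiv_clm_apply hfd (differentiableAt_const _)]
    simp
  rw [← h1]
  have h2 : (fun z' => fderiv ℝ (fun z : Vec d => φ (q, p, z)) z' (EuclideanSpace.single i 1)) =
      fun z' => dirDeriv (zDir i) φ (q, p, z') := by
    ext z'
    exact dirDeriv_zSlice hd q p z' _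
  rw [h2, dirDeriv_zSlice ((contDiff_dirDeriv hφ _).differentiable (by simp))]
  rfl

lemma sqNorm_nonneg (x : Phase d) : 0 ≤ sqNorm x := by
  unfold sqNorm
  positivity

lemma continuous_sqNorm : Continuous (sqNorm : Phase d → ℝ) := by
  unfold sqNorm
  fun_prop

/-- The product norm is the maximum of the three block norms. Lipschitz and growth conditions are
stated in it, whereas moments and costs use the Euclidean `sqNorm`. -/
lemma norm_sq_le_sqNorm (x : Phase d) : ‖x‖ ^ 2 ≤ sqNorm x := by
  obtain ⟨q, p, z⟩ := x
  simp only [Prod.norm_mk, sqNorm]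
  rcases max_choice ‖q‖ (max ‖p‖ ‖z‖) with h | h <;> rw [h]
  · nlinarith [sq_nonneg ‖p‖, sq_nonneg ‖z‖]
  · rcases max_choice ‖p‖ ‖z‖ with h | h <;> rw [h]
    · nlinarith [sq_nonneg ‖q‖, sq_nonneg ‖z‖]
    · nlinarith [sq_nonneg ‖p‖, sq_nonneg ‖q‖]

lemma norm_mid_le (x : Phase d) : ‖x.2.1‖ ≤ ‖x‖ := (norm_fst_le x.2).trans (norm_snd_le x)
lemma norm_last_le (x : Phase d) : ‖x.2.2‖ ≤ ‖x‖ := (norm_snd_le x.2).trans (norm_snd_le x)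

/-- The Euclidean inner product of the phase space. -/
noncomputable def phaseInner (x y : Phase d) : ℝ :=
  inner ℝ x.1 y.1 + inner ℝ x.2.1 y.2.1 + inner ℝ x.2.2 y.2.2

lemma sqNorm_add_smul (x v : Phase d) (r : ℝ) :
    sqNorm (x + r • v) = sqNorm x + 2 * r * phaseInner x v + r ^ 2 * sqNorm v := by
  simp only [sqNorm, phaseInner, Prod.fst_add, Prod.snd_add, Prod.smul_fst, Prod.smul_snd,
    norm_add_sq_real, norm_smul, inner_smul_right, mul_pow, Real.norm_eq_abs, sq_abs]
  ring

lemma phaseInner_add_smul (x v : Phase d) (r : ℝ) :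
    phaseInner (x + r • v) v = phaseInner x v + r * sqNorm v := by
  simp only [sqNorm, phaseInner, Prod.fst_add, Prod.snd_add, Prod.smul_fst, Prod.smul_snd,
    inner_add_left, inner_smul_left, real_inner_self_eq_norm_sq]
  simp
  ring

lemma abs_phaseInner_le (x v : Phase d) : |phaseInner x v| ≤ 3 * (‖x‖ * ‖v‖) := by
  have h1 := (abs_real_inner_le_norm x.1 v.1).trans
    (mul_le_mul (norm_fst_le x) (norm_fst_le v) (norm_nonneg _) (norm_nonneg _))
  have h2 := (abs_real_inner_le_norm x.2.1 v.2.1).trans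
    (mul_le_mul (norm_mid_le x) (norm_mid_le v) (norm_nonneg _) (norm_nonneg _))
  have h3 := (abs_real_inner_le_norm x.2.2 v.2.2).trans
    (mul_le_mul (norm_last_le x) (norm_last_le v) (norm_nonneg _) (norm_nonneg _))
  have := abs_add_three (inner ℝ x.1 v.1) (inner ℝ x.2.1 v.2.1) (inner ℝ x.2.2 v.2.2)
  unfold phaseInner
  linarith

lemma contDiff_sqNorm : ContDiff ℝ (⊤ : ℕ∞) (sqNorm : Phase d → ℝ) := by
  unfold sqNorm
  exact ((contDiff_fst.norm_sq ℝ).add (contDiff_snd.fst.norm_sq ℝ)).add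
    (contDiff_snd.snd.norm_sq ℝ)

lemma dirDeriv_eq_of_hasDerivAt {E : Type*} [NormedAddCommGroup E] [NormedSpace ℝ E] {φ : E → ℝ}
    (hφ : Differentiable ℝ φ) {x v : E} {D : ℝ}
    (h : HasDerivAt (fun r : ℝ => φ (x + r • v)) D 0) : dirDeriv v φ x = D := by
  have := (hasDerivAt_line hφ x v 0).unique h
  simpa using this

/-- The bounded approximation `|x|² / (1 + ε |x|²)` of the squared norm. -/
noncomputable def truncSq (ε : ℝ) (x : Phase d) : ℝ := sqNorm x * (1 + ε * sqNorm x)⁻¹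

lemma one_add_mul_sqNorm_pos {ε : ℝ} (hε : 0 ≤ ε) (x : Phase d) : 0 < 1 + ε * sqNorm x := by
  have := sqNorm_nonneg x
  positivity

lemma contDiff_truncSq {ε : ℝ} (hε : 0 ≤ ε) :
    ContDiff ℝ (⊤ : ℕ∞) (truncSq ε : Phase d → ℝ) := by
  refine contDiff_sqNorm.mul (ContDiff.inv ?_ fun x => (one_add_mul_sqNorm_pos hε x).ne')
  exact contDiff_const.add (contDiff_const.mul contDiff_sqNorm)

lemma hasDerivAt_sqNorm_line (x v : Phase d) :
    HasDerivAt (fun r : ℝ => sqNorm (x + r • v)) (2 * phaseInner x v) 0 := by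
  simp only [sqNorm_add_smul]
  have h1 : HasDerivAt (fun r : ℝ => 2 * r * phaseInner x v) (2 * phaseInner x v) 0 := by
    simpa using ((hasDerivAt_id (0 : ℝ)).const_mul 2).mul_const (phaseInner x v)
  have h2 : HasDerivAt (fun r : ℝ => r ^ 2 * sqNorm v) 0 0 := by
    simpa using ((hasDerivAt_id (0 : ℝ)).pow 2).mul_const (sqNorm v)
  exact ((h1.const_add (sqNorm x)).add h2).congr_deriv (add_zero _)

lemma hasDerivAt_inv_line {ε : ℝ} (hε : 0 ≤ ε) (x v : Phase d) :
    HasDerivAt (fun r : ℝ => (1 + ε * sqNorm (x + r • v))⁻¹)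
      (-(2 * ε * phaseInner x v) * ((1 + ε * sqNorm x)⁻¹) ^ 2) 0 := by
  have h := ((hasDerivAt_sqNorm_line x v).const_mul ε).const_add 1
  have h2 := h.inv (by simpa using (one_add_mul_sqNorm_pos hε x).ne')
  refine h2.congr_deriv ?_
  simp only [zero_smul, add_zero, div_eq_mul_inv, inv_pow]
  ring

lemma dirDeriv_truncSq {ε : ℝ} (hε : 0 ≤ ε) (v : Phase d) :
    dirDeriv v (truncSq ε) = fun x => 2 * phaseInner x v * ((1 + ε * sqNorm x)⁻¹) ^ 2 := by
  ext x
  refine dirDeriv_eq_of_hasDerivAt ((contDiff_truncSq hε).differentiable (by simp)) ?_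
  refine ((hasDerivAt_sqNorm_line x v).mul (hasDerivAt_inv_line hε x v)).congr_deriv ?_
  have := (one_add_mul_sqNorm_pos hε x).ne'
  simp only [zero_smul, add_zero]
  field_simp
  ring

lemma dirDeriv_dirDeriv_truncSq {ε : ℝ} (hε : 0 ≤ ε) (v x : Phase d) :
    dirDeriv v (dirDeriv v (truncSq ε)) x = 2 * sqNorm v * ((1 + ε * sqNorm x)⁻¹) ^ 2
      - 8 * ε * phaseInner x v ^ 2 * ((1 + ε * sqNorm x)⁻¹) ^ 3 := by
  refine dirDeriv_eq_of_hasDerivAt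
    ((contDiff_dirDeriv (contDiff_truncSq hε) v).differentiable (by simp)) ?_
  rw [dirDeriv_truncSq hε]
  have h1 : HasDerivAt (fun r : ℝ => 2 * phaseInner (x + r • v) v) (2 * sqNorm v) 0 := by
    simp only [phaseInner_add_smul]
    simpa using (((hasDerivAt_id (0 : ℝ)).mul_const (sqNorm v)).const_add
      (phaseInner x v)).const_mul 2
  refine (h1.mul ((hasDerivAt_inv_line hε x v).pow 2)).congr_deriv ?_
  simp only [Pi.pow_apply, zero_smul, add_zero]
  generalize (1 + ε * sqNorm x)⁻¹ = w
  push_cast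
  ring

lemma truncSq_nonneg {ε : ℝ} (hε : 0 ≤ ε) (x : Phase d) : 0 ≤ truncSq ε x :=
  mul_nonneg (sqNorm_nonneg x) (inv_nonneg.2 (one_add_mul_sqNorm_pos hε x).le)

lemma inv_one_add_le_one {ε : ℝ} (hε : 0 ≤ ε) (x : Phase d) : (1 + ε * sqNorm x)⁻¹ ≤ 1 := by
  refine inv_le_one_of_one_le₀ ?_
  have := mul_nonneg hε (sqNorm_nonneg x)
  linarith

lemma truncSq_le_sqNorm {ε : ℝ} (hε : 0 ≤ ε) (x : Phase d) : truncSq ε x ≤ sqNorm x :=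
  mul_le_of_le_one_right (sqNorm_nonneg x) (inv_one_add_le_one hε x)

lemma mul_truncSq_le_one {ε : ℝ} (hε : 0 ≤ ε) (x : Phase d) : ε * truncSq ε x ≤ 1 := by
  have h := one_add_mul_sqNorm_pos hε x
  rw [truncSq, ← mul_assoc, ← div_eq_mul_inv, div_le_one h]
  linarith

/-- The constant is independent of `ε`. This is the hypothesis `h1` of
`IsFPSolution.integral_le_exp`, so the resulting Gronwall bound survives the limit in which the
truncation is removed. -/
lemma abs_dirDeriv_truncSq_mul_le {ε : ℝ} (hε : 0 ≤ ε) (v x : Phase d) :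
    |dirDeriv v (truncSq ε) x| * (1 + ‖x‖) ≤ 12 * (1 + truncSq ε x) * ‖v‖ := by
  rw [dirDeriv_truncSq hε]
  have h0 := inv_pos.2 (one_add_mul_sqNorm_pos hε x)
  have h1 := inv_one_add_le_one hε x
  have hφ : truncSq ε x = sqNorm x * (1 + ε * sqNorm x)⁻¹ := rfl
  set w := (1 + ε * sqNorm x)⁻¹ with hw
  have h2 := abs_phaseInner_le x v
  have h3 := norm_sq_le_sqNorm x
  have hx := norm_nonneg x
  have hv := norm_nonneg v
  rw [abs_mul, abs_mul, abs_two, abs_of_pos (by positivity : 0 < w ^ 2)]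
  have h4 : w ^ 2 ≤ w := by nlinarith
  have h5 : ‖x‖ * (1 + ‖x‖) ≤ 2 * (1 + sqNorm x) := by nlinarith [sq_nonneg (‖x‖ - 1)]
  have h6 : 0 ≤ sqNorm x := sqNorm_nonneg x
  calc 2 * |phaseInner x v| * w ^ 2 * (1 + ‖x‖)
      ≤ 2 * (3 * (‖x‖ * ‖v‖)) * w * (1 + ‖x‖) := by gcongr
    _ = 6 * ‖v‖ * w * (‖x‖ * (1 + ‖x‖)) := by ring
    _ ≤ 6 * ‖v‖ * w * (2 * (1 + sqNorm x)) := by gcongr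
    _ = 12 * ‖v‖ * (w + sqNorm x * w) := by ring
    _ ≤ 12 * ‖v‖ * (1 + sqNorm x * w) := by gcongr
    _ = 12 * (1 + truncSq ε x) * ‖v‖ := by rw [hφ]; ring

lemma sqNorm_zDir (i : Fin d) : sqNorm (zDir i : Phase d) = 1 := by
  simp [sqNorm, zDir]

lemma phaseInner_zDir_sq_le (x : Phase d) (i : Fin d) : phaseInner x (zDir i) ^ 2 ≤ sqNorm x := by
  have h1 : phaseInner x (zDir i) = inner ℝ x.2.2 (EuclideanSpace.single i (1 : ℝ)) := by
    simp [phaseInner, zDir]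
  have h2 := abs_real_inner_le_norm x.2.2 (EuclideanSpace.single i (1 : ℝ))
  rw [PiLp.norm_single, norm_one, mul_one, ← h1] at h2
  have h3 := pow_le_pow_left₀ (abs_nonneg _) h2 2
  rw [sq_abs] at h3
  refine h3.trans ?_
  unfold sqNorm
  nlinarith [sq_nonneg ‖x.1‖, sq_nonneg ‖x.2.1‖]

/-- Each of the `d` second derivatives is at most `10`, uniformly in `ε`. The summand `12` lets a
single constant cover this bound and the gradient bound. -/
lemma abs_dirLaplacian_truncSq_le {ε : ℝ} (hε : 0 ≤ ε) (x : Phase d) :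
    |dirLaplacian zDir (truncSq ε) x| ≤ 12 + 10 * d := by
  have h0 := inv_pos.2 (one_add_mul_sqNorm_pos hε x)
  have h1 := inv_one_add_le_one hε x
  have hb := mul_truncSq_le_one hε x
  have hφ : truncSq ε x = sqNorm x * (1 + ε * sqNorm x)⁻¹ := rfl
  have key : ∀ i : Fin d, |dirDeriv (zDir i) (dirDeriv (zDir i) (truncSq ε)) x| ≤ 10 := by
    intro i
    rw [dirDeriv_dirDeriv_truncSq hε, sqNorm_zDir]
    have h2 := phaseInner_zDir_sq_le x i
    have h6 := sqNorm_nonneg x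
    set w := (1 + ε * sqNorm x)⁻¹ with hw
    have h4 : w ^ 2 ≤ 1 := pow_le_one₀ h0.le h1
    have h5 : 8 * ε * phaseInner x (zDir i) ^ 2 * w ^ 3 ≤ 8 := by
      calc 8 * ε * phaseInner x (zDir i) ^ 2 * w ^ 3 ≤ 8 * ε * sqNorm x * w ^ 3 := by gcongr
        _ = 8 * (ε * truncSq ε x) * w ^ 2 := by rw [hφ]; ring
        _ ≤ 8 * 1 * 1 := by
          gcongr
        _ = 8 := by norm_num
    have h7 : 0 ≤ 8 * ε * phaseInner x (zDir i) ^ 2 * w ^ 3 := by positivity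
    have h8 : 0 ≤ w ^ 2 := by positivity
    rw [abs_le]
    constructor <;> linarith
  refine (Finset.abs_sum_le_sum_abs _ _).trans ((Finset.sum_le_sum fun i _ => key i).trans ?_)
  simp
  linarith

lemma exists_hasBoundedDerivs_truncSq {ε : ℝ} (hε : 0 < ε) :
    ∃ D, HasBoundedDerivs zDir (truncSq ε : Phase d → ℝ) D := by
  refine ⟨12 * (1 + ε⁻¹) + (12 + 10 * d), contDiff_truncSq hε.le, fun v x => ?_, fun x => ?_⟩
  · have h1 := abs_dirDeriv_truncSq_mul_le hε.le v x
    have h2 : truncSq ε x ≤ ε⁻¹ := by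
      rw [← one_div, le_div_iff₀' hε]
      exact mul_truncSq_le_one hε.le x
    have h3 := abs_nonneg (dirDeriv v (truncSq ε) x)
    have h4 := mul_nonneg h3 (norm_nonneg x)
    have h5 := mul_le_mul_of_nonneg_right h2 (norm_nonneg v)
    have h6 := norm_nonneg v
    have h7 : (0 : ℝ) ≤ (12 + 10 * d) * ‖v‖ := by positivity
    linarith
  · refine (abs_dirLaplacian_truncSq_le hε.le x).trans ?_
    have : 0 < ε⁻¹ := inv_pos.2 hε
    linarith

lemma FiniteSecondMoment.integrable {μ : ProbabilityMeasure (Phase d)}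
    (h : FiniteSecondMoment μ) : Integrable sqNorm (μ : Measure (Phase d)) := by
  refine ⟨continuous_sqNorm.aestronglyMeasurable, ?_⟩
  rw [hasFiniteIntegral_iff_ofReal (ae_of_all _ sqNorm_nonneg)]
  exact h

lemma Integrable.norm_of_sqNorm {μ : Measure (Phase d)} [IsFiniteMeasure μ]
    (h : Integrable sqNorm μ) : Integrable (fun x => ‖x‖) μ := by
  refine ((integrable_const (1 : ℝ)).add h).mono' (by fun_prop) (ae_of_all _ fun x => ?_)
  rw [norm_norm, Pi.add_apply]
  have := norm_sq_le_sqNorm x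
  nlinarith [sq_nonneg (‖x‖ - 1)]

lemma one_add_norm_sq_le (x : Phase d) : (1 + ‖x‖) ^ 2 ≤ 2 * (1 + sqNorm x) := by
  have := norm_sq_le_sqNorm x
  nlinarith [sq_nonneg (‖x‖ - 1)]

lemma Integrable.one_add_norm_sq {μ : Measure (Phase d)} [IsFiniteMeasure μ]
    (h : Integrable sqNorm μ) : Integrable (fun x => (1 + ‖x‖) ^ 2) μ := by
  refine (((integrable_const (1 : ℝ)).add h).const_mul 2).mono' (by fun_prop)
    (ae_of_all _ fun x => ?_)
  rw [Real.norm_of_nonneg (sq_nonneg _)]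
  exact one_add_norm_sq_le x

/-- Second moments of a solution are bounded on bounded time intervals. -/
lemma IsFPSolution.exists_secondMoment_le {b : ℝ → Phase d → Phase d}
    {ρ : ℝ → ProbabilityMeasure (Phase d)} (h : IsFPSolution zDir b ρ)
    (h2 : ∀ t, 0 ≤ t → FiniteSecondMoment (ρ t)) {T : ℝ} (hT : 0 ≤ T) :
    ∃ R, 0 ≤ R ∧ ∀ t ∈ Icc 0 T, ∫ x, sqNorm x ∂(ρ t : Measure (Phase d)) ≤ R := by
  obtain ⟨K, hK, hb⟩ := h.exists_bound hT
  have hA : (0 : ℝ) < 12 + 10 * d := by positivity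
  set R := 2 * (1 + ∫ x, sqNorm x ∂(ρ 0 : Measure (Phase d))) *
    Real.exp (2 * ((12 + 10 * d) * (K + 1)) * T) with hR
  have hR0 : 0 ≤ R := by
    have : 0 ≤ ∫ x, sqNorm x ∂(ρ 0 : Measure (Phase d)) := integral_nonneg sqNorm_nonneg
    positivity
  refine ⟨R, hR0, fun t ht => ?_⟩
  have hi := (h2 t ht.1).integrable
  have hi0 := (h2 0 le_rfl).integrable
  have bound : ∀ n : ℕ, ∫ x, truncSq (1 / ((n : ℝ) + 1)) x ∂(ρ t : Measure (Phase d)) ≤ R := by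
    intro n
    have hε : (0 : ℝ) < 1 / ((n : ℝ) + 1) := by positivity
    obtain ⟨D, hD⟩ := exists_hasBoundedDerivs_truncSq (d := d) hε
    refine (h.integral_le_exp hT hK (fun t ht => (hb t ht).2) hD hA (truncSq_nonneg hε.le)
      (R := (1 / ((n : ℝ) + 1))⁻¹) (fun x => ?_) (fun v x => ?_)
      (abs_dirLaplacian_truncSq_le hε.le) ht).trans ?_
    · rw [← one_div, le_div_iff₀' hε]
      exact mul_truncSq_le_one hε.le x
    · refine (abs_dirDeriv_truncSq_mul_le hε.le v x).trans ?_
      have := truncSq_nonneg hε.le x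
      gcongr
      have : (0 : ℝ) ≤ d := Nat.cast_nonneg _
      linarith
    · rw [hR]
      gcongr
      · exact hi0.mono' (contDiff_truncSq hε.le).continuous.aestronglyMeasurable
          (ae_of_all _ fun x => by
            rw [Real.norm_of_nonneg (truncSq_nonneg hε.le x)]
            exact truncSq_le_sqNorm hε.le x)
      · exact fun x => truncSq_le_sqNorm hε.le x
  -- Finiteness of the second moment at each time is known and provides the majorant; what the limit
  -- adds is a bound uniform in time.
  have lim : Tendsto (fun n : ℕ => ∫ x, truncSq (1 / ((n : ℝ) + 1)) x ∂(ρ t : Measure (Phase d)))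
      atTop (𝓝 (∫ x, sqNorm x ∂(ρ t : Measure (Phase d)))) := by
    refine tendsto_integral_of_dominated_convergence sqNorm
      (fun n => (contDiff_truncSq (by positivity)).continuous.aestronglyMeasurable) hi
      (fun n => ae_of_all _ fun x => ?_) (ae_of_all _ fun x => ?_)
    · have hε : (0 : ℝ) ≤ 1 / ((n : ℝ) + 1) := by positivity
      rw [Real.norm_of_nonneg (truncSq_nonneg hε x)]
      exact truncSq_le_sqNorm hε x
    · have h1 : ContinuousAt (fun ε : ℝ => truncSq ε x) 0 := by
        unfold truncSq
        exact continuousAt_const.mul (ContinuousAt.inv₀ (by fun_prop) (by simp))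
      have h2 := h1.tendsto.comp (tendsto_one_div_add_atTop_nhds_zero_nat (𝕜 := ℝ))
      simpa [truncSq, Function.comp_def] using h2
  exact le_of_tendsto' lim bound

end PhaseSpace

/-! ### Growth and regularity of the drift and of the mean field. -/

section Drift

open Filter Topology

variable {d : ℕ} {α β lam C_A C_B : ℝ} {A B : Vec d → Vec d}

lemma continuous_of_norm_sub_le {F : Vec d → Vec d} {c : ℝ}
    (hF : ∀ q₁ q₂, ‖F q₁ - F q₂‖ ≤ c * ‖q₁ - q₂‖) : Continuous F :=
  (LipschitzWith.of_dist_le_mul (K := c.toNNReal) fun x y => by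
    rw [dist_eq_norm, dist_eq_norm]
    exact (hF x y).trans (mul_le_mul_of_nonneg_right (Real.le_coe_toNNReal c)
      (norm_nonneg _))).continuous

lemma norm_kernel_le (hCB : 0 ≤ C_B) (hB : ∀ q₁ q₂, ‖B q₁ - B q₂‖ ≤ C_B * ‖q₁ - q₂‖)
    (q : Vec d) (y : Phase d) : ‖B (q - y.1)‖ ≤ ‖B 0‖ + C_B * (‖q‖ + ‖y‖) := by
  have h1 := hB (q - y.1) 0
  rw [sub_zero] at h1
  have h2 : ‖q - y.1‖ ≤ ‖q‖ + ‖y‖ := (norm_sub_le _ _).trans (by linarith [norm_fst_le y])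
  have h3 := norm_sub_norm_le (B (q - y.1)) (B 0)
  have h4 := mul_le_mul_of_nonneg_left h2 hCB
  linarith

lemma integrable_kernel (hCB : 0 ≤ C_B) (hB : ∀ q₁ q₂, ‖B q₁ - B q₂‖ ≤ C_B * ‖q₁ - q₂‖)
    {μ : Measure (Phase d)} [IsFiniteMeasure μ] (hμ : Integrable (fun x => ‖x‖) μ) (q : Vec d) :
    Integrable (fun y : Phase d => B (q - y.1)) μ := by
  have hc := continuous_of_norm_sub_le hB
  refine ((integrable_const (‖B 0‖ + C_B * ‖q‖)).add (hμ.const_mul C_B)).mono'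
    (Continuous.aestronglyMeasurable (by fun_prop)) (ae_of_all _ fun y => ?_)
  refine (norm_kernel_le hCB hB q y).trans (le_of_eq ?_)
  simp only [Pi.add_apply]
  ring

lemma norm_meanField_sub_le (hCB : 0 ≤ C_B) (hB : ∀ q₁ q₂, ‖B q₁ - B q₂‖ ≤ C_B * ‖q₁ - q₂‖)
    {μ : ProbabilityMeasure (Phase d)} (hμ : Integrable (fun x => ‖x‖) (μ : Measure (Phase d)))
    (q q' : Vec d) : ‖meanField B μ q - meanField B μ q'‖ ≤ C_B * ‖q - q'‖ := by
  rw [meanField, meanField, ← integral_sub (integrable_kernel hCB hB hμ q)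
    (integrable_kernel hCB hB hμ q')]
  refine (norm_integral_le_of_norm_le_const (C := C_B * ‖q - q'‖) (ae_of_all _ fun y => ?_)).trans
    (le_of_eq (by simp))
  refine (hB _ _).trans (le_of_eq ?_)
  rw [sub_sub_sub_cancel_right]

lemma norm_meanField_le (hCB : 0 ≤ C_B) (hB : ∀ q₁ q₂, ‖B q₁ - B q₂‖ ≤ C_B * ‖q₁ - q₂‖)
    {μ : ProbabilityMeasure (Phase d)} (hμ : Integrable (fun x => ‖x‖) (μ : Measure (Phase d)))
    (q : Vec d) :
    ‖meanField B μ q‖ ≤ ‖B 0‖ + C_B * (‖q‖ + ∫ y, ‖y‖ ∂(μ : Measure (Phase d))) := by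
  rw [meanField]
  refine (norm_integral_le_of_norm_le ((integrable_const (‖B 0‖ + C_B * ‖q‖)).add
    (hμ.const_mul C_B)) (ae_of_all _ fun y => ?_)).trans (le_of_eq ?_)
  · refine (norm_kernel_le hCB hB q y).trans (le_of_eq ?_)
    simp only [Pi.add_apply]
    ring
  · rw [integral_add' (integrable_const _) (hμ.const_mul C_B), integral_const,
      integral_const_mul, probReal_univ, one_smul]
    ring

lemma norm_drift_sub_le (hα : 0 ≤ α) (hβ : 0 ≤ β) (hlam : 0 ≤ lam) (hCA : 0 ≤ C_A) (hCB : 0 ≤ C_B)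
    (hA : ∀ q₁ q₂, ‖A q₁ - A q₂‖ ≤ C_A * ‖q₁ - q₂‖)
    (hB : ∀ q₁ q₂, ‖B q₁ - B q₂‖ ≤ C_B * ‖q₁ - q₂‖)
    {μ : ProbabilityMeasure (Phase d)} (hμ : Integrable (fun x => ‖x‖) (μ : Measure (Phase d)))
    (x y : Phase d) : ‖drift α β lam A B μ x - drift α β lam A B μ y‖ ≤
      (1 + α + β + 2 * lam + C_A + C_B) * ‖x - y‖ := by
  have h1 : ‖x.1 - y.1‖ ≤ ‖x - y‖ := norm_fst_le (x - y)
  have h2 : ‖x.2.1 - y.2.1‖ ≤ ‖x - y‖ := norm_mid_le (x - y)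
  have h3 : ‖x.2.2 - y.2.2‖ ≤ ‖x - y‖ := norm_last_le (x - y)
  have hn := norm_nonneg (x - y)
  have hαn := mul_nonneg hα hn
  have hβn := mul_nonneg hβ hn
  have hln := mul_nonneg hlam hn
  have hAn := mul_nonneg hCA hn
  have hBn := mul_nonneg hCB hn
  refine norm_prod_le_iff.2 ⟨?_, norm_prod_le_iff.2 ⟨?_, ?_⟩⟩
  · change ‖x.2.1 - y.2.1‖ ≤ _
    linarith
  · have e1 : (drift α β lam A B μ x - drift α β lam A B μ y).2.1 =
        -(β • (x.1 - y.1) + (A x.1 - A y.1) + (meanField B μ x.1 - meanField B μ y.1)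
          - lam • (x.2.2 - y.2.2)) := by
      simp only [drift, Prod.snd_sub, Prod.fst_sub, smul_sub]
      abel
    rw [e1, norm_neg]
    have b1 : ‖β • (x.1 - y.1)‖ ≤ β * ‖x - y‖ := by
      rw [norm_smul, Real.norm_of_nonneg hβ]
      exact mul_le_mul_of_nonneg_left h1 hβ
    have b2 : ‖lam • (x.2.2 - y.2.2)‖ ≤ lam * ‖x - y‖ := by
      rw [norm_smul, Real.norm_of_nonneg hlam]
      exact mul_le_mul_of_nonneg_left h3 hlam
    have b3 := (hA x.1 y.1).trans (mul_le_mul_of_nonneg_left h1 hCA)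
    have b4 := (norm_meanField_sub_le hCB hB hμ x.1 y.1).trans (mul_le_mul_of_nonneg_left h1 hCB)
    have c1 := norm_sub_le (β • (x.1 - y.1) + (A x.1 - A y.1)
      + (meanField B μ x.1 - meanField B μ y.1)) (lam • (x.2.2 - y.2.2))
    have c2 := norm_add₃_le (a := β • (x.1 - y.1)) (b := A x.1 - A y.1)
      (c := meanField B μ x.1 - meanField B μ y.1)
    linarith
  · have e1 : (drift α β lam A B μ x - drift α β lam A B μ y).2.2 =
        -(lam • (x.2.1 - y.2.1) + α • (x.2.2 - y.2.2)) := by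
      simp only [drift, Prod.snd_sub, smul_sub]
      abel
    rw [e1, norm_neg]
    refine (norm_add_le _ _).trans ?_
    rw [norm_smul, norm_smul, Real.norm_of_nonneg hlam, Real.norm_of_nonneg hα]
    have b1 := mul_le_mul_of_nonneg_left h2 hlam
    have b2 := mul_le_mul_of_nonneg_left h3 hα
    linarith

lemma norm_drift_le (hα : 0 ≤ α) (hβ : 0 ≤ β) (hlam : 0 ≤ lam) (hCA : 0 ≤ C_A) (hCB : 0 ≤ C_B)
    (hA : ∀ q₁ q₂, ‖A q₁ - A q₂‖ ≤ C_A * ‖q₁ - q₂‖)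
    (hB : ∀ q₁ q₂, ‖B q₁ - B q₂‖ ≤ C_B * ‖q₁ - q₂‖)
    {μ : ProbabilityMeasure (Phase d)} (hμ : Integrable (fun x => ‖x‖) (μ : Measure (Phase d)))
    (x : Phase d) : ‖drift α β lam A B μ x‖ ≤
      (1 + α + β + 2 * lam + C_A + C_B + ‖A 0‖ + ‖B 0‖) *
        (1 + ‖x‖ + ∫ y, ‖y‖ ∂(μ : Measure (Phase d))) := by
  have h1 := norm_drift_sub_le hα hβ hlam hCA hCB hA hB hμ x 0
  rw [sub_zero] at h1
  set m := ∫ y, ‖y‖ ∂(μ : Measure (Phase d)) with hm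
  have hm0 : 0 ≤ m := integral_nonneg fun _ => norm_nonneg _
  have h2 : ‖drift α β lam A B μ 0‖ ≤ ‖A 0‖ + (‖B 0‖ + C_B * m) := by
    have h3 := norm_meanField_le hCB hB hμ 0
    rw [norm_zero, zero_add] at h3
    have : drift α β lam A B μ 0 = (0, -(A 0 + meanField B μ 0), 0) := by simp [drift]
    rw [this]
    refine norm_prod_le_iff.2 ⟨?_, norm_prod_le_iff.2 ⟨?_, ?_⟩⟩
    · simp only [norm_zero]; positivity
    · simp only [norm_neg]
      exact (norm_add_le _ _).trans (by linarith)
    · simp only [norm_zero]; positivity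
  have h4 := (norm_sub_norm_le (drift α β lam A B μ x) (drift α β lam A B μ 0)).trans h1
  have h5 := (sub_le_iff_le_add.1 h4).trans (add_le_add_right h2 _)
  refine h5.trans ?_
  have hx := norm_nonneg x
  have ha0 := norm_nonneg (A 0)
  have hb0 := norm_nonneg (B 0)
  clear_value m
  clear h1 h2 h4 h5 hA hB hμ hm
  generalize ‖A 0‖ = a at *
  generalize ‖B 0‖ = b at *
  generalize ‖x‖ = r at *
  have h6 : C_B * m ≤ (1 + α + β + 2 * lam + C_A + C_B) * m :=
    mul_le_mul_of_nonneg_right (by linarith) hm0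
  have h7 : 0 ≤ (a + b) * (r + m) := by positivity
  linarith

lemma continuous_drift (hα : 0 ≤ α) (hβ : 0 ≤ β) (hlam : 0 ≤ lam) (hCA : 0 ≤ C_A) (hCB : 0 ≤ C_B)
    (hA : ∀ q₁ q₂, ‖A q₁ - A q₂‖ ≤ C_A * ‖q₁ - q₂‖)
    (hB : ∀ q₁ q₂, ‖B q₁ - B q₂‖ ≤ C_B * ‖q₁ - q₂‖)
    {μ : ProbabilityMeasure (Phase d)} (hμ : Integrable (fun x => ‖x‖) (μ : Measure (Phase d))) :
    Continuous (drift α β lam A B μ) :=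
  (LipschitzWith.of_dist_le_mul (K := (1 + α + β + 2 * lam + C_A + C_B).toNNReal) fun x y => by
    rw [dist_eq_norm, dist_eq_norm]
    exact (norm_drift_sub_le hα hβ hlam hCA hCB hA hB hμ x y).trans
      (mul_le_mul_of_nonneg_right (Real.le_coe_toNNReal _) (norm_nonneg _))).continuous

lemma drift_sub_drift (μ ν : ProbabilityMeasure (Phase d)) (x : Phase d) :
    drift α β lam A B μ x - drift α β lam A B ν x =
      (0, -(meanField B μ x.1 - meanField B ν x.1), 0) := by
  simp only [drift, Prod.mk_sub_mk, sub_self]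
  congr 2
  abel

lemma norm_drift_sub_drift (μ ν : ProbabilityMeasure (Phase d)) (x : Phase d) :
    ‖drift α β lam A B μ x - drift α β lam A B ν x‖ =
      ‖meanField B μ x.1 - meanField B ν x.1‖ := by
  rw [drift_sub_drift]
  simp [Prod.norm_mk, norm_sub_rev]

lemma IsSolution.integrable_norm {ρ : ℝ → ProbabilityMeasure (Phase d)}
    (h : IsSolution α β lam A B ρ) {t : ℝ} (ht : 0 ≤ t) :
    Integrable (fun x => ‖x‖) (ρ t : Measure (Phase d)) :=
  Integrable.norm_of_sqNorm (h.secondMoment t ht).integrable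

lemma IsSolution.isFPSolution (hα : 0 ≤ α) (hβ : 0 ≤ β) (hlam : 0 ≤ lam) (hCA : 0 ≤ C_A)
    (hCB : 0 ≤ C_B) (hA : ∀ q₁ q₂, ‖A q₁ - A q₂‖ ≤ C_A * ‖q₁ - q₂‖)
    (hB : ∀ q₁ q₂, ‖B q₁ - B q₂‖ ≤ C_B * ‖q₁ - q₂‖) {ρ : ℝ → ProbabilityMeasure (Phase d)}
    (h : IsSolution α β lam A B ρ) :
    IsFPSolution zDir (fun t => drift α β lam A B (ρ t)) ρ where
  continuousOn := h.narrowlyContinuous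
  integrable_norm t ht := h.integrable_norm ht
  lintegral_norm := h.integrable_coeff
  continuous_drift t ht := continuous_drift hα hβ hlam hCA hCB hA hB (h.integrable_norm ht)
  growth := ⟨1 + α + β + 2 * lam + C_A + C_B + ‖A 0‖ + ‖B 0‖, by positivity, fun t ht x =>
    norm_drift_le hα hβ hlam hCA hCB hA hB (h.integrable_norm ht) x⟩
  weak_integrable φ hφ hφc t ht := by
    simpa only [generator_eq_fpOp α β lam A B _ hφ] using h.weak_integrable φ hφ hφc t ht
  weak_eq φ hφ hφc t ht := by
    simpa only [generator_eq_fpOp α β lam A B _ hφ] using h.weak_eq φ hφ hφc t ht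

/-- Pairing with a fixed vector reduces the vector-valued mean field to scalar Lipschitz test
functions, for which the time modulus is available. -/
lemma inner_kernel_lipschitz (hCB : 0 ≤ C_B)
    (hB : ∀ q₁ q₂, ‖B q₁ - B q₂‖ ≤ C_B * ‖q₁ - q₂‖) (v q : Vec d) (x y : Phase d) :
    |inner ℝ v (B (q - x.1)) - inner ℝ v (B (q - y.1))| ≤ ‖v‖ * C_B * ‖x - y‖ := by
  rw [← inner_sub_right, mul_assoc]
  refine (abs_real_inner_le_norm _ _).trans (mul_le_mul_of_nonneg_left ?_ (norm_nonneg v))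
  refine (hB _ _).trans (mul_le_mul_of_nonneg_left ?_ hCB)
  rw [sub_sub_sub_cancel_left, norm_sub_rev]
  exact norm_fst_le (x - y)

/-- The drift of a solution is continuous in time, uniformly in space. -/
lemma IsSolution.exists_drift_modulus (hα : 0 ≤ α) (hβ : 0 ≤ β) (hlam : 0 ≤ lam) (hCA : 0 ≤ C_A)
    (hCB : 0 ≤ C_B) (hA : ∀ q₁ q₂, ‖A q₁ - A q₂‖ ≤ C_A * ‖q₁ - q₂‖)
    (hB : ∀ q₁ q₂, ‖B q₁ - B q₂‖ ≤ C_B * ‖q₁ - q₂‖) {ρ : ℝ → ProbabilityMeasure (Phase d)}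
    (h : IsSolution α β lam A B ρ) {T : ℝ} (hT : 0 ≤ T) {ω : ℝ} (hω : 0 < ω) :
    ∃ h₀ > 0, ∀ t ∈ Icc 0 T, ∀ s ∈ Icc 0 T, |s - t| ≤ h₀ →
      ∀ x, ‖drift α β lam A B (ρ s) x - drift α β lam A B (ρ t) x‖ ≤ ω := by
  obtain ⟨h₀, hh₀, hmod⟩ := (h.isFPSolution hα hβ hlam hCA hCB hA hB).exists_time_modulus hT
    (ε := ω / (C_B + 1)) (by positivity)
  refine ⟨h₀, hh₀, fun t ht s hs hst x => ?_⟩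
  rw [norm_drift_sub_drift]
  -- The increment is tested against itself: the modulus yields `‖v‖ ^ 2 ≤ ‖v‖ * C_B * (ω / (C_B +
  -- 1))`, and one factor `‖v‖` cancels. The modulus depends linearly on the Lipschitz constant, so
  -- it is uniform in `x`.
  set v := meanField B (ρ s) x.1 - meanField B (ρ t) x.1 with hv
  have key := hmod t ht s hs hst (‖v‖ * C_B) (fun y => inner ℝ v (B (x.1 - y.1))) (by positivity)
    (inner_kernel_lipschitz hCB hB v x.1)
  rw [integral_inner (integrable_kernel hCB hB (h.integrable_norm hs.1) x.1),
    integral_inner (integrable_kernel hCB hB (h.integrable_norm ht.1) x.1),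
    ← inner_sub_right] at key
  have e1 : (∫ y : Phase d, B (x.1 - y.1) ∂(ρ s : Measure (Phase d)))
      - ∫ y : Phase d, B (x.1 - y.1) ∂(ρ t : Measure (Phase d)) = v := rfl
  rw [e1, real_inner_self_eq_norm_sq, abs_of_nonneg (sq_nonneg _)] at key
  by_cases hv0 : ‖v‖ = 0
  · rw [hv0]; exact hω.le
  · have hvp : 0 < ‖v‖ := lt_of_le_of_ne (norm_nonneg _) (Ne.symm hv0)
    have h1 : ‖v‖ ≤ C_B * (ω / (C_B + 1)) := by
      refine le_of_mul_le_mul_left ?_ hvp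
      linarith
    refine h1.trans ?_
    rw [mul_div_assoc', div_le_iff₀ (by positivity)]
    linarith

lemma sq_integral_le {X : Type*} [MeasurableSpace X] {π : Measure X} [IsProbabilityMeasure π]
    {f : X → ℝ} (hf : Integrable f π) (hf2 : Integrable (fun x => f x ^ 2) π) :
    (∫ x, f x ∂π) ^ 2 ≤ ∫ x, f x ^ 2 ∂π := by
  set m := ∫ x, f x ∂π with hm
  have h1 : ∫ x, (2 * m * f x - m ^ 2) ∂π ≤ ∫ x, f x ^ 2 ∂π :=
    integral_mono ((hf.const_mul _).sub (integrable_const _)) hf2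
      fun x => by nlinarith [sq_nonneg (f x - m)]
  rw [integral_sub (hf.const_mul _) (integrable_const _), integral_const_mul, integral_const,
    probReal_univ, one_smul, ← hm] at h1
  linarith

/-- The mean-field force depends on the measure in a Lipschitz way. -/
lemma sq_norm_meanField_sub_meanField_le (hCB : 0 ≤ C_B)
    (hB : ∀ q₁ q₂, ‖B q₁ - B q₂‖ ≤ C_B * ‖q₁ - q₂‖) {μ ν : ProbabilityMeasure (Phase d)}
    (hμ : Integrable (fun x => ‖x‖) (μ : Measure (Phase d)))
    (hν : Integrable (fun x => ‖x‖) (ν : Measure (Phase d))) {π : Measure (Phase d × Phase d)}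
    (hπ : IsCoupling π μ ν) (hi : Integrable (fun w => sqNorm (w.1 - w.2)) π) (q : Vec d) :
    ‖meanField B μ q - meanField B ν q‖ ^ 2 ≤ C_B ^ 2 * ∫ w, sqNorm (w.1 - w.2) ∂π := by
  have hp : IsProbabilityMeasure π := by
    have : IsProbabilityMeasure (π.map Prod.fst) := by rw [hπ.1]; infer_instance
    exact Measure.isProbabilityMeasure_of_map Prod.fst
  have hc := continuous_of_norm_sub_le hB
  have cf : Continuous fun y : Phase d => B (q - y.1) := by fun_prop
  have i1 : Integrable (fun w : Phase d × Phase d => B (q - w.1.1)) π := by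
    have := integrable_kernel hCB hB hμ q
    rw [← hπ.1, integrable_map_measure cf.aestronglyMeasurable measurable_fst.aemeasurable] at this
    exact this
  have i2 : Integrable (fun w : Phase d × Phase d => B (q - w.2.1)) π := by
    have := integrable_kernel hCB hB hν q
    rw [← hπ.2, integrable_map_measure cf.aestronglyMeasurable measurable_snd.aemeasurable] at this
    exact this
  have e1 : meanField B μ q = ∫ w, B (q - w.1.1) ∂π := by
    rw [meanField, ← hπ.1, integral_map measurable_fst.aemeasurable cf.aestronglyMeasurable]
  have e2 : meanField B ν q = ∫ w, B (q - w.2.1) ∂π := by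
    rw [meanField, ← hπ.2, integral_map measurable_snd.aemeasurable cf.aestronglyMeasurable]
  have hn : Integrable (fun w : Phase d × Phase d => ‖w.1 - w.2‖) π := by
    refine ((integrable_const (1 : ℝ)).add hi).mono'
      (Continuous.aestronglyMeasurable (by fun_prop)) (ae_of_all _ fun w => ?_)
    rw [norm_norm, Pi.add_apply]
    have := norm_sq_le_sqNorm (w.1 - w.2)
    nlinarith [sq_nonneg (‖w.1 - w.2‖ - 1)]
  have hn2 : Integrable (fun w : Phase d × Phase d => ‖w.1 - w.2‖ ^ 2) π := by
    refine hi.mono' (Continuous.aestronglyMeasurable (by fun_prop)) (ae_of_all _ fun w => ?_)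
    rw [Real.norm_of_nonneg (sq_nonneg _)]
    exact norm_sq_le_sqNorm _
  have h1 : ‖meanField B μ q - meanField B ν q‖ ≤ C_B * ∫ w, ‖w.1 - w.2‖ ∂π := by
    rw [e1, e2, ← integral_sub i1 i2, ← integral_const_mul]
    refine norm_integral_le_of_norm_le (hn.const_mul C_B) (ae_of_all _ fun w => ?_)
    refine (hB _ _).trans (mul_le_mul_of_nonneg_left ?_ hCB)
    rw [sub_sub_sub_cancel_left, norm_sub_rev]
    exact norm_fst_le (w.1 - w.2)
  calc ‖meanField B μ q - meanField B ν q‖ ^ 2 ≤ (C_B * ∫ w, ‖w.1 - w.2‖ ∂π) ^ 2 :=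
        pow_le_pow_left₀ (norm_nonneg _) h1 2
    _ = C_B ^ 2 * (∫ w, ‖w.1 - w.2‖ ∂π) ^ 2 := by ring
    _ ≤ C_B ^ 2 * ∫ w, sqNorm (w.1 - w.2) ∂π := by
        refine mul_le_mul_of_nonneg_left ((sq_integral_le hn hn2).trans ?_) (sq_nonneg _)
        exact integral_mono hn2 hi fun w => norm_sq_le_sqNorm _

end Drift

/-! ### The hypocoercive quadratic form. -/

section Lyapunov

variable {d : ℕ}

/-- The quadratic form `β|q|² + |p|² + |z|² + 2a q·p + 2b p·z`. -/
noncomputable def lyap (β a b : ℝ) (x : Phase d) : ℝ :=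
  β * ‖x.1‖ ^ 2 + ‖x.2.1‖ ^ 2 + ‖x.2.2‖ ^ 2 + 2 * a * inner ℝ x.1 x.2.1
    + 2 * b * inner ℝ x.2.1 x.2.2

/-- The bilinear form that polarises `lyap`. -/
noncomputable def lyapBilin (β a b : ℝ) (x y : Phase d) : ℝ :=
  β * inner ℝ x.1 y.1 + inner ℝ x.2.1 y.2.1 + inner ℝ x.2.2 y.2.2
    + a * (inner ℝ x.1 y.2.1 + inner ℝ x.2.1 y.1) + b * (inner ℝ x.2.1 y.2.2 + inner ℝ x.2.2 y.2.1)

/-- The linear part `(p, -(β q - λ z), -(λ p + α z))` of the drift. -/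
noncomputable def linDrift (α β lam : ℝ) (x : Phase d) : Phase d :=
  (x.2.1, -(β • x.1 - lam • x.2.2), -(lam • x.2.1 + α • x.2.2))

variable (α β lam a b : ℝ)

lemma continuous_lyap : Continuous (lyap β a b : Phase d → ℝ) := by
  unfold lyap
  fun_prop

lemma lyap_add (x y : Phase d) :
    lyap β a b (x + y) = lyap β a b x + 2 * lyapBilin β a b x y + lyap β a b y := by
  simp only [lyap, lyapBilin, Prod.fst_add, Prod.snd_add, norm_add_sq_real, inner_add_left,
    inner_add_right]
  rw [real_inner_comm x.2.1 y.1, real_inner_comm x.2.2 y.2.1]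
  ring

lemma lyap_smul (r : ℝ) (x : Phase d) : lyap β a b (r • x) = r ^ 2 * lyap β a b x := by
  simp only [lyap, Prod.smul_fst, Prod.smul_snd, norm_smul, inner_smul_left, inner_smul_right,
    mul_pow, Real.norm_eq_abs, sq_abs, conj_trivial]
  ring

lemma lyapBilin_smul_right (r : ℝ) (x y : Phase d) :
    lyapBilin β a b x (r • y) = r * lyapBilin β a b x y := by
  simp only [lyapBilin, Prod.smul_fst, Prod.smul_snd, inner_smul_right]
  ring

lemma lyapBilin_smul_left (r : ℝ) (x y : Phase d) :
    lyapBilin β a b (r • x) y = r * lyapBilin β a b x y := by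
  simp only [lyapBilin, Prod.smul_fst, Prod.smul_snd, inner_smul_left, conj_trivial]
  ring

lemma lyapBilin_add_right (x y z : Phase d) :
    lyapBilin β a b x (y + z) = lyapBilin β a b x y + lyapBilin β a b x z := by
  simp only [lyapBilin, Prod.fst_add, Prod.snd_add, inner_add_right]
  ring

lemma lyap_mid (e : Vec d) : lyap β a b ((0, e, 0) : Phase d) = ‖e‖ ^ 2 := by
  simp [lyap]

variable {α β lam a b}

/-- Young's inequality for a nonnegative form: expand it at `ε x - y`. -/
lemma two_mul_lyapBilin_le (hQ : ∀ x : Phase d, 0 ≤ lyap β a b x) {ε : ℝ} (hε : 0 < ε)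
    (x y : Phase d) : 2 * lyapBilin β a b x y ≤ ε * lyap β a b x + ε⁻¹ * lyap β a b y := by
  have h := hQ (ε • x + (-1 : ℝ) • y)
  rw [lyap_add, lyap_smul, lyap_smul, lyapBilin_smul_left, lyapBilin_smul_right] at h
  refine le_of_mul_le_mul_left ?_ hε
  have : ε * (ε * lyap β a b x + ε⁻¹ * lyap β a b y) = ε ^ 2 * lyap β a b x + lyap β a b y := by
    field_simp
  rw [this]
  linarith

lemma lyap_add_le (hQ : ∀ x : Phase d, 0 ≤ lyap β a b x) (x y : Phase d) :
    lyap β a b (x + y) ≤ 2 * lyap β a b x + 2 * lyap β a b y := by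
  have := two_mul_lyapBilin_le hQ one_pos x y
  rw [lyap_add]
  linarith

lemma sqNorm_linDrift_le (x : Phase d) :
    sqNorm (linDrift α β lam x) ≤ (1 + 2 * α ^ 2 + 2 * β ^ 2 + 4 * lam ^ 2) * sqNorm x := by
  have h1 : ‖-(β • x.1 - lam • x.2.2)‖ ^ 2 ≤ 2 * β ^ 2 * ‖x.1‖ ^ 2 + 2 * lam ^ 2 * ‖x.2.2‖ ^ 2 := by
    have := parallelogram_law_with_norm ℝ (β • x.1) (lam • x.2.2)
    rw [norm_smul, norm_smul, Real.norm_eq_abs, Real.norm_eq_abs] at this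
    rw [norm_neg]
    nlinarith [mul_self_nonneg ‖β • x.1 + lam • x.2.2‖, sq_abs β, sq_abs lam]
  have h2 : ‖-(lam • x.2.1 + α • x.2.2)‖ ^ 2 ≤
      2 * lam ^ 2 * ‖x.2.1‖ ^ 2 + 2 * α ^ 2 * ‖x.2.2‖ ^ 2 := by
    have := parallelogram_law_with_norm ℝ (lam • x.2.1) (α • x.2.2)
    rw [norm_smul, norm_smul, Real.norm_eq_abs, Real.norm_eq_abs] at this
    rw [norm_neg]
    nlinarith [mul_self_nonneg ‖lam • x.2.1 - α • x.2.2‖, sq_abs α, sq_abs lam]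
  simp only [sqNorm, linDrift]
  have t1 := sq_nonneg ‖x.1‖
  have t2 := sq_nonneg ‖x.2.1‖
  have t3 := sq_nonneg ‖x.2.2‖
  have a2 := sq_nonneg α
  have b2 := sq_nonneg β
  have l2 := sq_nonneg lam
  nlinarith [mul_nonneg a2 t1, mul_nonneg a2 t2, mul_nonneg b2 t2, mul_nonneg b2 t3,
    mul_nonneg l2 t1, mul_nonneg l2 t2, mul_nonneg l2 t3]

/-- The conservative couplings cancel in the diagonal part, which dissipates in `z` only. The cross
term `q·p` supplies dissipation in `q` at the price of `|p|²`, and the cross term `p·z` supplies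
dissipation in `p` at the price of `|z|²`. -/
lemma lyapBilin_linDrift (x : Phase d) :
    lyapBilin β a b x (linDrift α β lam x) = -α * ‖x.2.2‖ ^ 2
      + a * (-β * ‖x.1‖ ^ 2 + lam * inner ℝ x.1 x.2.2 + ‖x.2.1‖ ^ 2)
      + b * (-lam * ‖x.2.1‖ ^ 2 - α * inner ℝ x.2.1 x.2.2 - β * inner ℝ x.1 x.2.2
        + lam * ‖x.2.2‖ ^ 2) := by
  simp only [lyapBilin, linDrift, inner_neg_right, inner_sub_right, inner_add_right,
    inner_smul_right, real_inner_self_eq_norm_sq]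
  rw [real_inner_comm x.2.1 x.1, real_inner_comm x.2.2 x.2.1, real_inner_comm x.2.2 x.1]
  ring

/-- The form `lyap β a b` is equivalent to the Euclidean one and is contracted by small explicit
Euler steps of the linear dynamics, up to perturbations of the momentum. -/
structure IsLyapunov (α β lam a b c₁ c₂ γ η h₀ K : ℝ) : Prop where
  c₁_pos : 0 < c₁
  c₂_pos : 0 < c₂
  γ_pos : 0 < γ
  η_pos : 0 < η
  h₀_pos : 0 < h₀
  K_pos : 0 < K
  mul_le_one : γ * h₀ ≤ 1
  le_lyap : ∀ {d : ℕ} (x : Phase d), c₁ * sqNorm x ≤ lyap β a b x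
  lyap_le : ∀ {d : ℕ} (x : Phase d), lyap β a b x ≤ c₂ * sqNorm x
  step : ∀ {d : ℕ} (x : Phase d) (e : Vec d) (τ δ : ℝ), 0 ≤ τ → τ ≤ h₀ → 0 ≤ δ →
    ‖e‖ ≤ η * ‖x.1‖ + δ →
    lyap β a b (x + τ • (linDrift α β lam x + (0, e, 0))) ≤
      (1 - γ * τ) * lyap β a b x + τ * (K * δ ^ 2)

lemma IsLyapunov.nonneg {c₁ c₂ γ η h₀ K : ℝ} (h : IsLyapunov α β lam a b c₁ c₂ γ η h₀ K)
    (x : Phase d) : 0 ≤ lyap β a b x :=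
  (mul_nonneg h.c₁_pos.le (sqNorm_nonneg x)).trans (h.le_lyap x)

lemma abs_mul_inner_le (u v : Vec d) {s r t : ℝ} (hr : 0 < r) (hs : s ^ 2 ≤ 4 * r * t) :
    |s * inner ℝ u v| ≤ r * ‖u‖ ^ 2 + t * ‖v‖ ^ 2 := by
  rw [abs_mul]
  refine (mul_le_mul_of_nonneg_left (abs_real_inner_le_norm u v) (abs_nonneg s)).trans ?_
  refine le_of_mul_le_mul_left ?_ (by positivity : 0 < 4 * r)
  have h1 := sq_nonneg (2 * r * ‖u‖ - |s| * ‖v‖)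
  have h2 := mul_le_mul_of_nonneg_right hs (sq_nonneg ‖v‖)
  have h3 := sq_abs s
  nlinarith

/-- With `a = b λ / 2` the dissipation `b λ |p|²` pays for the gain `a |p|²`. All remaining bad
terms are of order `b`, and after Young's inequality they burden `|z|²`, whose dissipation `α` does
not depend on `b`; a small `b` therefore suffices. -/
lemma exists_form (hα : 0 < α) (hβ : 0 < β) (hlam : 0 < lam) :
    ∃ a b c₁ c₂ c : ℝ, 0 < c₁ ∧ 0 < c₂ ∧ 0 < c ∧ ∀ (d : ℕ) (x : Phase d),
      c₁ * sqNorm x ≤ lyap β a b x ∧ lyap β a b x ≤ c₂ * sqNorm x ∧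
      2 * lyapBilin β a b x (linDrift α β lam x) ≤ -(c * sqNorm x) := by
  -- `b * G` is the total burden on `|z|²`: the gain from `p·z`, the `q·z` terms with coefficient `b
  -- (λ² / 2 - β)`, and the `p·z` term with coefficient `b α`. The other three conditions on `b`
  -- keep the form comparable with the Euclidean one.
  set G := lam + (lam ^ 2 / 2 - β) ^ 2 / (lam * β) + α ^ 2 / lam with hG
  have hGpos : 0 < G := by positivity
  obtain ⟨b, hb, hb1, hb2, hb3, hb4⟩ : ∃ b > 0, b * lam ≤ β ∧ b * lam ≤ 1 / 2 ∧ b ≤ 1 / 4 ∧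
      b * G ≤ α / 2 := by
    refine ⟨min (min (β / lam) (1 / 2 / lam)) (min (1 / 4) (α / 2 / G)), by positivity, ?_, ?_, ?_, ?_⟩
    · rw [← le_div_iff₀ hlam]
      exact (min_le_left _ _).trans (min_le_left _ _)
    · rw [← le_div_iff₀ hlam]
      exact (min_le_left _ _).trans (min_le_right _ _)
    · exact (min_le_right _ _).trans (min_le_left _ _)
    · rw [← le_div_iff₀ hGpos]
      exact (min_le_right _ _).trans (min_le_right _ _)
  refine ⟨b * lam / 2, b, min (β / 2) (1 / 2), 2 * (β + 1),
    min (b * lam * β / 2) (min (b * lam / 2) α), by positivity, by positivity, by positivity,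
    fun d x => ?_⟩
  have n1 := sq_nonneg ‖x.1‖
  have n2 := sq_nonneg ‖x.2.1‖
  have n3 := sq_nonneg ‖x.2.2‖
  have i1 := abs_le.1 (abs_mul_inner_le x.1 x.2.1 (s := b * lam) (r := b * lam / 2)
    (t := b * lam / 2) (by positivity) (by nlinarith))
  have i2 := abs_le.1 (abs_mul_inner_le x.2.1 x.2.2 (s := 2 * b) (r := b) (t := b) hb
    (by nlinarith))
  refine ⟨?_, ?_, ?_⟩
  · have m1 : min (β / 2) (1 / 2) * ‖x.1‖ ^ 2 ≤ β / 2 * ‖x.1‖ ^ 2 :=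
      mul_le_mul_of_nonneg_right (min_le_left _ _) n1
    have m2 : min (β / 2) (1 / 2) * ‖x.2.1‖ ^ 2 ≤ 1 / 2 * ‖x.2.1‖ ^ 2 :=
      mul_le_mul_of_nonneg_right (min_le_right _ _) n2
    have m3 : min (β / 2) (1 / 2) * ‖x.2.2‖ ^ 2 ≤ 1 / 2 * ‖x.2.2‖ ^ 2 :=
      mul_le_mul_of_nonneg_right (min_le_right _ _) n3
    simp only [sqNorm, lyap]
    have k1 := mul_le_mul_of_nonneg_right hb1 n1
    have k2 := mul_le_mul_of_nonneg_right hb2 n2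
    have k3 := mul_le_mul_of_nonneg_right hb3 n2
    have k4 := mul_le_mul_of_nonneg_right hb3 n3
    linarith [i1.1, i2.1]
  · simp only [sqNorm, lyap]
    have k1 := mul_le_mul_of_nonneg_right hb1 n1
    have k2 := mul_le_mul_of_nonneg_right hb2 n2
    have k3 := mul_le_mul_of_nonneg_right hb3 n2
    have k4 := mul_le_mul_of_nonneg_right hb3 n3
    have j1 := mul_nonneg hβ.le n1
    have j2 := mul_nonneg hβ.le n2
    have j3 := mul_nonneg hβ.le n3
    linarith [i1.2, i2.2]
  · rw [lyapBilin_linDrift]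
    have i3 := abs_le.1 (abs_mul_inner_le x.1 x.2.2 (s := b * (lam ^ 2 / 2 - β))
      (r := b * lam * β / 4) (t := b * ((lam ^ 2 / 2 - β) ^ 2 / (lam * β))) (by positivity)
      (le_of_eq (by field_simp)))
    have i4 := abs_le.1 (abs_mul_inner_le x.2.1 x.2.2 (s := b * α)
      (r := b * lam / 4) (t := b * (α ^ 2 / lam)) (by positivity) (le_of_eq (by field_simp)))
    have m1 : min (b * lam * β / 2) (min (b * lam / 2) α) * ‖x.1‖ ^ 2 ≤
        b * lam * β / 2 * ‖x.1‖ ^ 2 := mul_le_mul_of_nonneg_right (min_le_left _ _) n1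
    have m2 : min (b * lam * β / 2) (min (b * lam / 2) α) * ‖x.2.1‖ ^ 2 ≤
        b * lam / 2 * ‖x.2.1‖ ^ 2 :=
      mul_le_mul_of_nonneg_right ((min_le_right _ _).trans (min_le_left _ _)) n2
    have m3 : min (b * lam * β / 2) (min (b * lam / 2) α) * ‖x.2.2‖ ^ 2 ≤ α * ‖x.2.2‖ ^ 2 :=
      mul_le_mul_of_nonneg_right ((min_le_right _ _).trans (min_le_right _ _)) n3
    have k := mul_le_mul_of_nonneg_right hb4 n3
    simp only [sqNorm]
    rw [hG] at k
    linarith [i3.2, i4.1]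

/-- The rate is distributed as follows. The linear flow decays at rate `4 γ`. In first order the
perturbation costs `2 γ`, one `γ` from Young's inequality and one from the part `η ‖x.1‖` of its
size. The term of order `τ ^ 2` costs another `γ` once `τ * L ≤ γ`, and `γ` remains. The defect `δ`
enters with `2 / γ` in first order and, for `4 τ ≤ 1 / γ`, with `1 / γ` in second order, hence `K =
3 / γ`. -/
lemma exists_isLyapunov (hα : 0 < α) (hβ : 0 < β) (hlam : 0 < lam) :
    ∃ a b c₁ c₂ γ η h₀ K : ℝ, IsLyapunov α β lam a b c₁ c₂ γ η h₀ K := by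
  obtain ⟨a, b, c₁, c₂, c, hc₁, hc₂, hc, hform⟩ := exists_form hα hβ hlam
  set γ := c / (4 * c₂) with hγ
  have hγpos : 0 < γ := by positivity
  set η := min 1 (γ * min 1 c₁ / 2) with hη
  have hηpos : 0 < η := by positivity
  have hη2 : 2 * η ^ 2 ≤ γ ^ 2 * c₁ := by
    have h1 : η ≤ γ * min 1 c₁ / 2 := min_le_right _ _
    have h2 : min 1 c₁ * min 1 c₁ ≤ 1 * c₁ :=
      mul_le_mul (min_le_left _ _) (min_le_right _ _) (by positivity) zero_le_one
    have h3 := pow_le_pow_left₀ hηpos.le h1 2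
    have h4 := mul_le_mul_of_nonneg_left h2 (sq_nonneg γ)
    have h5 : 0 < γ ^ 2 * c₁ := by positivity
    nlinarith
  -- `L` controls the form of the perturbed drift in terms of the form of `x`; the summand `4` comes
  -- from `2 ‖e‖ ^ 2` together with `η ≤ 1`.
  set L := (2 * c₂ * (1 + 2 * α ^ 2 + 2 * β ^ 2 + 4 * lam ^ 2) + 4) / c₁ with hL
  have hLpos : 0 < L := by positivity
  set h₀ := min (min (γ / L) (1 / (4 * γ))) 1 with hh₀
  refine ⟨a, b, c₁, c₂, γ, η, h₀, 3 / γ, hc₁, hc₂, hγpos, hηpos, by positivity, by positivity, ?_,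
    fun x => (hform _ x).1, fun x => (hform _ x).2.1, fun {d} x e τ δ hτ hτh hδ he => ?_⟩
  · have h1 : h₀ ≤ 1 / (4 * γ) := (min_le_left _ _).trans (min_le_right _ _)
    calc γ * h₀ ≤ γ * (1 / (4 * γ)) := by gcongr
      _ = 1 / 4 := by field_simp
      _ ≤ 1 := by norm_num
  have hQ : ∀ x : Phase d, 0 ≤ lyap β a b x := fun x =>
    (mul_nonneg hc₁.le (sqNorm_nonneg x)).trans (hform _ x).1
  have hQx := hQ x
  obtain ⟨f1, f2, f3⟩ := hform d x
  have hs := sqNorm_nonneg x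
  have hx1 : ‖x.1‖ ^ 2 ≤ sqNorm x := by
    unfold sqNorm; nlinarith [sq_nonneg ‖x.2.1‖, sq_nonneg ‖x.2.2‖]
  have he2 : ‖e‖ ^ 2 ≤ 2 * η ^ 2 * sqNorm x + 2 * δ ^ 2 := by
    have h1 := pow_le_pow_left₀ (norm_nonneg e) he 2
    have h2 := mul_le_mul_of_nonneg_left hx1 (sq_nonneg η)
    nlinarith [sq_nonneg (η * ‖x.1‖ - δ)]
  have g1 : 2 * lyapBilin β a b x (linDrift α β lam x) ≤ -(4 * γ * lyap β a b x) := by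
    have : 4 * γ * lyap β a b x ≤ 4 * γ * (c₂ * sqNorm x) := by gcongr
    have e : 4 * γ * (c₂ * sqNorm x) = c * sqNorm x := by rw [hγ]; field_simp
    linarith
  have g2 : 2 * lyapBilin β a b x (0, e, 0) ≤ 2 * γ * lyap β a b x + 2 / γ * δ ^ 2 := by
    have h1 := two_mul_lyapBilin_le hQ hγpos x (0, e, 0)
    rw [lyap_mid] at h1
    have h2 : γ⁻¹ * ‖e‖ ^ 2 ≤ γ⁻¹ * (2 * η ^ 2 * sqNorm x + 2 * δ ^ 2) := by gcongr
    have h3 : γ⁻¹ * (2 * η ^ 2 * sqNorm x) ≤ γ⁻¹ * (γ ^ 2 * c₁ * sqNorm x) := by gcongr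
    have h4 : γ⁻¹ * (γ ^ 2 * c₁ * sqNorm x) = γ * (c₁ * sqNorm x) := by field_simp
    have h5 : γ * (c₁ * sqNorm x) ≤ γ * lyap β a b x := by gcongr
    have h6 : γ⁻¹ * (2 * δ ^ 2) = 2 / γ * δ ^ 2 := by field_simp
    linarith
  have g3 : lyap β a b (linDrift α β lam x + (0, e, 0)) ≤ L * lyap β a b x + 4 * δ ^ 2 := by
    have h1 := lyap_add_le hQ (linDrift α β lam x) (0, e, 0)
    rw [lyap_mid] at h1
    have h2 := (hform d (linDrift α β lam x)).2.1
    have h3 := mul_le_mul_of_nonneg_left (sqNorm_linDrift_le (α := α) (β := β) (lam := lam) x)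
      hc₂.le
    have h4 : η ^ 2 ≤ 1 := pow_le_one₀ hηpos.le (min_le_left _ _)
    have h5 := mul_le_mul_of_nonneg_right h4 hs
    have h6 : L * (c₁ * sqNorm x) ≤ L * lyap β a b x := by gcongr
    have h7 : L * (c₁ * sqNorm x) =
        (2 * c₂ * (1 + 2 * α ^ 2 + 2 * β ^ 2 + 4 * lam ^ 2) + 4) * sqNorm x := by
      rw [hL]; field_simp
    linarith
  have hτ1 : τ * L ≤ γ := by
    rw [← le_div_iff₀ hLpos]
    exact hτh.trans ((min_le_left _ _).trans (min_le_left _ _))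
  have hτ2 : τ * 4 ≤ 1 / γ := by
    have := hτh.trans ((min_le_left _ _).trans (min_le_right _ _))
    rw [le_div_iff₀ (by positivity)] at this
    rw [le_div_iff₀ hγpos]
    linarith
  rw [lyap_add, lyapBilin_smul_right, lyap_smul, lyapBilin_add_right]
  have k1 := mul_le_mul_of_nonneg_left g1 hτ
  have k2 := mul_le_mul_of_nonneg_left g2 hτ
  have k3 := mul_le_mul_of_nonneg_left g3 (sq_nonneg τ)
  have k4 : τ ^ 2 * (L * lyap β a b x) ≤ τ * (γ * lyap β a b x) := by
    have := mul_le_mul_of_nonneg_left (mul_le_mul_of_nonneg_right hτ1 hQx) hτ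
    linarith
  have k5 : τ ^ 2 * (4 * δ ^ 2) ≤ τ * (1 / γ * δ ^ 2) := by
    have := mul_le_mul_of_nonneg_left (mul_le_mul_of_nonneg_right hτ2 (sq_nonneg δ)) hτ
    linarith
  have k6 : τ * (3 / γ * δ ^ 2) = τ * (2 / γ * δ ^ 2) + τ * (1 / γ * δ ^ 2) := by ring
  rw [k6]
  linarith

end Lyapunov

/-! ### Narrow limits of couplings. -/

section Compactness

open Filter Topology

/-- A convergent sequence together with its limit is compact, and relatively compact families on a
Polish space are tight. -/
lemma isTightMeasureSet_range_of_tendsto {X : Type*} [MetricSpace X] [CompleteSpace X]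
    [SecondCountableTopology X] [MeasurableSpace X] [BorelSpace X] {μ : ℕ → ProbabilityMeasure X}
    {μ' : ProbabilityMeasure X} (h : Tendsto μ atTop (𝓝 μ')) :
    IsTightMeasureSet {((ν : ProbabilityMeasure X) : Measure X) | ν ∈ range μ} := by
  refine isTightMeasureSet_of_isCompact_closure ?_
  exact h.isCompact_insert_range.closure_of_subset (subset_insert _ _)

/-- Lower semicontinuity of the cost, by the portmanteau inequality on open sets. No uniform
integrability is required. -/
lemma lintegral_le_of_tendsto {X : Type*} [TopologicalSpace X] [MeasurableSpace X]
    [OpensMeasurableSpace X] [HasOuterApproxClosed X] {π : ℕ → ProbabilityMeasure X}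
    {π' : ProbabilityMeasure X} (h : Tendsto π atTop (𝓝 π')) {c : X → ℝ} (hc : Continuous c)
    (hc0 : ∀ x, 0 ≤ c x) {R : ℝ≥0∞}
    (hR : ∀ n, ∫⁻ x, ENNReal.ofReal (c x) ∂(π n : Measure X) ≤ R) :
    ∫⁻ x, ENNReal.ofReal (c x) ∂(π' : Measure X) ≤ R := by
  refine (lintegral_le_liminf_lintegral_of_forall_isOpen_measure_le_liminf_measure hc hc0
    fun G hG => ProbabilityMeasure.le_liminf_measure_open_of_tendsto h hG).trans ?_
  refine (liminf_le_liminf (Eventually.of_forall hR)).trans (le_of_eq ?_)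
  exact liminf_const R

/-- Couplings with a uniformly bounded cost pass to the narrow limit. -/
lemma exists_coupling_of_tendsto {X : Type*} [MetricSpace X] [CompleteSpace X]
    [SecondCountableTopology X] [MeasurableSpace X] [BorelSpace X]
    {μ ν : ℕ → ProbabilityMeasure X} {μ' ν' : ProbabilityMeasure X}
    (hμ : Tendsto μ atTop (𝓝 μ')) (hν : Tendsto ν atTop (𝓝 ν')) {c : X × X → ℝ}
    (hc : Continuous c) (hc0 : ∀ w, 0 ≤ c w) {R : ℝ≥0∞}
    (h : ∀ n, ∃ π : Measure (X × X), π.map Prod.fst = (μ n : Measure X) ∧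
      π.map Prod.snd = (ν n : Measure X) ∧ ∫⁻ w, ENNReal.ofReal (c w) ∂π ≤ R) :
    ∃ π : Measure (X × X), π.map Prod.fst = (μ' : Measure X) ∧ π.map Prod.snd = (ν' : Measure X) ∧
      ∫⁻ w, ENNReal.ofReal (c w) ∂π ≤ R := by
  choose π h1 h2 h3 using h
  have hp : ∀ n, IsProbabilityMeasure (π n) := fun n => by
    have : IsProbabilityMeasure ((π n).map Prod.fst) := by rw [h1]; infer_instance
    exact Measure.isProbabilityMeasure_of_map Prod.fst
  set Γ : ℕ → ProbabilityMeasure (X × X) := fun n => ⟨π n, hp n⟩ with hΓ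
  -- Couplings are tight as soon as both families of marginals are.
  have htight : IsTightMeasureSet
      {((m : ProbabilityMeasure (X × X)) : Measure (X × X)) | m ∈ range Γ} := by
    refine IsTightMeasureSet.prodMk ?_ ?_
    · refine (isTightMeasureSet_range_of_tendsto hμ).subset ?_
      rintro _ ⟨_, ⟨_, ⟨n, rfl⟩, rfl⟩, rfl⟩
      exact ⟨μ n, ⟨n, rfl⟩, (h1 n).symm⟩
    · refine (isTightMeasureSet_range_of_tendsto hν).subset ?_
      rintro _ ⟨_, ⟨_, ⟨n, rfl⟩, rfl⟩, rfl⟩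
      exact ⟨ν n, ⟨n, rfl⟩, (h2 n).symm⟩
  have hcomp := isCompact_closure_of_isTightMeasureSet htight
  obtain ⟨Γ', -, φ, hφ, hlim⟩ := hcomp.tendsto_subseq (x := Γ) fun n => subset_closure ⟨n, rfl⟩
  refine ⟨Γ', ?_, ?_, ?_⟩
  · have t1 := ProbabilityMeasure.tendsto_map_of_tendsto_of_continuous _ _ hlim continuous_fst
    have t2 := hμ.comp hφ.tendsto_atTop
    have e : (fun n => ((Γ ∘ φ) n).map continuous_fst.measurable.aemeasurable) = μ ∘ φ := by
      funext n
      exact Subtype.ext (h1 (φ n))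
    rw [e] at t1
    exact congrArg (fun m : ProbabilityMeasure X => (m : Measure X)) (tendsto_nhds_unique t1 t2)
  · have t1 := ProbabilityMeasure.tendsto_map_of_tendsto_of_continuous _ _ hlim continuous_snd
    have t2 := hν.comp hφ.tendsto_atTop
    have e : (fun n => ((Γ ∘ φ) n).map continuous_snd.measurable.aemeasurable) = ν ∘ φ := by
      funext n
      exact Subtype.ext (h2 (φ n))
    rw [e] at t1
    exact congrArg (fun m : ProbabilityMeasure X => (m : Measure X)) (tendsto_nhds_unique t1 t2)
  · exact lintegral_le_of_tendsto hlim hc hc0 fun n => h3 (φ n)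

end Compactness

/-! ### Synchronous coupling of two Euler schemes. -/

section CoupledScheme

variable {d : ℕ} {α β lam C_A C_B : ℝ} {A B : Vec d → Vec d}

/-- The standing assumptions on the coefficients. -/
structure IsCoeff (α β lam C_A C_B : ℝ) (A B : Vec d → Vec d) : Prop where
  α_nonneg : 0 ≤ α
  β_nonneg : 0 ≤ β
  lam_nonneg : 0 ≤ lam
  CA_nonneg : 0 ≤ C_A
  CB_nonneg : 0 ≤ C_B
  lipA : ∀ q₁ q₂, ‖A q₁ - A q₂‖ ≤ C_A * ‖q₁ - q₂‖
  lipB : ∀ q₁ q₂, ‖B q₁ - B q₂‖ ≤ C_B * ‖q₁ - q₂‖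

lemma IsCoeff.continuous_drift (hc : IsCoeff α β lam C_A C_B A B)
    {μ : ProbabilityMeasure (Phase d)} (hμ : Integrable (fun x => ‖x‖) (μ : Measure (Phase d))) :
    Continuous (drift α β lam A B μ) :=
  GenVlasov.continuous_drift hc.α_nonneg hc.β_nonneg hc.lam_nonneg hc.CA_nonneg hc.CB_nonneg
    hc.lipA hc.lipB hμ

/-- The common noise cancels, and the nonlinear forces act on the momentum only. This is the shape
of perturbation that `IsLyapunov.step` tolerates. -/
lemma eulerStep_drift_sub (τ : ℝ) (μ ν : ProbabilityMeasure (Phase d)) (j : Option (Fin d × Bool))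
    (x y : Phase d) :
    eulerStep zDir τ (drift α β lam A B μ) j x - eulerStep zDir τ (drift α β lam A B ν) j y =
      (x - y) + τ • (linDrift α β lam (x - y) +
        (0, -((A x.1 - A y.1) + (meanField B μ x.1 - meanField B ν y.1)), 0)) := by
  have e : drift α β lam A B μ x - drift α β lam A B ν y = linDrift α β lam (x - y) +
      (0, -((A x.1 - A y.1) + (meanField B μ x.1 - meanField B ν y.1)), 0) := by
    refine Prod.ext ?_ (Prod.ext ?_ ?_)
    · simp [drift, linDrift]
    · simp only [drift, linDrift, Prod.snd_sub, Prod.fst_sub, Prod.snd_add, Prod.fst_add, smul_sub]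
      abel
    · simp only [drift, linDrift, Prod.snd_sub, Prod.fst_sub, Prod.snd_add, smul_sub, add_zero]
      abel
  rw [← e]
  simp only [eulerStep, smul_sub]
  abel

variable {a b c₁ c₂ γ η h₀ K : ℝ}

/-- The difference of the mean fields is split at a fixed measure and at a fixed point. The first
part is Lipschitz in position and joins `A` under the threshold `η`; the second is the defect `δ`.
-/
lemma IsLyapunov.eulerStep_sub_le (hL : IsLyapunov α β lam a b c₁ c₂ γ η h₀ K)
    (hc : IsCoeff α β lam C_A C_B A B) (hη : C_A + C_B ≤ η) {τ δ : ℝ} (hτ : 0 ≤ τ) (hτh : τ ≤ h₀)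
    {μ ν : ProbabilityMeasure (Phase d)} (hμ : Integrable (fun x => ‖x‖) (μ : Measure (Phase d)))
    (hδ : ∀ q, ‖meanField B μ q - meanField B ν q‖ ≤ δ) (j : Option (Fin d × Bool))
    (x y : Phase d) :
    lyap β a b (eulerStep zDir τ (drift α β lam A B μ) j x
      - eulerStep zDir τ (drift α β lam A B ν) j y) ≤
      (1 - γ * τ) * lyap β a b (x - y) + τ * (K * δ ^ 2) := by
  rw [eulerStep_drift_sub]
  refine hL.step _ _ τ δ hτ hτh ((norm_nonneg _).trans (hδ 0)) ?_
  rw [norm_neg]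
  have h1 := norm_meanField_sub_le hc.CB_nonneg hc.lipB hμ x.1 y.1
  have h2 := hc.lipA x.1 y.1
  have h3 := hδ y.1
  have h4 : meanField B μ x.1 - meanField B ν y.1 =
      (meanField B μ x.1 - meanField B μ y.1) + (meanField B μ y.1 - meanField B ν y.1) := by abel
  have h5 := mul_le_mul_of_nonneg_right hη (norm_nonneg (x.1 - y.1))
  rw [h4]
  refine (norm_add_le _ _).trans ?_
  have h6 := norm_add_le (meanField B μ x.1 - meanField B μ y.1)
    (meanField B μ y.1 - meanField B ν y.1)
  change _ ≤ η * ‖x.1 - y.1‖ + δ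
  linarith

/-- One step of the Euler scheme for two drifts, driven by the same noise. -/
noncomputable def coupledStep {E ι : Type*} [NormedAddCommGroup E] [NormedSpace ℝ E] [Fintype ι]
    [MeasurableSpace E] (e : ι → E) (τ : ℝ) (b b' : E → E) (π : Measure (E × E)) :
    Measure (E × E) :=
  avgMap (fun j w => (eulerStep e τ b j w.1, eulerStep e τ b' j w.2)) π

section Marginals

variable {E ι : Type*} [NormedAddCommGroup E] [NormedSpace ℝ E] [Fintype ι]
  [MeasurableSpace E] [BorelSpace E] {e : ι → E} {τ : ℝ} {b b' : E → E}

lemma measurable_coupled_eulerStep (hb : Continuous b) (hb' : Continuous b')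
    (j : Option (ι × Bool)) :
    Measurable fun w : E × E => (eulerStep e τ b j w.1, eulerStep e τ b' j w.2) :=
  ((continuous_eulerStep e τ hb j).measurable.comp measurable_fst).prodMk
    ((continuous_eulerStep e τ hb' j).measurable.comp measurable_snd)

lemma coupledStep_map_fst (hb : Continuous b) (hb' : Continuous b') (π : Measure (E × E)) :
    (coupledStep e τ b b' π).map Prod.fst = avgMap (eulerStep e τ b) (π.map Prod.fst) := by
  rw [coupledStep, map_avgMap (measurable_coupled_eulerStep hb hb') _ measurable_fst,
    avgMap_map (fun j => (continuous_eulerStep e τ hb j).measurable) _ measurable_fst]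

lemma coupledStep_map_snd (hb : Continuous b) (hb' : Continuous b') (π : Measure (E × E)) :
    (coupledStep e τ b b' π).map Prod.snd = avgMap (eulerStep e τ b') (π.map Prod.snd) := by
  rw [coupledStep, map_avgMap (measurable_coupled_eulerStep hb hb') _ measurable_snd,
    avgMap_map (fun j => (continuous_eulerStep e τ hb' j).measurable) _ measurable_snd]

end Marginals

/-- A pointwise estimate for the mean over the noise is integrated. It serves both for the cost of a
coupling and for the moment of a single law. -/
lemma lintegral_avgMap_le {J X Y : Type*} [Fintype J] [Nonempty J] [MeasurableSpace X]
    [MeasurableSpace Y] {f : J → X → Y} (hf : ∀ j, Measurable (f j)) (μ : Measure X)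
    [IsProbabilityMeasure μ] {c : Y → ℝ} (hc : Measurable c) (hc0 : ∀ y, 0 ≤ c y) {c' : X → ℝ}
    (hc' : Measurable c') {r s V : ℝ} (hr : 0 ≤ r) (hs : 0 ≤ s) (hV : 0 ≤ V) (h0 : ∀ x, 0 ≤ c' x)
    (h : ∀ x, (Fintype.card J : ℝ)⁻¹ * ∑ j, c (f j x) ≤ r * c' x + s)
    (hint : ∫⁻ x, ENNReal.ofReal (c' x) ∂μ ≤ ENNReal.ofReal V) :
    ∫⁻ y, ENNReal.ofReal (c y) ∂(avgMap f μ) ≤ ENNReal.ofReal (r * V + s) := by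
  rw [lintegral_avgMap hf μ (by fun_prop), ← lintegral_finsetSum _ (by fun_prop),
    ← lintegral_const_mul _ (by fun_prop)]
  calc ∫⁻ x, (Fintype.card J : ℝ≥0∞)⁻¹ * ∑ j, ENNReal.ofReal (c (f j x)) ∂μ
      ≤ ∫⁻ x, (ENNReal.ofReal r * ENNReal.ofReal (c' x) + ENNReal.ofReal s) ∂μ := by
        refine lintegral_mono fun x => ?_
        have hJ : (0 : ℝ) < Fintype.card J := by exact_mod_cast Fintype.card_pos
        rw [← ENNReal.ofReal_mul hr, ← ENNReal.ofReal_add (mul_nonneg hr (h0 x)) hs,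
          ← ENNReal.ofReal_sum_of_nonneg fun j _ => hc0 _, ← ENNReal.ofReal_natCast,
          ← ENNReal.ofReal_inv_of_pos hJ, ← ENNReal.ofReal_mul (inv_nonneg.2 hJ.le)]
        exact ENNReal.ofReal_le_ofReal (h x)
    _ = ENNReal.ofReal r * ∫⁻ x, ENNReal.ofReal (c' x) ∂μ + ENNReal.ofReal s := by
        rw [lintegral_add_right _ measurable_const, lintegral_const_mul _ (by fun_prop)]
        simp
    _ ≤ ENNReal.ofReal r * ENNReal.ofReal V + ENNReal.ofReal s := by gcongr
    _ = ENNReal.ofReal (r * V + s) := by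
        rw [← ENNReal.ofReal_mul hr, ← ENNReal.ofReal_add (mul_nonneg hr hV) hs]

lemma avg_le {J : Type*} [Fintype J] [Nonempty J] {a : J → ℝ} {c : ℝ} (h : ∀ j, a j ≤ c) :
    (Fintype.card J : ℝ)⁻¹ * ∑ j, a j ≤ c := by
  rw [← avg_const (J := J) c]
  exact mul_le_mul_of_nonneg_left (Finset.sum_le_sum fun j _ => h j) (by positivity)

lemma IsLyapunov.lintegral_coupledStep_le (hL : IsLyapunov α β lam a b c₁ c₂ γ η h₀ K)
    (hc : IsCoeff α β lam C_A C_B A B) (hη : C_A + C_B ≤ η) {τ δ V : ℝ} (hτ : 0 ≤ τ) (hτh : τ ≤ h₀)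
    {μ ν : ProbabilityMeasure (Phase d)} (hμ : Integrable (fun x => ‖x‖) (μ : Measure (Phase d)))
    (hν : Integrable (fun x => ‖x‖) (ν : Measure (Phase d)))
    (hδ : ∀ q, ‖meanField B μ q - meanField B ν q‖ ≤ δ) (hV : 0 ≤ V)
    (π : Measure (Phase d × Phase d)) [IsProbabilityMeasure π]
    (hπ : ∫⁻ w, ENNReal.ofReal (lyap β a b (w.1 - w.2)) ∂π ≤ ENNReal.ofReal V) :
    ∫⁻ w, ENNReal.ofReal (lyap β a b (w.1 - w.2))
      ∂(coupledStep zDir τ (drift α β lam A B μ) (drift α β lam A B ν) π) ≤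
      ENNReal.ofReal ((1 - γ * τ) * V + τ * (K * δ ^ 2)) := by
  have hm : Measurable fun w : Phase d × Phase d => lyap β a b (w.1 - w.2) :=
    ((continuous_lyap β a b).comp (continuous_fst.sub continuous_snd)).measurable
  have h1 : γ * τ ≤ 1 := (mul_le_mul_of_nonneg_left hτh hL.γ_pos.le).trans hL.mul_le_one
  have hK := hL.K_pos.le
  exact lintegral_avgMap_le
    (measurable_coupled_eulerStep (hc.continuous_drift hμ) (hc.continuous_drift hν)) π hm (fun w => hL.nonneg _) hm
    (by linarith) (by positivity) hV (fun w => hL.nonneg _)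
    (fun w => avg_le fun j => hL.eulerStep_sub_le hc hη hτ hτh hμ hδ j w.1 w.2) hπ

lemma IsCoupling.isProbabilityMeasure {μ ν : ProbabilityMeasure (Phase d)}
    {π : Measure (Phase d × Phase d)} (h : IsCoupling π μ ν) : IsProbabilityMeasure π := by
  have : IsProbabilityMeasure (π.map Prod.fst) := by rw [h.1]; infer_instance
  exact Measure.isProbabilityMeasure_of_map Prod.fst

end CoupledScheme

/-! ### Exponential contraction for two solutions. -/

section Contraction

open Filter Topology

variable {d : ℕ} {α β lam C_A C_B : ℝ} {A B : Vec d → Vec d} {a b c₁ c₂ γ η h₀ K : ℝ}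

lemma IsCoeff.isFPSolution (hc : IsCoeff α β lam C_A C_B A B) {ρ : ℝ → ProbabilityMeasure (Phase d)}
    (h : IsSolution α β lam A B ρ) : IsFPSolution zDir (fun t => drift α β lam A B (ρ t)) ρ :=
  h.isFPSolution hc.α_nonneg hc.β_nonneg hc.lam_nonneg hc.CA_nonneg hc.CB_nonneg hc.lipA hc.lipB

lemma IsCoeff.exists_tendsto_schemeLaw (hc : IsCoeff α β lam C_A C_B A B)
    {ρ : ℝ → ProbabilityMeasure (Phase d)} (h : IsSolution α β lam A B ρ) {T : ℝ} (hT : 0 < T) :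
    ∃ μ : ℕ → ProbabilityMeasure (Phase d), (∀ n : ℕ, (μ n : Measure (Phase d)) =
      schemeLaw zDir (fun t => drift α β lam A B (ρ t)) (T / (n + 1)) (ρ 0) (n + 1)) ∧
      Tendsto μ atTop (𝓝 (ρ T)) := by
  have hF := hc.isFPSolution h
  have hp := fun n : ℕ => isProbabilityMeasure_schemeLaw (e := zDir) (τ := T / ((n : ℝ) + 1))
    (by positivity) hF.continuous_drift (ρ 0 : Measure (Phase d)) (n + 1)
  obtain ⟨R, hR, hRb⟩ := hF.exists_secondMoment_le h.secondMoment hT.le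
  have h1 := hc.α_nonneg
  have h2 := hc.β_nonneg
  have h3 := hc.lam_nonneg
  have h4 := hc.CA_nonneg
  have h5 := hc.CB_nonneg
  refine ⟨fun n => ⟨_, hp n⟩, fun n => rfl, ?_⟩
  refine hF.tendsto_schemeLaw hT (L := 1 + α + β + 2 * lam + C_A + C_B) (W := 2 * (1 + R))
    (by positivity) (fun t ht x y =>
    norm_drift_sub_le h1 h2 h3 h4 h5 hc.lipA hc.lipB (h.integrable_norm ht.1) x y)
    (fun ω hω => h.exists_drift_modulus h1 h2 h3 h4 h5 hc.lipA hc.lipB hT.le hω)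
    (fun t ht => ?_) _ fun n => rfl
  have hi := (h.secondMoment t ht.1).integrable
  refine ⟨Integrable.one_add_norm_sq hi, ?_⟩
  calc ∫ x, (1 + ‖x‖) ^ 2 ∂(ρ t : Measure (Phase d))
      ≤ ∫ x, 2 * (1 + sqNorm x) ∂(ρ t : Measure (Phase d)) :=
        integral_mono (Integrable.one_add_norm_sq hi)
          (((integrable_const _).add hi).const_mul 2) one_add_norm_sq_le
    _ = 2 * (1 + ∫ x, sqNorm x ∂(ρ t : Measure (Phase d))) := by
        rw [integral_const_mul, integral_add (integrable_const _) hi]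
        simp
    _ ≤ 2 * (1 + R) := by
        have := hRb t ht
        linarith

lemma continuous_lyap_sub (β a b : ℝ) :
    Continuous fun w : Phase d × Phase d => lyap β a b (w.1 - w.2) :=
  (continuous_lyap β a b).comp (continuous_fst.sub continuous_snd)

/-- The source term uses at most half of the rate `γ`, and the other half remains: `1 - γ τ / 2 ≤
exp (-γ τ / 2)`. -/
lemma decay_step {γ τ R θV e : ℝ} (hτ : 0 ≤ τ) (hR : 0 ≤ R) (he : 0 ≤ e)
    (hθ : θV ≤ γ / 2 * R) :
    (1 - γ * τ) * (R * e) + τ * (θV * e) ≤ R * (e * Real.exp (-(γ / 2) * τ)) := by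
  have h1 : 1 - γ / 2 * τ ≤ Real.exp (-(γ / 2) * τ) := by
    have := Real.add_one_le_exp (-(γ / 2) * τ)
    linarith
  have h2 := mul_le_mul_of_nonneg_left h1 (mul_nonneg hR he)
  have h3 := mul_le_mul_of_nonneg_left hθ (mul_nonneg hτ he)
  linarith

/-- If the two mean-field forces are exponentially close, then so are the two solutions. -/
lemma IsLyapunov.exists_coupling_le (hL : IsLyapunov α β lam a b c₁ c₂ γ η h₀ K)
    (hc : IsCoeff α β lam C_A C_B A B) (hη : C_A + C_B ≤ η) {ρ ρ' : ℝ → ProbabilityMeasure (Phase d)}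
    (h : IsSolution α β lam A B ρ) (h' : IsSolution α β lam A B ρ') {T V r : ℝ} (hT : 0 < T)
    (hV : 0 ≤ V) (hr : 0 ≤ r)
    (hmf : ∀ s ∈ Icc 0 T, ∀ q, ‖meanField B (ρ s) q - meanField B (ρ' s) q‖ ^ 2 ≤
      V * Real.exp (-(γ / 2) * s))
    {π₀ : Measure (Phase d × Phase d)} (hπ₀ : IsCoupling π₀ (ρ 0) (ρ' 0))
    (hr₀ : ∫⁻ w, ENNReal.ofReal (lyap β a b (w.1 - w.2)) ∂π₀ ≤ ENNReal.ofReal r) :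
    ∃ π, IsCoupling π (ρ T) (ρ' T) ∧ ∫⁻ w, ENNReal.ofReal (lyap β a b (w.1 - w.2)) ∂π ≤
      ENNReal.ofReal ((r + 2 * K / γ * V) * Real.exp (-(γ / 2) * T)) := by
  have hγ := hL.γ_pos
  have hK := hL.K_pos
  obtain ⟨μ, hμ, hμlim⟩ := hc.exists_tendsto_schemeLaw h hT
  obtain ⟨ν, hν, hνlim⟩ := hc.exists_tendsto_schemeLaw h' hT
  have hF := hc.isFPSolution h
  have hF' := hc.isFPSolution h'
  -- `R` dominates the initial cost `r` and satisfies `K V ≤ γ / 2 * R`, the two conditions under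
  -- which the decay propagates from step to step.
  set R := r + 2 * K / γ * V with hR
  have hR0 : 0 ≤ R := by positivity
  -- The contraction needs steps of length at most `h₀`, so the first `N` schemes are discarded.
  obtain ⟨N, hN⟩ := exists_nat_gt (T / h₀)
  have hN' : T < N * h₀ := (div_lt_iff₀ hL.h₀_pos).1 hN
  simp only [IsCoupling, and_assoc]
  refine exists_coupling_of_tendsto (hμlim.comp (tendsto_add_atTop_nat N))
    (hνlim.comp (tendsto_add_atTop_nat N)) (continuous_lyap_sub β a b) (fun w => hL.nonneg _)
    fun n => ?_
  simp only [Function.comp_apply, hμ, hν]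
  set τ : ℝ := T / ((n + N : ℕ) + 1) with hτ
  have hτ0 : 0 ≤ τ := by positivity
  have hτh : τ ≤ h₀ := by
    rw [hτ, div_le_iff₀ (by positivity)]
    have := hL.h₀_pos
    push_cast
    nlinarith [mul_nonneg this.le (Nat.cast_nonneg (α := ℝ) n)]
  have hτT : ((n + N + 1 : ℕ) : ℝ) * τ = T := by
    rw [hτ]
    push_cast
    field_simp
  have key : ∀ m : ℕ, m ≤ n + N + 1 → ∃ π : Measure (Phase d × Phase d),
      π.map Prod.fst = schemeLaw zDir (fun t => drift α β lam A B (ρ t)) τ (ρ 0) m ∧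
      π.map Prod.snd = schemeLaw zDir (fun t => drift α β lam A B (ρ' t)) τ (ρ' 0) m ∧
      ∫⁻ w, ENNReal.ofReal (lyap β a b (w.1 - w.2)) ∂π ≤
        ENNReal.ofReal (R * Real.exp (-(γ / 2) * (m * τ))) := by
    intro m
    induction m with
    | zero =>
      intro _
      refine ⟨π₀, hπ₀.1, hπ₀.2, hr₀.trans (ENNReal.ofReal_le_ofReal ?_)⟩
      simp only [Nat.cast_zero, zero_mul, mul_zero, Real.exp_zero, mul_one]
      have : 0 ≤ 2 * K / γ * V := by positivity
      linarith
    | succ m ih =>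
      intro hm
      obtain ⟨π, hπ1, hπ2, hπ3⟩ := ih (by omega)
      have hmτ0 : 0 ≤ (m : ℝ) * τ := by positivity
      have hmτ : (m : ℝ) * τ ∈ Icc 0 T := by
        refine ⟨hmτ0, ?_⟩
        rw [← hτT]
        gcongr
        omega
      have : IsProbabilityMeasure π := by
        have : IsProbabilityMeasure (π.map Prod.fst) := by
          rw [hπ1]
          exact isProbabilityMeasure_schemeLaw hτ0 hF.continuous_drift _ m
        exact Measure.isProbabilityMeasure_of_map Prod.fst
      refine ⟨coupledStep zDir τ (drift α β lam A B (ρ (m * τ))) (drift α β lam A B (ρ' (m * τ))) π,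
        ?_, ?_, ?_⟩
      · rw [coupledStep_map_fst (hF.continuous_drift _ hmτ0) (hF'.continuous_drift _ hmτ0), hπ1]
        rfl
      · rw [coupledStep_map_snd (hF.continuous_drift _ hmτ0) (hF'.continuous_drift _ hmτ0), hπ2]
        rfl
      · have hd0 : 0 ≤ V * Real.exp (-(γ / 2) * (m * τ)) := by positivity
        refine (hL.lintegral_coupledStep_le hc hη hτ0 hτh (h.integrable_norm hmτ0)
          (h'.integrable_norm hmτ0) (δ := √(V * Real.exp (-(γ / 2) * (m * τ))))
          (fun q => Real.le_sqrt_of_sq_le (hmf _ hmτ q)) (by positivity) π hπ3).trans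
          (ENNReal.ofReal_le_ofReal ?_)
        rw [Real.sq_sqrt hd0]
        have e1 : K * (V * Real.exp (-(γ / 2) * (m * τ))) =
          K * V * Real.exp (-(γ / 2) * (m * τ)) := by ring
        have e2 : Real.exp (-(γ / 2) * ((m + 1 : ℕ) * τ)) =
            Real.exp (-(γ / 2) * (m * τ)) * Real.exp (-(γ / 2) * τ) := by
          rw [← Real.exp_add]
          congr 1
          push_cast
          ring
        rw [e1, e2]
        refine decay_step hτ0 hR0 (Real.exp_nonneg _) ?_
        have : γ / 2 * R = γ / 2 * r + K * V := by rw [hR]; field_simp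
        rw [this]
        have : 0 ≤ γ / 2 * r := by positivity
        linarith
  obtain ⟨π, h1, h2, h3⟩ := key (n + N + 1) le_rfl
  rw [hτT] at h3
  exact ⟨π, h1, h2, h3⟩

lemma sqNorm_sub_le (x y : Phase d) : sqNorm (x - y) ≤ 2 * sqNorm x + 2 * sqNorm y := by
  have key : ∀ u v : Vec d, ‖u - v‖ ^ 2 ≤ 2 * ‖u‖ ^ 2 + 2 * ‖v‖ ^ 2 := fun u v => by
    have := parallelogram_law_with_norm ℝ u v
    nlinarith [mul_self_nonneg ‖u + v‖]
  have h1 := key x.1 y.1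
  have h2 := key x.2.1 y.2.1
  have h3 := key x.2.2 y.2.2
  simp only [sqNorm, Prod.fst_sub, Prod.snd_sub]
  linarith

lemma isCoupling_prod (μ ν : ProbabilityMeasure (Phase d)) :
    IsCoupling ((μ : Measure (Phase d)).prod (ν : Measure (Phase d))) μ ν := by
  constructor
  · rw [Measure.map_fst_prod]; simp
  · rw [Measure.map_snd_prod]; simp

lemma IsCoupling.integrable_sqNorm_sub {μ ν : ProbabilityMeasure (Phase d)}
    {π : Measure (Phase d × Phase d)} (h : IsCoupling π μ ν) (hμ : FiniteSecondMoment μ)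
    (hν : FiniteSecondMoment ν) : Integrable (fun w => sqNorm (w.1 - w.2)) π := by
  have i1 : Integrable (fun w : Phase d × Phase d => sqNorm w.1) π := by
    have := hμ.integrable
    rw [← h.1, integrable_map_measure continuous_sqNorm.aestronglyMeasurable
      measurable_fst.aemeasurable] at this
    exact this
  have i2 : Integrable (fun w : Phase d × Phase d => sqNorm w.2) π := by
    have := hν.integrable
    rw [← h.2, integrable_map_measure continuous_sqNorm.aestronglyMeasurable
      measurable_snd.aemeasurable] at this
    exact this
  refine ((i1.const_mul 2).add (i2.const_mul 2)).mono'
    (continuous_sqNorm.comp (continuous_fst.sub continuous_snd)).aestronglyMeasurable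
    (ae_of_all _ fun w => ?_)
  rw [Real.norm_of_nonneg (sqNorm_nonneg _)]
  exact sqNorm_sub_le w.1 w.2

lemma IsLyapunov.sq_norm_meanField_sub_le (hL : IsLyapunov α β lam a b c₁ c₂ γ η h₀ K)
    (hc : IsCoeff α β lam C_A C_B A B) {μ ν : ProbabilityMeasure (Phase d)}
    (hμ : FiniteSecondMoment μ) (hν : FiniteSecondMoment ν) {π : Measure (Phase d × Phase d)}
    (hπ : IsCoupling π μ ν) {V : ℝ} (hV : 0 ≤ V)
    (h : ∫⁻ w, ENNReal.ofReal (lyap β a b (w.1 - w.2)) ∂π ≤ ENNReal.ofReal V) (q : Vec d) :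
    ‖meanField B μ q - meanField B ν q‖ ^ 2 ≤ C_B ^ 2 / c₁ * V := by
  have hi := hπ.integrable_sqNorm_sub hμ hν
  have hc1 := hL.c₁_pos
  refine (sq_norm_meanField_sub_meanField_le hc.CB_nonneg hc.lipB
    (Integrable.norm_of_sqNorm hμ.integrable) (Integrable.norm_of_sqNorm hν.integrable)
    hπ hi q).trans ?_
  have h1 : c₁ * ∫ w, sqNorm (w.1 - w.2) ∂π ≤ V := by
    rw [← integral_const_mul]
    have h2 : ENNReal.ofReal (∫ w, c₁ * sqNorm (w.1 - w.2) ∂π) ≤ ENNReal.ofReal V := by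
      rw [ofReal_integral_eq_lintegral_ofReal (hi.const_mul c₁)
        (ae_of_all _ fun w => mul_nonneg hc1.le (sqNorm_nonneg _))]
      exact (lintegral_mono fun w => ENNReal.ofReal_le_ofReal (hL.le_lyap _)).trans h
    exact (ENNReal.ofReal_le_ofReal_iff hV).1 h2
  have h3 : ∫ w, sqNorm (w.1 - w.2) ∂π ≤ V / c₁ := by
    rw [le_div_iff₀ hc1]
    linarith
  calc C_B ^ 2 * ∫ w, sqNorm (w.1 - w.2) ∂π ≤ C_B ^ 2 * (V / c₁) := by gcongr
    _ = C_B ^ 2 / c₁ * V := by ring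

/-- The product coupling and the second moment bounds suffice. The factor `exp (γ T / 2)` in the
constant only rewrites a bound on `[0, T]` in the decaying form used by the iteration. -/
lemma IsLyapunov.exists_apriori (hL : IsLyapunov α β lam a b c₁ c₂ γ η h₀ K)
    (hc : IsCoeff α β lam C_A C_B A B) {ρ ρ' : ℝ → ProbabilityMeasure (Phase d)}
    (h : IsSolution α β lam A B ρ) (h' : IsSolution α β lam A B ρ') {T : ℝ} (hT : 0 ≤ T) :
    ∃ v, 0 ≤ v ∧ ∀ s ∈ Icc 0 T, ∃ π, IsCoupling π (ρ s) (ρ' s) ∧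
      ∫⁻ w, ENNReal.ofReal (lyap β a b (w.1 - w.2)) ∂π ≤
        ENNReal.ofReal (v * Real.exp (-(γ / 2) * s)) := by
  obtain ⟨R, hR, hRb⟩ := (hc.isFPSolution h).exists_secondMoment_le h.secondMoment hT
  obtain ⟨R', hR', hRb'⟩ := (hc.isFPSolution h').exists_secondMoment_le h'.secondMoment hT
  have hc2 := hL.c₂_pos
  refine ⟨c₂ * (2 * R + 2 * R') * Real.exp (γ / 2 * T), by positivity, fun s hs =>
    ⟨_, isCoupling_prod _ _, ?_⟩⟩
  have i1 := (h.secondMoment s hs.1).integrable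
  have i2 := (h'.secondMoment s hs.1).integrable
  have j1 := i1.comp_fst (ν := (ρ' s : Measure (Phase d)))
  have j2 := i2.comp_snd (μ := (ρ s : Measure (Phase d)))
  calc ∫⁻ w, ENNReal.ofReal (lyap β a b (w.1 - w.2))
        ∂((ρ s : Measure (Phase d)).prod (ρ' s : Measure (Phase d)))
      ≤ ∫⁻ w, ENNReal.ofReal (c₂ * (2 * sqNorm w.1 + 2 * sqNorm w.2))
        ∂((ρ s : Measure (Phase d)).prod (ρ' s : Measure (Phase d))) := by
        refine lintegral_mono fun w => ENNReal.ofReal_le_ofReal ((hL.lyap_le _).trans ?_)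
        gcongr
        exact sqNorm_sub_le _ _
    _ = ENNReal.ofReal (c₂ * (2 * ∫ x, sqNorm x ∂(ρ s : Measure (Phase d))
          + 2 * ∫ x, sqNorm x ∂(ρ' s : Measure (Phase d)))) := by
        have j3 : Integrable (fun w : Phase d × Phase d => c₂ * (2 * sqNorm w.1 + 2 * sqNorm w.2))
            ((ρ s : Measure (Phase d)).prod (ρ' s : Measure (Phase d))) :=
          ((j1.const_mul 2).add (j2.const_mul 2)).const_mul c₂
        rw [← ofReal_integral_eq_lintegral_ofReal j3
          (ae_of_all _ fun w => mul_nonneg hc2.le (by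
            have := sqNorm_nonneg w.1
            have := sqNorm_nonneg w.2
            positivity)), integral_const_mul,
          integral_add (j1.const_mul 2) (j2.const_mul 2), integral_const_mul, integral_const_mul,
          integral_fun_fst, integral_fun_snd]
        simp
    _ ≤ _ := by
        refine ENNReal.ofReal_le_ofReal ?_
        rw [mul_assoc (c₂ * _), ← Real.exp_add]
        have e1 : 1 ≤ Real.exp (γ / 2 * T + -(γ / 2) * s) := by
          rw [Real.one_le_exp_iff]
          have := mul_nonneg hL.γ_pos.le (sub_nonneg.2 hs.2)
          linarith
        refine le_trans ?_ (le_mul_of_one_le_right (by positivity) e1)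
        have := hRb s hs
        have := hRb' s hs
        gcongr

/-- One round bounds the mean fields by the present cost bound `v'` and re-runs the coupling from
the same initial coupling, which replaces `v'` by `r + v' / 2`. The fixed point of this map is `2
r`, and the deviation from it is halved each time. -/
lemma IsLyapunov.exists_coupling_iterate (hL : IsLyapunov α β lam a b c₁ c₂ γ η h₀ K)
    (hc : IsCoeff α β lam C_A C_B A B) (hη : C_A + C_B ≤ η)
    (hsmall : 2 * K / γ * (C_B ^ 2 / c₁) ≤ 1 / 2) {ρ ρ' : ℝ → ProbabilityMeasure (Phase d)}
    (h : IsSolution α β lam A B ρ) (h' : IsSolution α β lam A B ρ') {T r v : ℝ}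
    (hr : 0 ≤ r) {π₀ : Measure (Phase d × Phase d)} (hπ₀ : IsCoupling π₀ (ρ 0) (ρ' 0))
    (hr₀ : ∫⁻ w, ENNReal.ofReal (lyap β a b (w.1 - w.2)) ∂π₀ ≤ ENNReal.ofReal r) (hv : 0 ≤ v)
    (hv₀ : ∀ s ∈ Icc 0 T, ∃ π, IsCoupling π (ρ s) (ρ' s) ∧
      ∫⁻ w, ENNReal.ofReal (lyap β a b (w.1 - w.2)) ∂π ≤
        ENNReal.ofReal (v * Real.exp (-(γ / 2) * s))) (n : ℕ) :
    ∀ s ∈ Icc 0 T, ∃ π, IsCoupling π (ρ s) (ρ' s) ∧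
      ∫⁻ w, ENNReal.ofReal (lyap β a b (w.1 - w.2)) ∂π ≤
        ENNReal.ofReal ((2 * r + v * (1 / 2) ^ n) * Real.exp (-(γ / 2) * s)) := by
  induction n with
  | zero =>
    intro s hs
    obtain ⟨π, hπ, hle⟩ := hv₀ s hs
    refine ⟨π, hπ, hle.trans (ENNReal.ofReal_le_ofReal ?_)⟩
    gcongr
    rw [pow_zero]
    linarith
  | succ n ih =>
    intro s hs
    set v' := 2 * r + v * (1 / 2) ^ n with hv'
    have hv'0 : 0 ≤ v' := by positivity
    have e : 2 * r + v * (1 / 2) ^ (n + 1) = r + 1 / 2 * v' := by rw [hv', pow_succ]; ring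
    rw [e]
    rcases hs.1.eq_or_lt with h0 | h0
    · subst h0
      refine ⟨π₀, hπ₀, hr₀.trans (ENNReal.ofReal_le_ofReal ?_)⟩
      simp only [mul_zero, Real.exp_zero, mul_one]
      linarith
    · have hc1 := hL.c₁_pos
      obtain ⟨π, hπ, hle⟩ := hL.exists_coupling_le hc hη h h' h0 (V := C_B ^ 2 / c₁ * v')
        (by positivity) hr (fun u hu q => by
          obtain ⟨π, hπ, hle⟩ := ih u ⟨hu.1, hu.2.trans hs.2⟩
          rw [mul_assoc]
          exact hL.sq_norm_meanField_sub_le hc (h.secondMoment u hu.1) (h'.secondMoment u hu.1) hπ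
            (by positivity) hle q) hπ₀ hr₀
      refine ⟨π, hπ, hle.trans (ENNReal.ofReal_le_ofReal ?_)⟩
      refine mul_le_mul_of_nonneg_right ?_ (Real.exp_nonneg _)
      rw [← mul_assoc]
      gcongr

/-- The transport cost between `μ` and `ν` for the cost function `c (x - y)`. -/
noncomputable def transportCost (c : Phase d → ℝ) (μ ν : ProbabilityMeasure (Phase d)) : ℝ≥0∞ :=
  ⨅ (π : Measure (Phase d × Phase d)) (_ : IsCoupling π μ ν),
    ∫⁻ w, ENNReal.ofReal (c (w.1 - w.2)) ∂π

lemma transportCost_le {c : Phase d → ℝ} {μ ν : ProbabilityMeasure (Phase d)}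
    {π : Measure (Phase d × Phase d)} (hπ : IsCoupling π μ ν) :
    transportCost c μ ν ≤ ∫⁻ w, ENNReal.ofReal (c (w.1 - w.2)) ∂π :=
  iInf₂_le π hπ

lemma transportCost_le_mul {c c' : Phase d → ℝ} {r : ℝ} (hr : 0 < r) (h : ∀ x, c x ≤ r * c' x)
    (μ ν : ProbabilityMeasure (Phase d)) :
    transportCost c μ ν ≤ ENNReal.ofReal r * transportCost c' μ ν := by
  have h0 : ENNReal.ofReal r ≠ 0 := by simpa using hr
  simp only [transportCost, ENNReal.mul_iInf_of_ne h0 ENNReal.ofReal_ne_top]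
  refine iInf₂_mono fun π _ => ?_
  rw [← lintegral_const_mul' _ _ ENNReal.ofReal_ne_top]
  refine lintegral_mono fun w => ?_
  rw [← ENNReal.ofReal_mul hr.le]
  exact ENNReal.ofReal_le_ofReal (h _)

/-- Exponential contraction in the transport cost of the Lyapunov form. -/
lemma IsLyapunov.transportCost_lyap_le (hL : IsLyapunov α β lam a b c₁ c₂ γ η h₀ K)
    (hc : IsCoeff α β lam C_A C_B A B) (hη : C_A + C_B ≤ η)
    (hsmall : 2 * K / γ * (C_B ^ 2 / c₁) ≤ 1 / 2) {ρ ρ' : ℝ → ProbabilityMeasure (Phase d)}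
    (h : IsSolution α β lam A B ρ) (h' : IsSolution α β lam A B ρ') {t : ℝ} (ht : 0 ≤ t) :
    transportCost (lyap β a b) (ρ t) (ρ' t) ≤
      ENNReal.ofReal (2 * Real.exp (-(γ / 2) * t)) * transportCost (lyap β a b) (ρ 0) (ρ' 0) := by
  have hpos : 0 < 2 * Real.exp (-(γ / 2) * t) := by positivity
  have h0 : ENNReal.ofReal (2 * Real.exp (-(γ / 2) * t)) ≠ 0 := by simpa using hpos
  conv_rhs => rw [transportCost]
  simp only [ENNReal.mul_iInf_of_ne h0 ENNReal.ofReal_ne_top]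
  refine le_iInf₂ fun π₀ hπ₀ => ?_
  by_cases htop : ∫⁻ w, ENNReal.ofReal (lyap β a b (w.1 - w.2)) ∂π₀ = ⊤
  · rw [htop, ENNReal.mul_top h0]
    exact le_top
  set r := (∫⁻ w, ENNReal.ofReal (lyap β a b (w.1 - w.2)) ∂π₀).toReal with hr
  have hr₀ : ∫⁻ w, ENNReal.ofReal (lyap β a b (w.1 - w.2)) ∂π₀ = ENNReal.ofReal r :=
    (ENNReal.ofReal_toReal htop).symm
  have hr0 : 0 ≤ r := ENNReal.toReal_nonneg
  -- The constant `v` depends on `t` and on the two solutions, which is harmless: `t` stays fixed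
  -- while `(1 / 2) ^ n` removes `v`.
  obtain ⟨v, hv, hv₀⟩ := hL.exists_apriori hc h h' ht
  have key : ∀ n : ℕ, transportCost (lyap β a b) (ρ t) (ρ' t) ≤
      ENNReal.ofReal ((2 * r + v * (1 / 2) ^ n) * Real.exp (-(γ / 2) * t)) := fun n => by
    obtain ⟨π, hπ, hle⟩ := hL.exists_coupling_iterate hc hη hsmall h h' hr0 hπ₀ hr₀.le hv hv₀ n t
      ⟨ht, le_rfl⟩
    exact (transportCost_le hπ).trans hle
  have lim : Tendsto (fun n : ℕ =>
      ENNReal.ofReal ((2 * r + v * (1 / 2) ^ n) * Real.exp (-(γ / 2) * t))) atTop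
      (𝓝 (ENNReal.ofReal ((2 * r + v * 0) * Real.exp (-(γ / 2) * t)))) := by
    refine ENNReal.tendsto_ofReal (((tendsto_const_nhds).add (Tendsto.const_mul v ?_)).mul_const _)
    exact tendsto_pow_atTop_nhds_zero_of_lt_one (by norm_num) (by norm_num)
  refine (ge_of_tendsto' lim key).trans (le_of_eq ?_)
  rw [hr₀, ← ENNReal.ofReal_mul hpos.le]
  congr 1
  ring

/-- Exponential contraction in the Wasserstein distance. -/
lemma IsLyapunov.W2_le (hL : IsLyapunov α β lam a b c₁ c₂ γ η h₀ K)
    (hc : IsCoeff α β lam C_A C_B A B) (hη : C_A + C_B ≤ η)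
    (hsmall : 2 * K / γ * (C_B ^ 2 / c₁) ≤ 1 / 2) {ρ ρ' : ℝ → ProbabilityMeasure (Phase d)}
    (h : IsSolution α β lam A B ρ) (h' : IsSolution α β lam A B ρ') {t : ℝ} (ht : 0 ≤ t) :
    W2 (ρ t) (ρ' t) ≤
      ENNReal.ofReal (√(2 * c₂ / c₁) * Real.exp (-(γ / 4) * t)) * W2 (ρ 0) (ρ' 0) := by
  have hc1 := hL.c₁_pos
  have hc2 := hL.c₂_pos
  have h1 : transportCost sqNorm (ρ t) (ρ' t) ≤
      ENNReal.ofReal (2 * c₂ / c₁ * Real.exp (-(γ / 2) * t)) *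
        transportCost sqNorm (ρ 0) (ρ' 0) := by
    calc transportCost sqNorm (ρ t) (ρ' t)
        ≤ ENNReal.ofReal c₁⁻¹ * transportCost (lyap β a b) (ρ t) (ρ' t) :=
          transportCost_le_mul (by positivity) (fun x => by
            rw [← div_eq_inv_mul, le_div_iff₀' hc1]
            exact hL.le_lyap x) _ _
      _ ≤ ENNReal.ofReal c₁⁻¹ * (ENNReal.ofReal (2 * Real.exp (-(γ / 2) * t)) *
            (ENNReal.ofReal c₂ * transportCost sqNorm (ρ 0) (ρ' 0))) := by
          gcongr
          refine (hL.transportCost_lyap_le hc hη hsmall h h' ht).trans ?_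
          gcongr
          exact transportCost_le_mul hc2 hL.lyap_le _ _
      _ = _ := by
          rw [← mul_assoc, ← mul_assoc, ← ENNReal.ofReal_mul (by positivity),
            ← ENNReal.ofReal_mul (by positivity)]
          congr 2
          field_simp
  have h2 : W2 (ρ t) (ρ' t) ≤ (ENNReal.ofReal (2 * c₂ / c₁ * Real.exp (-(γ / 2) * t)) *
        transportCost sqNorm (ρ 0) (ρ' 0)) ^ (1 / 2 : ℝ) :=
    ENNReal.rpow_le_rpow h1 (by norm_num)
  refine h2.trans (le_of_eq ?_)
  rw [ENNReal.mul_rpow_of_nonneg _ _ (by norm_num), ENNReal.ofReal_rpow_of_nonneg (by positivity)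
    (by norm_num), ← Real.sqrt_eq_rpow, Real.sqrt_mul (by positivity)]
  have e : √(Real.exp (-(γ / 2) * t)) = Real.exp (-(γ / 4) * t) := by
    rw [Real.sqrt_eq_iff_mul_self_eq (by positivity) (by positivity), ← Real.exp_add]
    congr 1
    ring
  rw [e]
  rfl

end Contraction

/-! ### The nonlinear Euler scheme and its almost fixed points. -/

section NonlinearScheme

open Filter Topology

variable {d : ℕ} {α β lam C_A C_B : ℝ} {A B : Vec d → Vec d} {a b c₁ c₂ γ η h₀ K : ℝ}

lemma lyap_zDir (i : Fin d) : lyap β a b (zDir i : Phase d) = 1 := by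
  simp [lyap, zDir]

/-- The noise adds `2 d τ` to the mean value of the Lyapunov form. -/
lemma avg_lyap_add_noiseVec {τ : ℝ} (hτ : 0 ≤ τ) (y : Phase d) :
    (Fintype.card (Option (Fin d × Bool)) : ℝ)⁻¹ * ∑ j, lyap β a b (y + noiseVec zDir τ j) =
      lyap β a b y + 2 * d * τ := by
  rw [card_option_prod_bool, sum_option_prod_bool, Fintype.card_fin]
  set r := √((2 * (d : ℝ) + 1) * τ) with hr
  have hr2 : r ^ 2 = (2 * (d : ℝ) + 1) * τ := Real.sq_sqrt (by positivity)
  have h : ∀ i : Fin d, lyap β a b (y + noiseVec zDir τ (some (i, true)))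
      + lyap β a b (y + noiseVec zDir τ (some (i, false))) =
      2 * lyap β a b y + 2 * ((2 * (d : ℝ) + 1) * τ) := fun i => by
    simp only [noiseVec, Fintype.card_fin, ← hr]
    rw [← neg_smul, lyap_add, lyap_add, lyap_smul, lyap_smul, lyapBilin_smul_right,
      lyapBilin_smul_right, lyap_zDir, neg_sq, hr2]
    ring
  rw [Finset.sum_congr rfl fun i _ => h i]
  simp only [noiseVec, add_zero, Finset.sum_const, Finset.card_univ, Fintype.card_fin, nsmul_eq_mul]
  field_simp
  ring

/-- The forces are compared with their size at the origin: their Lipschitz part in position falls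
under `η`, while `A 0`, `B 0` and the first moment of the law form the defect `δ`. The noise adds `2
d τ`. -/
lemma IsLyapunov.avg_lyap_eulerStep_le (hL : IsLyapunov α β lam a b c₁ c₂ γ η h₀ K)
    (hc : IsCoeff α β lam C_A C_B A B) (hη : C_A + C_B ≤ η) {τ : ℝ} (hτ : 0 ≤ τ) (hτh : τ ≤ h₀)
    {μ : ProbabilityMeasure (Phase d)} (hμ : Integrable (fun x => ‖x‖) (μ : Measure (Phase d)))
    (x : Phase d) :
    (Fintype.card (Option (Fin d × Bool)) : ℝ)⁻¹ *
      ∑ j, lyap β a b (eulerStep zDir τ (drift α β lam A B μ) j x) ≤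
      (1 - γ * τ) * lyap β a b x + τ * (K * (‖A 0‖ + ‖B 0‖ +
        C_B * ∫ y, ‖y‖ ∂(μ : Measure (Phase d))) ^ 2 + 2 * d) := by
  have e : drift α β lam A B μ x =
      linDrift α β lam x + (0, -(A x.1 + meanField B μ x.1), 0) := by
    refine Prod.ext ?_ (Prod.ext ?_ ?_)
    · simp [drift, linDrift]
    · simp only [drift, linDrift, Prod.snd_add, Prod.fst_add]
      abel
    · simp [drift, linDrift]
  simp only [eulerStep]
  rw [avg_lyap_add_noiseVec hτ, e]
  set m := ∫ y, ‖y‖ ∂(μ : Measure (Phase d)) with hm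
  have hm0 : 0 ≤ m := integral_nonneg fun _ => norm_nonneg _
  have hCB := hc.CB_nonneg
  have h1 := hL.step x (-(A x.1 + meanField B μ x.1)) τ (‖A 0‖ + ‖B 0‖ + C_B * m) hτ hτh
    (by positivity) (by
      rw [norm_neg]
      have h2 := norm_meanField_le hCB hc.lipB hμ x.1
      have h3 := hc.lipA x.1 0
      rw [sub_zero] at h3
      have h4 := norm_sub_norm_le (A x.1) (A 0)
      have h5 := mul_le_mul_of_nonneg_right hη (norm_nonneg x.1)
      refine (norm_add_le _ _).trans ?_
      rw [← hm] at h2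
      linarith)
  linarith

/-- Laws whose Lyapunov moment is at most `M`. -/
def HasLyapMoment (β a b M : ℝ) (μ : ProbabilityMeasure (Phase d)) : Prop :=
  ∫⁻ x, ENNReal.ofReal (lyap β a b x) ∂(μ : Measure (Phase d)) ≤ ENNReal.ofReal M

lemma IsLyapunov.lintegral_sqNorm_le (hL : IsLyapunov α β lam a b c₁ c₂ γ η h₀ K) {M : ℝ}
    {μ : ProbabilityMeasure (Phase d)} (h : HasLyapMoment β a b M μ) :
    ∫⁻ x, ENNReal.ofReal (sqNorm x) ∂(μ : Measure (Phase d)) ≤ ENNReal.ofReal (M / c₁) := by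
  have hc1 := hL.c₁_pos
  calc ∫⁻ x, ENNReal.ofReal (sqNorm x) ∂(μ : Measure (Phase d))
      ≤ ∫⁻ x, ENNReal.ofReal c₁⁻¹ * ENNReal.ofReal (lyap β a b x) ∂(μ : Measure (Phase d)) := by
        refine lintegral_mono fun x => ?_
        rw [← ENNReal.ofReal_mul (by positivity)]
        refine ENNReal.ofReal_le_ofReal ?_
        rw [← div_eq_inv_mul, le_div_iff₀' hc1]
        exact hL.le_lyap x
    _ = ENNReal.ofReal c₁⁻¹ * ∫⁻ x, ENNReal.ofReal (lyap β a b x) ∂(μ : Measure (Phase d)) :=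
        lintegral_const_mul' _ _ ENNReal.ofReal_ne_top
    _ ≤ ENNReal.ofReal c₁⁻¹ * ENNReal.ofReal M := by
        gcongr
        exact h
    _ = ENNReal.ofReal (M / c₁) := by
        rw [← ENNReal.ofReal_mul (by positivity), div_eq_inv_mul]

lemma IsLyapunov.finiteSecondMoment (hL : IsLyapunov α β lam a b c₁ c₂ γ η h₀ K) {M : ℝ}
    {μ : ProbabilityMeasure (Phase d)} (h : HasLyapMoment β a b M μ) : FiniteSecondMoment μ :=
  (hL.lintegral_sqNorm_le h).trans_lt ENNReal.ofReal_lt_top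

lemma IsLyapunov.integral_sqNorm_le (hL : IsLyapunov α β lam a b c₁ c₂ γ η h₀ K) {M : ℝ}
    (hM : 0 ≤ M) {μ : ProbabilityMeasure (Phase d)} (h : HasLyapMoment β a b M μ) :
    ∫ x, sqNorm x ∂(μ : Measure (Phase d)) ≤ M / c₁ := by
  have h1 := hL.lintegral_sqNorm_le h
  rw [← ofReal_integral_eq_lintegral_ofReal (hL.finiteSecondMoment h).integrable
    (ae_of_all _ sqNorm_nonneg)] at h1
  exact (ENNReal.ofReal_le_ofReal_iff (div_nonneg hM hL.c₁_pos.le)).1 h1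

lemma sq_integral_norm_le {μ : ProbabilityMeasure (Phase d)} (h : FiniteSecondMoment μ) :
    (∫ x, ‖x‖ ∂(μ : Measure (Phase d))) ^ 2 ≤ ∫ x, sqNorm x ∂(μ : Measure (Phase d)) := by
  have h2 : Integrable (fun x => ‖x‖ ^ 2) (μ : Measure (Phase d)) := by
    refine h.integrable.mono' (by fun_prop) (ae_of_all _ fun x => ?_)
    rw [Real.norm_of_nonneg (sq_nonneg _)]
    exact norm_sq_le_sqNorm x
  exact (sq_integral_le (Integrable.norm_of_sqNorm h.integrable) h2).trans
    (integral_mono h2 h.integrable norm_sq_le_sqNorm)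

/-- The one-step laws stay in a set of laws with bounded Lyapunov moment. -/
lemma IsLyapunov.exists_step_law (hL : IsLyapunov α β lam a b c₁ c₂ γ η h₀ K)
    (hc : IsCoeff α β lam C_A C_B A B) (hη : C_A + C_B ≤ η)
    (hsmall : 2 * K / γ * (C_B ^ 2 / c₁) ≤ 1 / 2) {M τ : ℝ}
    (hM : M = 2 * (2 * K * (‖A 0‖ + ‖B 0‖) ^ 2 + 2 * d) / γ) (hτ : 0 ≤ τ) (hτh : τ ≤ h₀)
    {μ : ProbabilityMeasure (Phase d)} (hμ : HasLyapMoment β a b M μ) :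
    ∃ ν : ProbabilityMeasure (Phase d), HasLyapMoment β a b M ν ∧
      (ν : Measure (Phase d)) = avgMap (eulerStep zDir τ (drift α β lam A B μ)) μ := by
  have hγ := hL.γ_pos
  have hK := hL.K_pos
  have hc1 := hL.c₁_pos
  have hM0 : 0 ≤ M := by rw [hM]; positivity
  have h2 := hL.finiteSecondMoment hμ
  have hn := Integrable.norm_of_sqNorm h2.integrable
  have hmeas := fun j => (continuous_eulerStep zDir τ (hc.continuous_drift hn) j).measurable
  have h1 : γ * τ ≤ 1 := (mul_le_mul_of_nonneg_left hτh hL.γ_pos.le).trans hL.mul_le_one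
  refine ⟨⟨_, isProbabilityMeasure_avgMap hmeas (μ : Measure (Phase d))⟩, ?_, rfl⟩
  refine (lintegral_avgMap_le hmeas (μ : Measure (Phase d)) (continuous_lyap β a b).measurable
    hL.nonneg (continuous_lyap β a b).measurable (by linarith) (by positivity) hM0 hL.nonneg
    (hL.avg_lyap_eulerStep_le hc hη hτ hτh hn) hμ).trans (ENNReal.ofReal_le_ofReal ?_)
  have h3 := (sq_integral_norm_le h2).trans (hL.integral_sqNorm_le hM0 hμ)
  set m := ∫ x, ‖x‖ ∂(μ : Measure (Phase d)) with hm
  set s := ‖A 0‖ + ‖B 0‖ with hs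
  -- `M` is the fixed point of the resulting moment recursion: by smallness of `C_B`, half of `γ M`
  -- pays for the dependence of the drift on the law, and the other half equals `2 K s² + 2 d`.
  have h4 : K * (s + C_B * m) ^ 2 ≤ 2 * K * s ^ 2 + γ / 2 * M := by
    have e1 : (s + C_B * m) ^ 2 ≤ 2 * s ^ 2 + 2 * (C_B ^ 2 * m ^ 2) := by
      nlinarith [sq_nonneg (s - C_B * m)]
    have e2 : C_B ^ 2 * m ^ 2 ≤ C_B ^ 2 * (M / c₁) := mul_le_mul_of_nonneg_left h3 (sq_nonneg _)
    have e3 : 2 * K * (C_B ^ 2 * (M / c₁)) = γ * (2 * K / γ * (C_B ^ 2 / c₁)) * M := by field_simp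
    have e4 : γ * (2 * K / γ * (C_B ^ 2 / c₁)) * M ≤ γ * (1 / 2) * M := by gcongr
    have e5 := mul_le_mul_of_nonneg_left e1 hK.le
    have e6 := mul_le_mul_of_nonneg_left e2 hK.le
    linarith
  have h5 : γ * M = 2 * (2 * K * s ^ 2 + 2 * d) := by rw [hM]; field_simp
  have h6 := mul_le_mul_of_nonneg_left h4 hτ
  have h7 : τ * (γ * M) = τ * (2 * (2 * K * s ^ 2 + 2 * d)) := by rw [h5]
  linarith

/-- Here each drift follows its own law, so the defect is controlled by the cost of the present
coupling. By smallness this feedback uses at most `γ / 2` of the rate `γ`. -/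
lemma IsLyapunov.exists_coupling_step (hL : IsLyapunov α β lam a b c₁ c₂ γ η h₀ K)
    (hc : IsCoeff α β lam C_A C_B A B) (hη : C_A + C_B ≤ η)
    (hsmall : 2 * K / γ * (C_B ^ 2 / c₁) ≤ 1 / 2) {τ V : ℝ} (hτ : 0 ≤ τ) (hτh : τ ≤ h₀)
    {μ ν μ' ν' : ProbabilityMeasure (Phase d)} (hμ : FiniteSecondMoment μ)
    (hν : FiniteSecondMoment ν)
    (hμ' : (μ' : Measure (Phase d)) = avgMap (eulerStep zDir τ (drift α β lam A B μ)) μ)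
    (hν' : (ν' : Measure (Phase d)) = avgMap (eulerStep zDir τ (drift α β lam A B ν)) ν)
    (hV : 0 ≤ V) (h : ∃ π, IsCoupling π μ ν ∧
      ∫⁻ w, ENNReal.ofReal (lyap β a b (w.1 - w.2)) ∂π ≤ ENNReal.ofReal V) :
    ∃ π, IsCoupling π μ' ν' ∧ ∫⁻ w, ENNReal.ofReal (lyap β a b (w.1 - w.2)) ∂π ≤
      ENNReal.ofReal ((1 - γ / 2 * τ) * V) := by
  obtain ⟨π, hπ, hle⟩ := h
  have := hπ.isProbabilityMeasure
  have hγ := hL.γ_pos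
  have hK := hL.K_pos
  have hc1 := hL.c₁_pos
  have nμ := Integrable.norm_of_sqNorm hμ.integrable
  have nν := Integrable.norm_of_sqNorm hν.integrable
  have bμ := hc.continuous_drift nμ
  have bν := hc.continuous_drift nν
  refine ⟨coupledStep zDir τ (drift α β lam A B μ) (drift α β lam A B ν) π, ⟨?_, ?_⟩, ?_⟩
  · rw [coupledStep_map_fst bμ bν, hπ.1, hμ']
  · rw [coupledStep_map_snd bμ bν, hπ.2, hν']
  · have hd0 : 0 ≤ C_B ^ 2 / c₁ * V := by positivity
    refine (hL.lintegral_coupledStep_le hc hη hτ hτh nμ nν (δ := √(C_B ^ 2 / c₁ * V))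
      (fun q => Real.le_sqrt_of_sq_le (hL.sq_norm_meanField_sub_le hc hμ hν hπ hV hle q)) hV π
      hle).trans (ENNReal.ofReal_le_ofReal ?_)
    rw [Real.sq_sqrt hd0]
    have e1 : K * (C_B ^ 2 / c₁ * V) = γ / 2 * (2 * K / γ * (C_B ^ 2 / c₁)) * V := by field_simp
    have e2 : γ / 2 * (2 * K / γ * (C_B ^ 2 / c₁)) * V ≤ γ / 2 * (1 / 2) * V := by gcongr
    have e3 : τ * (K * (C_B ^ 2 / c₁ * V)) ≤ τ * (γ / 2 * V) := by
      refine mul_le_mul_of_nonneg_left ?_ hτ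
      have : 0 ≤ γ / 2 * V := by positivity
      linarith
    linarith

lemma IsLyapunov.exists_coupling_cost (hL : IsLyapunov α β lam a b c₁ c₂ γ η h₀ K)
    {μ ν : ProbabilityMeasure (Phase d)} (hμ : FiniteSecondMoment μ) (hν : FiniteSecondMoment ν) :
    ∃ v, 0 ≤ v ∧ ∃ π, IsCoupling π μ ν ∧
      ∫⁻ w, ENNReal.ofReal (lyap β a b (w.1 - w.2)) ∂π ≤ ENNReal.ofReal v := by
  have hi := (isCoupling_prod μ ν).integrable_sqNorm_sub hμ hν
  have hc2 := hL.c₂_pos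
  refine ⟨_, ?_, _, isCoupling_prod μ ν, (lintegral_mono fun w => ENNReal.ofReal_le_ofReal
    (hL.lyap_le _)).trans (ofReal_integral_eq_lintegral_ofReal (hi.const_mul c₂)
    (ae_of_all _ fun w => mul_nonneg hc2.le (sqNorm_nonneg _))).symm.le⟩
  exact integral_nonneg fun w => mul_nonneg hc2.le (sqNorm_nonneg _)

/-- The nonlinear Euler scheme has almost fixed points. -/
lemma IsLyapunov.exists_almost_fixed (hL : IsLyapunov α β lam a b c₁ c₂ γ η h₀ K)
    (hc : IsCoeff α β lam C_A C_B A B) (hη : C_A + C_B ≤ η)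
    (hsmall : 2 * K / γ * (C_B ^ 2 / c₁) ≤ 1 / 2) {M τ ε : ℝ}
    (hM : M = 2 * (2 * K * (‖A 0‖ + ‖B 0‖) ^ 2 + 2 * d) / γ) (hτ : 0 < τ) (hτh : τ ≤ h₀)
    (hε : 0 < ε) : ∃ μ ν : ProbabilityMeasure (Phase d), HasLyapMoment β a b M μ ∧
      (ν : Measure (Phase d)) = avgMap (eulerStep zDir τ (drift α β lam A B μ)) μ ∧
      HasLyapMoment β a b M ν ∧ ∃ π, IsCoupling π μ ν ∧
      ∫⁻ w, ENNReal.ofReal (lyap β a b (w.1 - w.2)) ∂π ≤ ENNReal.ofReal ε := by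
  have hstep : ∀ μ : {μ : ProbabilityMeasure (Phase d) // HasLyapMoment β a b M μ},
      ∃ ν : {μ : ProbabilityMeasure (Phase d) // HasLyapMoment β a b M μ},
      (ν.1 : Measure (Phase d)) = avgMap (eulerStep zDir τ (drift α β lam A B μ.1)) μ.1 := fun μ => by
    obtain ⟨ν, h1, h2⟩ := hL.exists_step_law hc hη hsmall hM hτ.le hτh μ.2
    exact ⟨⟨ν, h1⟩, h2⟩
  choose Φ hΦ using hstep
  have h0 : HasLyapMoment β a b M (⟨Measure.dirac (0 : Phase d), inferInstance⟩ :
      ProbabilityMeasure (Phase d)) := by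
    change ∫⁻ x, ENNReal.ofReal (lyap β a b x) ∂(Measure.dirac (0 : Phase d)) ≤ _
    rw [lintegral_dirac' _ (continuous_lyap β a b).measurable.ennreal_ofReal]
    simp [lyap]
  set u : ℕ → {μ : ProbabilityMeasure (Phase d) // HasLyapMoment β a b M μ} :=
    fun n => Φ^[n] ⟨_, h0⟩ with hu
  have hus : ∀ n, u (n + 1) = Φ (u n) := fun n => Function.iterate_succ_apply' Φ n _
  have fsm : ∀ n, FiniteSecondMoment (u n).1 := fun n => hL.finiteSecondMoment (u n).2
  obtain ⟨v, hv, hv0⟩ := hL.exists_coupling_cost (fsm 0) (fsm 1)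
  have hq0 : 0 ≤ 1 - γ / 2 * τ := by
    have := (mul_le_mul_of_nonneg_left hτh hL.γ_pos.le).trans hL.mul_le_one
    have := mul_pos hL.γ_pos hτ
    linarith
  have hq1 : 1 - γ / 2 * τ < 1 := by
    have := mul_pos hL.γ_pos hτ
    linarith
  -- The cost between consecutive iterates decays geometrically, so some finite iterate is already
  -- almost fixed. No limit of the iterates is taken.
  have key : ∀ n, ∃ π, IsCoupling π (u n).1 (u (n + 1)).1 ∧
      ∫⁻ w, ENNReal.ofReal (lyap β a b (w.1 - w.2)) ∂π ≤
        ENNReal.ofReal ((1 - γ / 2 * τ) ^ n * v) := by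
    intro n
    induction n with
    | zero => simpa using hv0
    | succ n ih =>
      rw [pow_succ', mul_assoc]
      exact hL.exists_coupling_step hc hη hsmall hτ.le hτh (fsm n) (fsm (n + 1))
        (by rw [hus n]; exact hΦ _) (by rw [hus (n + 1)]; exact hΦ _) (by positivity) ih
  have lim : Tendsto (fun n : ℕ => (1 - γ / 2 * τ) ^ n * v) atTop (𝓝 (0 * v)) :=
    (tendsto_pow_atTop_nhds_zero_of_lt_one hq0 hq1).mul_const v
  rw [zero_mul] at lim
  obtain ⟨n, hn⟩ := (lim.eventually_lt_const hε).exists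
  obtain ⟨π, hπ, hle⟩ := key n
  exact ⟨(u n).1, (u (n + 1)).1, (u n).2, by rw [hus n]; exact hΦ _, (u (n + 1)).2, π, hπ,
    hle.trans (ENNReal.ofReal_le_ofReal hn.le)⟩

end NonlinearScheme

/-! ### Quantitative bounds for test functions. -/

section TestFunctions

variable {E : Type*} [NormedAddCommGroup E] [NormedSpace ℝ E] {ι : Type*} [Fintype ι]

/-- Quantitative bounds for a test function and its derivatives. -/
structure IsTestBound (e : ι → E) (φ : E → ℝ) (D : ℝ) : Prop where
  hasBoundedDerivs : HasBoundedDerivs e φ D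
  abs_le : ∀ x, |φ x| ≤ D
  hessian_lipschitz : ∀ i x y,
    |dirDeriv (e i) (dirDeriv (e i) φ) x - dirDeriv (e i) (dirDeriv (e i) φ) y| ≤ D * ‖x - y‖
  gradient_lipschitz : ∀ v x y, |dirDeriv v φ x - dirDeriv v φ y| ≤ D * ‖v‖ * ‖x - y‖

lemma exists_norm_sub_le_of_hasCompactSupport {F : Type*} [NormedAddCommGroup F] [NormedSpace ℝ F]
    {f : E → F} (hf : HasCompactSupport f) (h : ContDiff ℝ (⊤ : ℕ∞) f) :
    ∃ C, 0 ≤ C ∧ ∀ x y, ‖f x - f y‖ ≤ C * ‖x - y‖ := by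
  obtain ⟨C, hC⟩ := ContDiff.lipschitzWith_of_hasCompactSupport hf h (by simp)
  exact ⟨C, C.2, fun x y => by simpa [dist_eq_norm] using hC.dist_le_mul x y⟩

lemma exists_isTestBound (e : ι → E) {φ : E → ℝ} (hφ : ContDiff ℝ (⊤ : ℕ∞) φ)
    (hφc : HasCompactSupport φ) : ∃ D, IsTestBound e φ D := by
  have hD2 : ∀ i, ContDiff ℝ (⊤ : ℕ∞) (dirDeriv (e i) (dirDeriv (e i) φ)) := fun i =>
    contDiff_dirDeriv (contDiff_dirDeriv hφ _) _
  have hD2c : ∀ i, HasCompactSupport (dirDeriv (e i) (dirDeriv (e i) φ)) := fun i =>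
    hasCompactSupport_dirDeriv (hasCompactSupport_dirDeriv hφc _) _
  obtain ⟨C0, h0⟩ := hφ.continuous.bounded_above_of_compact_support hφc
  obtain ⟨C1, h1⟩ := (hφ.continuous_fderiv (by simp)).bounded_above_of_compact_support
    (hφc.fderiv (𝕜 := ℝ))
  obtain ⟨C2, hC2, h2⟩ := exists_norm_sub_le_of_hasCompactSupport (hφc.fderiv (𝕜 := ℝ))
    (hφ.fderiv_right (m := (⊤ : ℕ∞)) (by simp))
  choose C3 hC3 h3 using fun i => exists_norm_sub_le_of_hasCompactSupport (hD2c i) (hD2 i)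
  choose C4 h4 using fun i => (hD2 i).continuous.bounded_above_of_compact_support (hD2c i)
  have hC0 : 0 ≤ C0 := (norm_nonneg _).trans (h0 0)
  have hC1 : 0 ≤ C1 := (norm_nonneg _).trans (h1 0)
  have hC4 : ∀ i, 0 ≤ C4 i := fun i => (norm_nonneg _).trans (h4 i 0)
  have hS3 : 0 ≤ ∑ i, C3 i := Finset.sum_nonneg fun i _ => hC3 i
  have hS4 : 0 ≤ ∑ i, C4 i := Finset.sum_nonneg fun i _ => hC4 i
  obtain ⟨D, hD0, hD1, hD2, hD3, hD4⟩ : ∃ D, C0 ≤ D ∧ C1 ≤ D ∧ C2 ≤ D ∧ ∑ i, C3 i ≤ D ∧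
      ∑ i, C4 i ≤ D :=
    ⟨C0 + C1 + C2 + ∑ i, C3 i + ∑ i, C4 i, by linarith, by linarith, by linarith, by linarith,
      by linarith⟩
  refine ⟨D, ⟨hφ, fun v x => ?_, fun x => ?_⟩, fun x => (h0 x).trans hD0,
    fun i x y => ?_, fun v x y => ?_⟩
  · exact ((fderiv ℝ φ x).le_opNorm v).trans
      (mul_le_mul_of_nonneg_right ((h1 x).trans hD1) (norm_nonneg v))
  · exact (Finset.abs_sum_le_sum_abs _ _).trans ((Finset.sum_le_sum fun i _ => h4 i x).trans hD4)
  · exact (h3 i x y).trans (mul_le_mul_of_nonneg_right ((Finset.single_le_sum (f := C3)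
      (fun i _ => hC3 i) (Finset.mem_univ i)).trans hD3) (norm_nonneg _))
  · have e1 : dirDeriv v φ x - dirDeriv v φ y = (fderiv ℝ φ x - fderiv ℝ φ y) v := rfl
    rw [e1]
    refine ((fderiv ℝ φ x - fderiv ℝ φ y).le_opNorm v).trans ?_
    refine (mul_le_mul_of_nonneg_right (h2 x y) (norm_nonneg v)).trans ?_
    rw [mul_right_comm]
    exact mul_le_mul_of_nonneg_right (mul_le_mul_of_nonneg_right hD2 (norm_nonneg v))
      (norm_nonneg _)

lemma IsTestBound.lipschitz {e : ι → E} {φ : E → ℝ} {D : ℝ} (h : IsTestBound e φ D) (x y : E) :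
    |φ x - φ y| ≤ D * ‖x - y‖ :=
  lipschitz_of_abs_dirDeriv_le h.hasBoundedDerivs.differentiable h.hasBoundedDerivs.abs_dirDeriv_le
    x y

end TestFunctions

/-! ### Convergence of integrals, tightness, and definiteness of `W2`. -/

section Limit

open Filter Topology

/-- Narrow convergence and bounded second moments imply convergence of integrals. -/
lemma tendsto_integral_of_sq_le {X : Type*} [TopologicalSpace X] [MeasurableSpace X]
    [OpensMeasurableSpace X] {π : ℕ → ProbabilityMeasure X} {π' : ProbabilityMeasure X}
    (h : Tendsto π atTop (𝓝 π')) {G : X → ℝ} (hG : Continuous G) {S : ℝ}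
    (hi : ∀ n, Integrable (fun x => G x ^ 2) (π n : Measure X))
    (hS : ∀ n, ∫ x, G x ^ 2 ∂(π n : Measure X) ≤ S)
    (hi' : Integrable (fun x => G x ^ 2) (π' : Measure X))
    (hS' : ∫ x, G x ^ 2 ∂(π' : Measure X) ≤ S) :
    Tendsto (fun n => ∫ x, G x ∂(π n : Measure X)) atTop (𝓝 (∫ x, G x ∂(π' : Measure X))) := by
  have hS0 : 0 ≤ S := (integral_nonneg fun x => sq_nonneg _).trans hS'
  -- Truncation at level `R` changes `G` by at most `G ^ 2 / R`, so the error is uniform over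
  -- measures with the given second moment of `G`.
  have trunc : ∀ (R : ℝ), 0 < R → ∀ m : ProbabilityMeasure X,
      Integrable (fun x => G x ^ 2) (m : Measure X) → ∫ x, G x ^ 2 ∂(m : Measure X) ≤ S →
      |∫ x, G x ∂(m : Measure X) - ∫ x, max (-R) (min R (G x)) ∂(m : Measure X)| ≤ S / R := by
    intro R hR m hm hmS
    have j1 : Integrable G (m : Measure X) := by
      refine ((integrable_const (1 : ℝ)).add hm).mono' hG.aestronglyMeasurable
        (ae_of_all _ fun x => ?_)
      rw [Pi.add_apply, Real.norm_eq_abs]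
      nlinarith [sq_nonneg (|G x| - 1), sq_abs (G x)]
    have j2 : Integrable (fun x => max (-R) (min R (G x))) (m : Measure X) := by
      refine (integrable_const R).mono' (by fun_prop) (ae_of_all _ fun x => ?_)
      rw [Real.norm_eq_abs, abs_le]
      exact ⟨le_max_left _ _, max_le (by linarith) (min_le_left _ _)⟩
    rw [← integral_sub j1 j2, ← Real.norm_eq_abs]
    refine (norm_integral_le_of_norm_le (hm.div_const R) (ae_of_all _ fun x => ?_)).trans ?_
    · rw [Real.norm_eq_abs, le_div_iff₀ hR]
      rcases le_total R (G x) with h1 | h1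
      · rw [min_eq_left h1, max_eq_right (by linarith), abs_of_nonneg (by linarith)]
        nlinarith
      · rw [min_eq_right h1]
        rcases le_total (-R) (G x) with h2 | h2
        · rw [max_eq_right h2, sub_self, abs_zero, zero_mul]
          exact sq_nonneg _
        · rw [max_eq_left h2, abs_of_nonpos (by linarith)]
          nlinarith
    · rw [integral_div]
      gcongr
  rw [Metric.tendsto_atTop]
  intro ε hε
  obtain ⟨R, hR, hRε⟩ : ∃ R > 0, S / R ≤ ε / 4 := by
    refine ⟨4 * (S + 1) / ε, by positivity, ?_⟩
    rw [div_le_iff₀ (by positivity)]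
    field_simp
    linarith
  let g : BoundedContinuousFunction X ℝ := BoundedContinuousFunction.ofNormedAddCommGroup
    (fun x => max (-R) (min R (G x))) (by fun_prop) R fun x => by
      rw [Real.norm_eq_abs, abs_le]
      exact ⟨le_max_left _ _, max_le (by linarith) (min_le_left _ _)⟩
  have hg := (ProbabilityMeasure.tendsto_iff_forall_integral_tendsto.1 h) g
  obtain ⟨N, hN⟩ := (Metric.tendsto_atTop.1 hg) (ε / 4) (by positivity)
  refine ⟨N, fun n hn => ?_⟩
  have h1 := abs_le.1 (trunc R hR (π n) (hi n) (hS n))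
  have h2 := abs_le.1 (trunc R hR π' hi' hS')
  have h3 := hN n hn
  rw [Real.dist_eq] at h3 ⊢
  have h4 := abs_lt.1 h3
  change -(ε / 4) < ∫ x, max (-R) (min R (G x)) ∂(π n : Measure X)
    - ∫ x, max (-R) (min R (G x)) ∂(π' : Measure X) ∧
    ∫ x, max (-R) (min R (G x)) ∂(π n : Measure X)
    - ∫ x, max (-R) (min R (G x)) ∂(π' : Measure X) < ε / 4 at h4
  rw [abs_lt]
  constructor <;> linarith [h1.1, h1.2, h2.1, h2.2, h4.1, h4.2]

variable {d : ℕ}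

lemma abs_integral_sub_le_of_coupling {μ ν : ProbabilityMeasure (Phase d)}
    {π : Measure (Phase d × Phase d)} (hπ : IsCoupling π μ ν) {f : Phase d → ℝ} {Λ C r : ℝ}
    (hΛ : 0 ≤ Λ) (hf : ∀ x y, |f x - f y| ≤ Λ * ‖x - y‖) (hC : ∀ x, |f x| ≤ C) (hr : 0 ≤ r)
    (h : ∫⁻ w, ENNReal.ofReal (sqNorm (w.1 - w.2)) ∂π ≤ ENNReal.ofReal r) :
    |∫ x, f x ∂(μ : Measure (Phase d)) - ∫ x, f x ∂(ν : Measure (Phase d))| ≤ Λ * √r := by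
  have := hπ.isProbabilityMeasure
  have hfc := continuous_of_abs_sub_le hΛ hf
  have hi : Integrable (fun w : Phase d × Phase d => sqNorm (w.1 - w.2)) π := by
    refine ⟨(continuous_sqNorm.comp (continuous_fst.sub continuous_snd)).aestronglyMeasurable, ?_⟩
    rw [hasFiniteIntegral_iff_ofReal (ae_of_all _ fun w => sqNorm_nonneg _)]
    exact h.trans_lt ENNReal.ofReal_lt_top
  have hn2 : Integrable (fun w : Phase d × Phase d => ‖w.1 - w.2‖ ^ 2) π := by
    refine hi.mono' (Continuous.aestronglyMeasurable (by fun_prop)) (ae_of_all _ fun w => ?_)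
    rw [Real.norm_of_nonneg (sq_nonneg _)]
    exact norm_sq_le_sqNorm _
  have hn : Integrable (fun w : Phase d × Phase d => ‖w.1 - w.2‖) π := by
    refine ((integrable_const (1 : ℝ)).add hn2).mono'
      (Continuous.aestronglyMeasurable (by fun_prop)) (ae_of_all _ fun w => ?_)
    rw [norm_norm, Pi.add_apply]
    nlinarith [sq_nonneg (‖w.1 - w.2‖ - 1)]
  have e1 : ∫ x, f x ∂(μ : Measure (Phase d)) = ∫ w, f w.1 ∂π := by
    rw [← hπ.1, integral_map measurable_fst.aemeasurable hfc.aestronglyMeasurable]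
  have e2 : ∫ x, f x ∂(ν : Measure (Phase d)) = ∫ w, f w.2 ∂π := by
    rw [← hπ.2, integral_map measurable_snd.aemeasurable hfc.aestronglyMeasurable]
  have j1 : Integrable (fun w : Phase d × Phase d => f w.1) π :=
    (integrable_const C).mono' (hfc.comp continuous_fst).aestronglyMeasurable
      (ae_of_all _ fun w => hC _)
  have j2 : Integrable (fun w : Phase d × Phase d => f w.2) π :=
    (integrable_const C).mono' (hfc.comp continuous_snd).aestronglyMeasurable
      (ae_of_all _ fun w => hC _)
  rw [e1, e2, ← integral_sub j1 j2, ← Real.norm_eq_abs]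
  refine (norm_integral_le_of_norm_le (hn.const_mul Λ) (ae_of_all _ fun w => hf _ _)).trans ?_
  rw [integral_const_mul]
  refine mul_le_mul_of_nonneg_left (Real.le_sqrt_of_sq_le ?_) hΛ
  refine (sq_integral_le hn hn2).trans ((integral_mono hn2 hi fun w => norm_sq_le_sqNorm _).trans ?_)
  rw [← ofReal_integral_eq_lintegral_ofReal hi (ae_of_all _ fun w => sqNorm_nonneg _)] at h
  exact (ENNReal.ofReal_le_ofReal_iff hr).1 h

lemma isTightMeasureSet_of_lintegral_sqNorm_le (R : ℝ) {S : Set (ProbabilityMeasure (Phase d))}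
    (h : ∀ μ ∈ S, ∫⁻ x, ENNReal.ofReal (sqNorm x) ∂(μ : Measure (Phase d)) ≤ ENNReal.ofReal R) :
    IsTightMeasureSet {((μ : ProbabilityMeasure (Phase d)) : Measure (Phase d)) | μ ∈ S} := by
  refine isTightMeasureSet_of_tendsto_measure_norm_gt ?_
  have lim : Tendsto (fun r : ℝ => ENNReal.ofReal (R * (r ^ 2)⁻¹)) atTop (𝓝 0) := by
    have h1 : Tendsto (fun r : ℝ => R * (r ^ 2)⁻¹) atTop (𝓝 (R * 0)) :=
      ((tendsto_pow_atTop two_ne_zero).inv_tendsto_atTop).const_mul R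
    rw [mul_zero] at h1
    simpa using ENNReal.tendsto_ofReal h1
  refine tendsto_of_tendsto_of_tendsto_of_le_of_le' tendsto_const_nhds lim
    (Eventually.of_forall fun _ => zero_le) ?_
  filter_upwards [eventually_gt_atTop 0] with r hr
  refine iSup₂_le ?_
  rintro _ ⟨μ, hμ, rfl⟩
  have hr2 : ENNReal.ofReal (r ^ 2) ≠ 0 := by
    have : 0 < r ^ 2 := by positivity
    simpa using this.ne'
  rw [ENNReal.ofReal_mul' (by positivity), ENNReal.ofReal_inv_of_pos (by positivity),
    ← div_eq_mul_inv, ENNReal.le_div_iff_mul_le (Or.inl hr2) (Or.inl ENNReal.ofReal_ne_top), mul_comm]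
  refine le_trans ?_ (h μ hμ)
  refine le_trans ?_ (mul_meas_ge_le_lintegral continuous_sqNorm.measurable.ennreal_ofReal
    (ENNReal.ofReal (r ^ 2)))
  gcongr
  intro hx
  exact ENNReal.ofReal_le_ofReal
    ((pow_le_pow_left₀ hr.le (le_of_lt hx) 2).trans (norm_sq_le_sqNorm _))

/-- Couplings of arbitrarily small cost suffice, with no need for an optimal one: they show that
bounded Lipschitz functions have equal integrals. These test narrow convergence, so the constant
sequence `μ` converges to `ν`. -/
lemma eq_of_W2_eq_zero {μ ν : ProbabilityMeasure (Phase d)} (h : W2 μ ν = 0) : μ = ν := by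
  have h1 : transportCost sqNorm μ ν = 0 := by
    have := (ENNReal.rpow_eq_zero_iff_of_pos (by norm_num : (0 : ℝ) < 1 / 2)).1 h
    exact this
  have key : ∀ f : Phase d → ℝ, (∃ C : ℝ, ∀ x y, dist (f x) (f y) ≤ C) → (∃ L, LipschitzWith L f) →
      ∫ x, f x ∂(μ : Measure (Phase d)) = ∫ x, f x ∂(ν : Measure (Phase d)) := by
    rintro f ⟨C, hC⟩ ⟨L, hL⟩
    have hb : ∀ x, |f x| ≤ |f 0| + C := fun x => by
      have h2 := hC x 0
      rw [Real.dist_eq] at h2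
      have := abs_sub_abs_le_abs_sub (f x) (f 0)
      linarith
    have hl : ∀ x y, |f x - f y| ≤ L * ‖x - y‖ := fun x y => by
      simpa [dist_eq_norm] using hL.dist_le_mul x y
    have bound : ∀ r > 0, |∫ x, f x ∂(μ : Measure (Phase d)) - ∫ x, f x ∂(ν : Measure (Phase d))|
        ≤ L * √r := by
      intro r hr
      have h3 : transportCost sqNorm μ ν < ENNReal.ofReal r := by
        rw [h1]
        exact ENNReal.ofReal_pos.2 hr
      simp only [transportCost, iInf_lt_iff] at h3
      obtain ⟨π, hπ, hlt⟩ := h3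
      exact abs_integral_sub_le_of_coupling hπ L.2 hl hb hr.le hlt.le
    have lim : Tendsto (fun r : ℝ => L * √r) (𝓝[>] 0) (𝓝 (L * √0)) :=
      ((continuous_const.mul Real.continuous_sqrt).tendsto 0).mono_left nhdsWithin_le_nhds
    rw [Real.sqrt_zero, mul_zero] at lim
    have h4 := ge_of_tendsto lim (Filter.eventually_of_mem self_mem_nhdsWithin bound)
    exact sub_eq_zero.1 (abs_eq_zero.1 (le_antisymm h4 (abs_nonneg _)))
  have t : Tendsto (fun _ : ℕ => μ) atTop (𝓝 ν) := by
    rw [tendsto_iff_forall_lipschitz_integral_tendsto]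
    intro f h2 h3
    rw [key f h2 h3]
    exact tendsto_const_nhds
  exact tendsto_nhds_unique tendsto_const_nhds t

end Limit

/-! ### Existence of a stationary solution. -/

section Stationary

open Filter Topology

variable {d : ℕ} {α β lam C_A C_B : ℝ} {A B : Vec d → Vec d} {a b c₁ c₂ γ η h₀ K : ℝ}

lemma tendsto_prod_self {X : Type*} [TopologicalSpace X] [SecondCountableTopology X]
    [TopologicalSpace.PseudoMetrizableSpace X] [MeasurableSpace X] [BorelSpace X]
    {μ : ℕ → ProbabilityMeasure X} {m : ProbabilityMeasure X} (h : Tendsto μ atTop (𝓝 m)) :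
    Tendsto (fun n => (μ n).prod (μ n)) atTop (𝓝 (m.prod m)) :=
  (ProbabilityMeasure.continuous_prod.tendsto (m, m)).comp (h.prodMk_nhds h)

/-- The drift without the mean-field force. -/
noncomputable def freeDrift (α β lam : ℝ) (A : Vec d → Vec d) (x : Phase d) : Phase d :=
  (x.2.1, -(β • x.1 + A x.1 - lam • x.2.2), -(lam • x.2.1 + α • x.2.2))

/-- The free drift is the case of zero kernel, so the earlier growth and continuity bounds apply to
it. -/
lemma drift_zero_kernel (μ : ProbabilityMeasure (Phase d)) :
    drift α β lam A (fun _ => 0) μ = freeDrift α β lam A := by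
  ext1 x
  simp [drift, freeDrift, meanField]

lemma drift_eq_freeDrift_sub (μ : ProbabilityMeasure (Phase d)) (x : Phase d) :
    drift α β lam A B μ x = freeDrift α β lam A x - (0, meanField B μ x.1, 0) := by
  simp only [drift, freeDrift, Prod.mk_sub_mk, sub_zero]
  congr 2
  abel

lemma IsCoeff.freeDrift_bound (hc : IsCoeff α β lam C_A C_B A B) :
    Continuous (freeDrift α β lam A) ∧ ∃ S, 0 ≤ S ∧ ∀ x, ‖freeDrift α β lam A x‖ ≤ S * (1 + ‖x‖) := by
  set μ : ProbabilityMeasure (Phase d) := ⟨Measure.dirac 0, inferInstance⟩ with hμ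
  have hi : Integrable (fun x => ‖x‖) (μ : Measure (Phase d)) :=
    integrable_dirac (by simp)
  have hB : ∀ q₁ q₂ : Vec d, ‖(fun _ => (0 : Vec d)) q₁ - (fun _ => (0 : Vec d)) q₂‖ ≤
      (0 : ℝ) * ‖q₁ - q₂‖ := fun _ _ => by simp
  have h1 := hc.α_nonneg
  have h2 := hc.β_nonneg
  have h3 := hc.lam_nonneg
  have h4 := hc.CA_nonneg
  rw [← drift_zero_kernel μ]
  refine ⟨GenVlasov.continuous_drift h1 h2 h3 h4 le_rfl hc.lipA hB hi,
    1 + α + β + 2 * lam + C_A + 0 + ‖A 0‖ + ‖(0 : Vec d)‖, ?_, fun x =>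
    (norm_drift_le h1 h2 h3 h4 le_rfl hc.lipA hB hi x).trans (le_of_eq ?_)⟩
  · positivity
  · have : ∫ y, ‖y‖ ∂(μ : Measure (Phase d)) = 0 := by
      change ∫ y, ‖y‖ ∂(Measure.dirac (0 : Phase d)) = 0
      simp
    simp only [this, add_zero]

/-- The generator as a function of two particles. -/
noncomputable def pairGen (α β lam : ℝ) (A B : Vec d → Vec d) (φ : Phase d → ℝ)
    (w : Phase d × Phase d) : ℝ :=
  fpOp zDir (freeDrift α β lam A) φ w.1 - dirDeriv (0, B (w.1.1 - w.2.1), 0) φ w.1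

lemma IsCoeff.continuous_pairGen (hc : IsCoeff α β lam C_A C_B A B) {φ : Phase d → ℝ}
    (hφ : ContDiff ℝ (⊤ : ℕ∞) φ) : Continuous (pairGen α β lam A B φ) := by
  have hB := continuous_of_norm_sub_le hc.lipB
  have h1 := (continuous_fpOp zDir hc.freeDrift_bound.1 hφ).comp
    (continuous_fst : Continuous fun w : Phase d × Phase d => w.1)
  have h2 : Continuous fun w : Phase d × Phase d =>
      fderiv ℝ φ w.1 ((0, B (w.1.1 - w.2.1), 0) : Phase d) :=
    ((hφ.continuous_fderiv (by simp)).comp continuous_fst).clm_apply (by fun_prop)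
  exact h1.sub h2

lemma IsCoeff.exists_abs_pairGen_le (hc : IsCoeff α β lam C_A C_B A B) {φ : Phase d → ℝ} {D : ℝ}
    (hφ : HasBoundedDerivs zDir φ D) :
    ∃ C, 0 ≤ C ∧ ∀ w, |pairGen α β lam A B φ w| ≤ C * (1 + ‖w.1‖ + ‖w.2‖) := by
  obtain ⟨-, S, hS, hSb⟩ := hc.freeDrift_bound
  have hD := hφ.nonneg
  have hCB := hc.CB_nonneg
  refine ⟨D * (1 + S) + D * (‖B 0‖ + C_B), by positivity, fun w => ?_⟩
  have h1 := hφ.abs_fpOp_le (freeDrift α β lam A) w.1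
  have h2 := hφ.abs_dirDeriv_le (0, B (w.1.1 - w.2.1), 0) w.1
  have h3 : ‖((0, B (w.1.1 - w.2.1), 0) : Phase d)‖ = ‖B (w.1.1 - w.2.1)‖ := by
    simp [Prod.norm_mk]
  rw [h3] at h2
  have h4 : ‖B (w.1.1 - w.2.1)‖ ≤ (‖B 0‖ + C_B) * (1 + ‖w.1‖ + ‖w.2‖) := by
    have h5 := norm_kernel_le hCB hc.lipB w.1.1 w.2
    have h6 := mul_le_mul_of_nonneg_left (norm_fst_le w.1) hCB
    have h7 : 0 ≤ ‖B 0‖ * (‖w.1‖ + ‖w.2‖) := by positivity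
    linarith
  have h8 : 1 + ‖freeDrift α β lam A w.1‖ ≤ (1 + S) * (1 + ‖w.1‖ + ‖w.2‖) := by
    have h9 := hSb w.1
    have h10 : 0 ≤ S * ‖w.2‖ := by positivity
    linarith [norm_nonneg w.1, norm_nonneg w.2]
  refine (abs_sub _ _).trans ?_
  have h11 := h1.trans (mul_le_mul_of_nonneg_left h8 hD)
  have h12 := h2.trans (mul_le_mul_of_nonneg_left h4 hD)
  linarith

/-- The derivative of `φ` in momentum directions is a continuous linear functional, hence it passes
under the integral that defines the mean field. -/
lemma IsCoeff.generator_eq_integral (hc : IsCoeff α β lam C_A C_B A B) {φ : Phase d → ℝ}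
    (hφ : ContDiff ℝ (⊤ : ℕ∞) φ) {μ : ProbabilityMeasure (Phase d)}
    (hμ : Integrable (fun x => ‖x‖) (μ : Measure (Phase d))) (x : Phase d) :
    generator α β lam A B μ φ x = ∫ y, pairGen α β lam A B φ (x, y) ∂(μ : Measure (Phase d)) := by
  set L : Vec d →L[ℝ] ℝ := (fderiv ℝ φ x).comp ((ContinuousLinearMap.inr ℝ (Vec d) (Vec d × Vec d)).comp
    (ContinuousLinearMap.inl ℝ (Vec d) (Vec d))) with hLdef
  have hL : ∀ v : Vec d, dirDeriv ((0, v, 0) : Phase d) φ x = L v := fun v => rfl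
  have hi := integrable_kernel hc.CB_nonneg hc.lipB hμ x.1
  have e1 : dirDeriv (drift α β lam A B μ x) φ x =
      dirDeriv (freeDrift α β lam A x) φ x - L (meanField B μ x.1) := by
    rw [drift_eq_freeDrift_sub, ← hL]
    simp only [dirDeriv, map_sub]
  rw [generator_eq_fpOp _ _ _ _ _ _ hφ]
  simp only [pairGen, hL]
  rw [integral_sub (integrable_const _) (L.integrable_comp hi), L.integral_comp_comm hi,
    integral_const, probReal_univ, one_smul, fpOp, fpOp, e1]
  change _ - L (∫ y : Phase d, B (x.1 - y.1) ∂(μ : Measure (Phase d))) + _ = _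
  ring

lemma IsCoeff.pairGen_sq (hc : IsCoeff α β lam C_A C_B A B) {φ : Phase d → ℝ}
    {C : ℝ} (hφ : ContDiff ℝ (⊤ : ℕ∞) φ)
    (hC : ∀ w, |pairGen α β lam A B φ w| ≤ C * (1 + ‖w.1‖ + ‖w.2‖))
    {μ : ProbabilityMeasure (Phase d)} (hμ : FiniteSecondMoment μ) {R : ℝ}
    (hR : ∫ x, sqNorm x ∂(μ : Measure (Phase d)) ≤ R) :
    Integrable (fun w => pairGen α β lam A B φ w ^ 2) (μ.prod μ : Measure (Phase d × Phase d)) ∧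
    ∫ w, pairGen α β lam A B φ w ^ 2 ∂(μ.prod μ : Measure (Phase d × Phase d)) ≤
      3 * C ^ 2 * (1 + R + R) := by
  have i1 := hμ.integrable.comp_fst (ν := (μ : Measure (Phase d)))
  have i2 := hμ.integrable.comp_snd (μ := (μ : Measure (Phase d)))
  have hb : ∀ w : Phase d × Phase d, pairGen α β lam A B φ w ^ 2 ≤
      3 * C ^ 2 * (1 + sqNorm w.1 + sqNorm w.2) := fun w => by
    have h1 := pow_le_pow_left₀ (abs_nonneg _) (hC w) 2
    rw [sq_abs, mul_pow] at h1
    have h2 : (1 + ‖w.1‖ + ‖w.2‖) ^ 2 ≤ 3 * (1 + sqNorm w.1 + sqNorm w.2) := by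
      have := norm_sq_le_sqNorm w.1
      have := norm_sq_le_sqNorm w.2
      nlinarith [sq_nonneg (1 - ‖w.1‖), sq_nonneg (1 - ‖w.2‖), sq_nonneg (‖w.1‖ - ‖w.2‖)]
    have h3 := mul_le_mul_of_nonneg_left h2 (sq_nonneg C)
    linarith
  have i3 : Integrable (fun w : Phase d × Phase d => 3 * C ^ 2 * (1 + sqNorm w.1 + sqNorm w.2))
      (μ.prod μ : Measure (Phase d × Phase d)) :=
    (((integrable_const (1 : ℝ)).add i1).add i2).const_mul _
  have i4 : Integrable (fun w => pairGen α β lam A B φ w ^ 2)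
      (μ.prod μ : Measure (Phase d × Phase d)) :=
    i3.mono' ((hc.continuous_pairGen hφ).pow 2).aestronglyMeasurable (ae_of_all _ fun w => by
      rw [Real.norm_of_nonneg (sq_nonneg _)]
      exact hb w)
  refine ⟨i4, (integral_mono i4 i3 hb).trans ?_⟩
  have e1 : ∫ w : Phase d × Phase d, (1 + sqNorm w.1 + sqNorm w.2)
      ∂((μ : Measure (Phase d)).prod (μ : Measure (Phase d))) =
      1 + ∫ x, sqNorm x ∂(μ : Measure (Phase d)) + ∫ x, sqNorm x ∂(μ : Measure (Phase d)) := by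
    have j : Integrable (fun w : Phase d × Phase d => 1 + sqNorm w.1)
      ((μ : Measure (Phase d)).prod (μ : Measure (Phase d))) := (integrable_const (1 : ℝ)).add i1
    rw [integral_add j i2, integral_add (integrable_const _) i1, integral_fun_fst,
      integral_fun_snd]
    simp
  rw [integral_const_mul, ProbabilityMeasure.toMeasure_prod, e1]
  gcongr

lemma integrable_of_integrable_sq {X : Type*} [MeasurableSpace X] {m : Measure X}
    [IsFiniteMeasure m] {f : X → ℝ} (hf : AEStronglyMeasurable f m)
    (h : Integrable (fun x => f x ^ 2) m) : Integrable f m := by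
  refine ((integrable_const (1 : ℝ)).add h).mono' hf (ae_of_all _ fun x => ?_)
  rw [Pi.add_apply, Real.norm_eq_abs]
  nlinarith [sq_nonneg (|f x| - 1), sq_abs (f x)]

/-- The nonlinear dependence on `μ` becomes integration of a fixed continuous function of linear
growth against `μ.prod μ`, a form stable under narrow convergence with bounded second moments. -/
lemma IsCoeff.integral_generator_eq (hc : IsCoeff α β lam C_A C_B A B) {φ : Phase d → ℝ}
    (hφ : ContDiff ℝ (⊤ : ℕ∞) φ) {D : ℝ} (hD : HasBoundedDerivs zDir φ D)
    {μ : ProbabilityMeasure (Phase d)} (hμ : FiniteSecondMoment μ) :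
    ∫ x, generator α β lam A B μ φ x ∂(μ : Measure (Phase d)) =
      ∫ w, pairGen α β lam A B φ w ∂(μ.prod μ : Measure (Phase d × Phase d)) := by
  obtain ⟨C, -, hC⟩ := hc.exists_abs_pairGen_le (B := B) hD
  have h1 := (hc.pairGen_sq hφ hC hμ le_rfl).1
  have h2 := integrable_of_integrable_sq (hc.continuous_pairGen hφ).aestronglyMeasurable h1
  rw [ProbabilityMeasure.toMeasure_prod] at h2 ⊢
  rw [integral_prod _ h2]
  exact integral_congr_ae (ae_of_all _ fun x =>
    hc.generator_eq_integral hφ (Integrable.norm_of_sqNorm hμ.integrable) x)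

/-- Almost fixed points of the nonlinear scheme are almost stationary. -/
lemma IsLyapunov.exists_abs_integral_generator_le (hL : IsLyapunov α β lam a b c₁ c₂ γ η h₀ K)
    (hc : IsCoeff α β lam C_A C_B A B) {M : ℝ} (hM : 0 ≤ M) {φ : Phase d → ℝ}
    (hφ : ContDiff ℝ (⊤ : ℕ∞) φ) (hφc : HasCompactSupport φ) :
    ∃ C, ∀ τ : ℝ, 0 < τ → τ ≤ 1 → ∀ μ ν : ProbabilityMeasure (Phase d), HasLyapMoment β a b M μ →
      (ν : Measure (Phase d)) = avgMap (eulerStep zDir τ (drift α β lam A B μ)) μ →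
      (∃ π, IsCoupling π μ ν ∧
        ∫⁻ w, ENNReal.ofReal (lyap β a b (w.1 - w.2)) ∂π ≤ ENNReal.ofReal (τ ^ 4)) →
      |∫ x, generator α β lam A B μ φ x ∂(μ : Measure (Phase d))| ≤ C * √τ := by
  obtain ⟨D, hD⟩ := exists_isTestBound (zDir : Fin d → Phase d) hφ hφc
  have hc1 := hL.c₁_pos
  have hD0 := hD.hasBoundedDerivs.nonneg
  have h1 := hc.α_nonneg
  have h2 := hc.β_nonneg
  have h3 := hc.lam_nonneg
  have h4 := hc.CA_nonneg
  have h5 := hc.CB_nonneg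
  -- The first moment of any admissible law is at most `1 + M / c₁`, so `S` is a growth constant of
  -- the drift that does not depend on the law or on `τ`.
  obtain ⟨S, hS, hSdef⟩ : ∃ S, 0 ≤ S ∧ S = (1 + α + β + 2 * lam + C_A + C_B + ‖A 0‖ + ‖B 0‖) *
    (2 + M / c₁) := ⟨_, by positivity, rfl⟩
  obtain ⟨Q, hQ, hQdef⟩ : ∃ Q, 0 ≤ Q ∧ Q = 2 * √(2 * Fintype.card (Fin d) + 1) *
      (∑ i, ‖(zDir i : Phase d)‖) * (∑ _i : Fin d, D) + S * (∑ _i : Fin d, D) + D * S ^ 2 :=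
    ⟨_, by positivity, rfl⟩
  refine ⟨Q * (2 * (1 + M / c₁)) + D / √c₁, fun τ hτ hτ1 μ ν hμ hν ⟨π, hπ, hle⟩ => ?_⟩
  have hμ2 := hL.finiteSecondMoment hμ
  have hμn := Integrable.norm_of_sqNorm hμ2.integrable
  have hsq := hL.integral_sqNorm_le hM hμ
  have hbc := hc.continuous_drift hμn
  have hm1 : ∫ y, ‖y‖ ∂(μ : Measure (Phase d)) ≤ 1 + M / c₁ := by
    have := (sq_integral_norm_le hμ2).trans hsq
    nlinarith [sq_nonneg (∫ y, ‖y‖ ∂(μ : Measure (Phase d)) - 1)]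
  have hbS : ∀ x, ‖drift α β lam A B μ x‖ ≤ S * (1 + ‖x‖) := fun x => by
    refine (norm_drift_le h1 h2 h3 h4 h5 hc.lipA hc.lipB hμn x).trans ?_
    rw [hSdef, mul_assoc]
    refine mul_le_mul_of_nonneg_left ?_ (by positivity)
    have : 0 ≤ M / c₁ := by positivity
    have hx := norm_nonneg x
    nlinarith
  have cons := abs_eulerOp_sub_sub_le (e := zDir) (τ := τ) hφ (H := fun _ => D) (G := D)
    (fun _ => hD0) hD0 hS hτ.le hτ1 hD.hessian_lipschitz hD.gradient_lipschitz hbS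
  rw [← hQdef] at cons
  have hφi : Integrable φ (μ : Measure (Phase d)) :=
    (integrable_const D).mono' hφ.continuous.aestronglyMeasurable (ae_of_all _ hD.abs_le)
  have hEi : Integrable (eulerOp zDir τ (drift α β lam A B μ) φ) (μ : Measure (Phase d)) :=
    (integrable_const D).mono' (continuous_eulerOp _ _ hbc hφ.continuous).aestronglyMeasurable
      (ae_of_all _ fun x => abs_eulerOp_le _ _ _ hD.abs_le x)
  have hGi : Integrable (fpOp zDir (drift α β lam A B μ) φ) (μ : Measure (Phase d)) :=
    integrable_of_abs_le_linear hμn (continuous_fpOp zDir hbc hφ) (A := D * (1 + S)) (B := D * S)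
      fun x => by
        refine (hD.hasBoundedDerivs.abs_fpOp_le _ x).trans ?_
        have := mul_le_mul_of_nonneg_left (hbS x) hD0
        linarith
  have hνE : ∫ x, φ x ∂(ν : Measure (Phase d)) =
      ∫ x, eulerOp zDir τ (drift α β lam A B μ) φ x ∂(μ : Measure (Phase d)) := by
    have ij : ∀ j, Integrable (fun x => φ (eulerStep zDir τ (drift α β lam A B μ) j x))
        (μ : Measure (Phase d)) := fun j =>
      (integrable_const D).mono'
        (hφ.continuous.comp (continuous_eulerStep zDir τ hbc j)).aestronglyMeasurable
        (ae_of_all _ fun x => hD.abs_le _)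
    rw [hν, integral_avgMap (fun j => (continuous_eulerStep zDir τ hbc j).measurable) _
      hφ.continuous.stronglyMeasurable ij]
    simp only [eulerOp]
    rw [integral_const_mul, integral_finsetSum _ fun j _ => ij j]
  -- A quadratic cost `τ ^ 4` means a difference of order `τ ^ 2`, which still vanishes after
  -- division by `τ`.
  have hclose : |∫ x, φ x ∂(μ : Measure (Phase d)) - ∫ x, φ x ∂(ν : Measure (Phase d))| ≤
      D * √(τ ^ 4 / c₁) := by
    refine abs_integral_sub_le_of_coupling hπ hD0 hD.lipschitz hD.abs_le (by positivity) ?_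
    calc ∫⁻ w, ENNReal.ofReal (sqNorm (w.1 - w.2)) ∂π
        ≤ ∫⁻ w, ENNReal.ofReal c₁⁻¹ * ENNReal.ofReal (lyap β a b (w.1 - w.2)) ∂π := by
          refine lintegral_mono fun w => ?_
          rw [← ENNReal.ofReal_mul (by positivity)]
          refine ENNReal.ofReal_le_ofReal ?_
          rw [← div_eq_inv_mul, le_div_iff₀' hc1]
          exact hL.le_lyap _
      _ = ENNReal.ofReal c₁⁻¹ * ∫⁻ w, ENNReal.ofReal (lyap β a b (w.1 - w.2)) ∂π :=
          lintegral_const_mul' _ _ ENNReal.ofReal_ne_top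
      _ ≤ ENNReal.ofReal c₁⁻¹ * ENNReal.ofReal (τ ^ 4) := by gcongr
      _ = ENNReal.ofReal (τ ^ 4 / c₁) := by
          rw [← ENNReal.ofReal_mul (by positivity), div_eq_inv_mul]
  have e2 : √(τ ^ 4 / c₁) = τ ^ 2 / √c₁ := by
    rw [Real.sqrt_div (by positivity)]
    congr 1
    rw [show τ ^ 4 = (τ ^ 2) ^ 2 by ring, Real.sqrt_sq (by positivity)]
  have hloc : |∫ x, (eulerOp zDir τ (drift α β lam A B μ) φ x - φ x
      - τ * fpOp zDir (drift α β lam A B μ) φ x) ∂(μ : Measure (Phase d))| ≤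
      τ * (√τ * (Q * (2 * (1 + M / c₁)))) := by
    rw [← Real.norm_eq_abs]
    refine (norm_integral_le_of_norm_le
      ((((integrable_const (1 : ℝ)).add hμ2.integrable).const_mul (τ * (√τ * (Q * 2)))))
      (ae_of_all _ fun x => ?_)).trans ?_
    · refine (cons x).trans ?_
      simp only [Pi.add_apply]
      calc τ * (√τ * (Q * (1 + ‖x‖) ^ 2)) ≤ τ * (√τ * (Q * (2 * (1 + sqNorm x)))) := by
            have := one_add_norm_sq_le x
            gcongr
        _ = _ := by ring
    · rw [integral_const_mul, integral_add' (integrable_const _) hμ2.integrable]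
      simp only [integral_const, probReal_univ, one_smul]
      calc τ * (√τ * (Q * 2)) * (1 + ∫ x, sqNorm x ∂(μ : Measure (Phase d)))
          ≤ τ * (√τ * (Q * 2)) * (1 + M / c₁) := by gcongr
        _ = _ := by ring
  have hEφ : Integrable (fun x => eulerOp zDir τ (drift α β lam A B μ) φ x - φ x)
    (μ : Measure (Phase d)) := hEi.sub hφi
  rw [integral_sub hEφ (hGi.const_mul τ), integral_sub hEi hφi, integral_const_mul,
    ← hνE] at hloc
  simp only [generator_eq_fpOp α β lam A B μ hφ]
  have h3 : τ ≤ √τ := Real.le_sqrt_of_sq_le (by nlinarith)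
  have h6 : D * √(τ ^ 4 / c₁) ≤ τ * (√τ * (D / √c₁)) := by
    rw [e2]
    calc D * (τ ^ 2 / √c₁) = τ * (τ * (D / √c₁)) := by ring
      _ ≤ _ := by gcongr
  set I := ∫ x, fpOp zDir (drift α β lam A B μ) φ x ∂(μ : Measure (Phase d)) with hI
  have hgoal : τ * |I| ≤ τ * ((Q * (2 * (1 + M / c₁)) + D / √c₁) * √τ) := by
    rw [← abs_of_pos hτ, ← abs_mul, abs_of_pos hτ]
    have l1 := abs_le.1 hloc
    have l2 := abs_le.1 (hclose.trans h6)
    rw [abs_le]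
    constructor <;> linarith [l1.1, l1.2, l2.1, l2.2]
  exact le_of_mul_le_mul_left hgoal hτ

lemma isStationary_of_integral_generator_eq_zero {μ : ProbabilityMeasure (Phase d)}
    (hμ : FiniteSecondMoment μ) (h : ∀ φ : Phase d → ℝ, ContDiff ℝ (⊤ : ℕ∞) φ →
      HasCompactSupport φ → ∫ x, generator α β lam A B μ φ x ∂(μ : Measure (Phase d)) = 0) :
    IsStationary α β lam A B μ where
  secondMoment _ _ := hμ
  narrowlyContinuous := continuousOn_const
  integrable_coeff T _ := by
    have h1 : ∫⁻ x, ‖x‖ₑ ∂(μ : Measure (Phase d)) < ⊤ := by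
      simpa [HasFiniteIntegral] using (Integrable.norm_of_sqNorm hμ.integrable).hasFiniteIntegral
    rw [lintegral_const]
    exact ENNReal.mul_lt_top h1 (by simp)
  weak_integrable φ hφ hφc t _ := by
    simp only [h φ hφ hφc]
    exact intervalIntegrable_const
  weak_eq φ hφ hφc t _ := by
    simp [h φ hφ hφc]

lemma IsLyapunov.exists_isStationary (hL : IsLyapunov α β lam a b c₁ c₂ γ η h₀ K)
    (hc : IsCoeff α β lam C_A C_B A B) (hη : C_A + C_B ≤ η)
    (hsmall : 2 * K / γ * (C_B ^ 2 / c₁) ≤ 1 / 2) :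
    ∃ μ : ProbabilityMeasure (Phase d), IsStationary α β lam A B μ := by
  obtain ⟨M, hM⟩ : ∃ M, M = 2 * (2 * K * (‖A 0‖ + ‖B 0‖) ^ 2 + 2 * d) / γ := ⟨_, rfl⟩
  have hγ := hL.γ_pos
  have hK := hL.K_pos
  have hM0 : 0 ≤ M := by rw [hM]; positivity
  have hc1 := hL.c₁_pos
  set τ : ℕ → ℝ := fun n => min h₀ 1 * (1 / ((n : ℝ) + 1)) with hτ
  have hmin : 0 < min h₀ 1 := lt_min hL.h₀_pos one_pos
  have hτ0 : ∀ n, 0 < τ n := fun n => by positivity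
  have hτm : ∀ n, τ n ≤ min h₀ 1 := fun n => by
    refine mul_le_of_le_one_right hmin.le ?_
    rw [div_le_one (by positivity)]
    have : (0 : ℝ) ≤ n := Nat.cast_nonneg n
    linarith
  choose μ ν hμ hν _ hπ using fun n => hL.exists_almost_fixed hc hη hsmall hM (hτ0 n)
    ((hτm n).trans (min_le_left _ _)) (pow_pos (hτ0 n) 4)
  have htight := isTightMeasureSet_of_lintegral_sqNorm_le (M / c₁) (S := range μ) (by
    rintro _ ⟨n, rfl⟩
    exact hL.lintegral_sqNorm_le (hμ n))
  obtain ⟨m, -, ψ, hψ, hlim⟩ := (isCompact_closure_of_isTightMeasureSet htight).tendsto_subseq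
    (x := μ) fun n => subset_closure ⟨n, rfl⟩
  -- `M` does not depend on `τ`, so by lower semicontinuity the moment bound passes to the limit,
  -- which therefore has finite second moment.
  have hm : HasLyapMoment β a b M m :=
    lintegral_le_of_tendsto hlim (continuous_lyap β a b) hL.nonneg fun n => hμ (ψ n)
  refine ⟨m, isStationary_of_integral_generator_eq_zero (hL.finiteSecondMoment hm)
    fun φ hφ hφc => ?_⟩
  obtain ⟨D, hD⟩ := exists_isTestBound (zDir : Fin d → Phase d) hφ hφc
  obtain ⟨C, -, hC⟩ := hc.exists_abs_pairGen_le hD.hasBoundedDerivs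
  obtain ⟨C', hC'⟩ := hL.exists_abs_integral_generator_le hc hM0 hφ hφc
  -- Both arguments of `pairGen` carry the varying measure, so the convergence needed is that of the
  -- product measures.
  have hprod := tendsto_prod_self hlim
  have hsq := fun n => hc.pairGen_sq hφ hC (hL.finiteSecondMoment (hμ (ψ n)))
    (hL.integral_sqNorm_le hM0 (hμ (ψ n)))
  have hsqm := hc.pairGen_sq hφ hC (hL.finiteSecondMoment hm) (hL.integral_sqNorm_le hM0 hm)
  have t1 := tendsto_integral_of_sq_le hprod (hc.continuous_pairGen hφ) (fun n => (hsq n).1)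
    (fun n => (hsq n).2) hsqm.1 hsqm.2
  rw [hc.integral_generator_eq hφ hD.hasBoundedDerivs (hL.finiteSecondMoment hm)]
  have t2 : Tendsto (fun n => ∫ w, pairGen α β lam A B φ w
      ∂(((μ ∘ ψ) n).prod ((μ ∘ ψ) n) : Measure (Phase d × Phase d))) atTop (𝓝 0) := by
    refine squeeze_zero_norm (a := fun n => C' * √(τ (ψ n))) (fun n => ?_) ?_
    · rw [Function.comp_apply, ← hc.integral_generator_eq hφ hD.hasBoundedDerivs
        (hL.finiteSecondMoment (hμ (ψ n)))]
      exact hC' _ (hτ0 _) ((hτm _).trans (min_le_right _ _)) _ _ (hμ _) (hν _) (hπ _)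
    · have l1 : Tendsto τ atTop (𝓝 (min h₀ 1 * 0)) :=
        (tendsto_one_div_add_atTop_nhds_zero_nat (𝕜 := ℝ)).const_mul _
      rw [mul_zero] at l1
      have l2 := ((Real.continuous_sqrt.tendsto 0).comp (l1.comp hψ.tendsto_atTop)).const_mul C'
      simpa using l2
  exact tendsto_nhds_unique t1 t2

lemma W2_lt_top {μ ν : ProbabilityMeasure (Phase d)} (hμ : FiniteSecondMoment μ)
    (hν : FiniteSecondMoment ν) : W2 μ ν < ⊤ := by
  refine ENNReal.rpow_lt_top_of_nonneg (by norm_num) (ne_of_lt ?_)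
  refine (transportCost_le (c := sqNorm) (isCoupling_prod μ ν)).trans_lt ?_
  have hi := (isCoupling_prod μ ν).integrable_sqNorm_sub hμ hν
  rw [← ofReal_integral_eq_lintegral_ofReal hi (ae_of_all _ fun w => sqNorm_nonneg _)]
  exact ENNReal.ofReal_lt_top

end Stationary

end GenVlasov

/-! ### Choice of the constants and conclusion. -/

theorem theorem1 (α β lam : ℝ) (hα : 0 < α) (hβ : 0 < β) (hlam : 0 < lam) :
    ∃ η₀ : ℝ, 0 < η₀ ∧
    ∀ C_A C_B : ℝ, 0 ≤ C_A → 0 ≤ C_B → C_A + C_B < η₀ →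
    ∃ C C' : ℝ, 0 < C ∧ 0 < C' ∧
    ∀ (d : ℕ) (A B : GenVlasov.Vec d → GenVlasov.Vec d),
      (∀ q₁ q₂ : GenVlasov.Vec d, ‖A q₁ - A q₂‖ ≤ C_A * ‖q₁ - q₂‖) →
      (∀ q₁ q₂ : GenVlasov.Vec d, ‖B q₁ - B q₂‖ ≤ C_B * ‖q₁ - q₂‖) →
      (∀ q : GenVlasov.Vec d, B (-q) = -B q) →
      (∀ ρ ρ' : ℝ → ProbabilityMeasure (GenVlasov.Phase d),
        GenVlasov.IsSolution α β lam A B ρ → GenVlasov.IsSolution α β lam A B ρ' →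
        ∀ t : ℝ, 0 ≤ t →
          GenVlasov.W2 (ρ t) (ρ' t) ≤
            ENNReal.ofReal (C' * Real.exp (-C * t)) * GenVlasov.W2 (ρ 0) (ρ' 0)) ∧
      ∃ ρ_inf : ProbabilityMeasure (GenVlasov.Phase d),
        GenVlasov.IsStationary α β lam A B ρ_inf ∧
        (∀ μ : ProbabilityMeasure (GenVlasov.Phase d),
          GenVlasov.IsStationary α β lam A B μ → μ = ρ_inf) ∧
        ∀ ρ : ℝ → ProbabilityMeasure (GenVlasov.Phase d),
          GenVlasov.IsSolution α β lam A B ρ → ∀ t : ℝ, 0 ≤ t →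
            GenVlasov.W2 (ρ t) ρ_inf ≤
              ENNReal.ofReal (C' * Real.exp (-C * t)) * GenVlasov.W2 (ρ 0) ρ_inf := by
  obtain ⟨a, b, c₁, c₂, γ, η, h₀, K, hL⟩ := GenVlasov.exists_isLyapunov hα hβ hlam
  have hγ := hL.γ_pos
  have hK := hL.K_pos
  have hc₁ := hL.c₁_pos
  have hc₂ := hL.c₂_pos
  have hη := hL.η_pos
  -- The first threshold keeps the Lipschitz forces inside the tolerance of the Lyapunov form. The
  -- second gives `C_B ^ 2 ≤ c₁ γ / (4 K)`, which makes the feedback factor of the mean field at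
  -- most `1/2`.
  refine ⟨min η (√(c₁ * γ / (4 * K))), by positivity, fun C_A C_B hCA hCB hAB => ?_⟩
  have hABη : C_A + C_B ≤ η := hAB.le.trans (min_le_left _ _)
  have hsmall : 2 * K / γ * (C_B ^ 2 / c₁) ≤ 1 / 2 := by
    have h1 : C_B ≤ √(c₁ * γ / (4 * K)) := by
      have := hAB.le.trans (min_le_right _ _)
      linarith
    have h2 := pow_le_pow_left₀ hCB h1 2
    rw [Real.sq_sqrt (by positivity)] at h2
    calc 2 * K / γ * (C_B ^ 2 / c₁) ≤ 2 * K / γ * (c₁ * γ / (4 * K) / c₁) := by gcongr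
      _ = 1 / 2 := by field_simp; norm_num
  -- The quadratic cost decays at rate `γ / 2` with prefactor `2`, times `c₂ / c₁` for the change of
  -- form; the square root gives both constants.
  refine ⟨γ / 4, √(2 * c₂ / c₁), by positivity, by positivity, fun d A B hA hB _ => ?_⟩
  have hc : GenVlasov.IsCoeff α β lam C_A C_B A B := ⟨hα.le, hβ.le, hlam.le, hCA, hCB, hA, hB⟩
  have contr : ∀ ρ ρ' : ℝ → ProbabilityMeasure (GenVlasov.Phase d),
      GenVlasov.IsSolution α β lam A B ρ → GenVlasov.IsSolution α β lam A B ρ' →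
      ∀ t : ℝ, 0 ≤ t → GenVlasov.W2 (ρ t) (ρ' t) ≤
        ENNReal.ofReal (√(2 * c₂ / c₁) * Real.exp (-(γ / 4) * t)) * GenVlasov.W2 (ρ 0) (ρ' 0) :=
    fun ρ ρ' h h' t ht => hL.W2_le hc hABη hsmall h h' ht
  obtain ⟨m, hm⟩ := hL.exists_isStationary hc hABη hsmall
  refine ⟨contr, m, hm, fun μ hμ => GenVlasov.eq_of_W2_eq_zero ?_,
    fun ρ hρ t ht => contr ρ (fun _ => m) hρ hm t ht⟩
  -- Finiteness is essential for uniqueness: `W2 μ m` is bounded by a vanishing factor times itself,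
  -- which forces zero only if it is finite.
  have hfin : GenVlasov.W2 μ m ≠ ⊤ :=
    (GenVlasov.W2_lt_top (hμ.secondMoment 0 le_rfl) (hm.secondMoment 0 le_rfl)).ne
  have lim : Filter.Tendsto (fun t : ℝ =>
      ENNReal.ofReal (√(2 * c₂ / c₁) * Real.exp (-(γ / 4) * t)) * GenVlasov.W2 μ m)
      Filter.atTop (nhds (ENNReal.ofReal (√(2 * c₂ / c₁) * 0) * GenVlasov.W2 μ m)) := by
    refine ENNReal.Tendsto.mul_const (ENNReal.tendsto_ofReal (Filter.Tendsto.const_mul _ ?_))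
      (Or.inr hfin)
    refine Real.tendsto_exp_atBot.comp ?_
    exact Filter.tendsto_id.const_mul_atTop_of_neg (by linarith)
  rw [mul_zero, ENNReal.ofReal_zero, zero_mul] at lim
  refine le_antisymm (ge_of_tendsto lim ?_) zero_le
  filter_upwards [Filter.eventually_ge_atTop 0] with t ht
  exact contr (fun _ => μ) (fun _ => m) hμ hm t ht
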